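/- **Kripke canonicity gluing model for calf.** *Calf.* Fix a monoid $(K,+,0)$ of costs. Calf over $K$ is the dependent call-by-push-value theory with the following judgments, constants and equations. - Judgments: value types $A:\mathsf{tp}^+$, computation types $X:\mathsf{tp}^-$, terms $\mathsf{tm}(A)$ of a value type, and a proposition $\mathsf{beh}$, the behavioral phase (it has at most one proof). Contexts are extended by variables $x:\mathsf{tm}(A)$ and by assumptions $z:\mathsf{beh}$. Computations of type $X$ are elements of $\mathsf{tm}(\mathsf U X)$. - Free-forgetful structure: $\mathsf U:\mathsf{tp}^-\to\mathsf{tp}^+$, $\mathsf F:\mathsf{tp}^+\to\mathsf{tp}^-$, $\mathsf{ret}:\mathsf{tm}(A)\to\mathsf{tm}(\mathsf{UF}A)$, and $\mathsf{bind}:\mathsf{tm}(\mathsf{UF}A)\to(\mathsf{tm}(A)\to\mathsf{tm}(\mathsf UX))\to\mathsf{tm}(\mathsf UX)$, subject to the two unit laws and associativity. - Cost: a value type $\mathbb C$ with constants $\bar k$ ($k\in K$) and an addition such that $\mathbb C$ is a monoid with unit $\bar 0$ and $\overline{k+l}=\bar k+\bar l$; and $\mathsf{step}^{c}:\mathsf{tm}(\mathsf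 UX)\to\mathsf{tm}(\mathsf UX)$ for $c:\mathsf{tm}(\mathbb C)$, with $\mathsf{step}^{\bar0}e=e$, $\mathsf{step}^{c+d}e=\mathsf{step}^c\mathsf{step}^d e$, $\mathsf{bind}(\mathsf{step}^c e,f)=\mathsf{step}^c\,\mathsf{bind}(e,f)$, and $\mathsf{step}^c e=e$ whenever $\mathsf{beh}$ holds. - Connectives: dependent products $\Pi(A;X):\mathsf{tp}^-$ of computation types, with $\beta$, $\eta$ and $(\mathsf{step}^c f)\,a=\mathsf{step}^c(f\,a)$; dependent sums of value types with $\beta$ and $\eta$; extensional equality types; booleans with elimination into arbitrary families and $\beta$; the open modality $\mathsf{beh}\to A$ with $\beta$ and $\eta$; and the closed modality $\bullet A$, the join of $A$ and $\mathsf{beh}$, with constructors $\eta:\mathsf{tm}(A)\to\mathsf{tm}(\bullet A)$ and $\star:\mathsf{beh}\to\mathsf{tm}(\bullet A)$ that agree under $\mathsf{beh}$, and with elimination by matching cases into arbitrary families and $\beta$. A *model* of calf is a locally small category $\mathcal T$ of contexts and substitutions with a terminal object, presheaves of value types, computation types and terms, a presheaf of propositions $\mathsf{beh}$, chosen context extensions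 by variables and by $\mathsf{beh}$ with their universal properties, and operations for all the above constants, stable under substitution and satisfying the equations. A *morphism* of models is a functor together with maps of types and terms that preserves all of this structure strictly. The *syntactic model* is the initial model. *Gluing.* Let $\mathbb 2=\{\mathsf{beh}\to\top\}$ be the poset of two worlds. Each model $\mathcal T$ has a diagram $\mathbb 2\to\mathcal T$ sending $\top$ to the empty context $1$ and $\mathsf{beh}$ to the context $(z:\mathsf{beh})$, and hence a phase-separated global sections functor $\rho:\mathcal T\to\mathrm{Psh}(\mathbb 2)$ with $\rho(\Gamma)(\top)=\mathcal T(1,\Gamma)$ and $\rho(\Gamma)(\mathsf{beh})=\mathcal T((z:\mathsf{beh}),\Gamma)$. Let $\mathcal G=\mathrm{Psh}(\mathbb 2)\downarrow\rho$ be the gluing category, with objects $(P,\Gamma,P\to\rho\Gamma)$, and let $\pi:\mathcal G\to\mathcal T$ be the projection. **Theorem.** For every model $\mathcal T$ of calf over $K$, the category $\mathcal G$ carries a model of calf over $K$ such that the projection $\pi:\mathcal G\to\mathcal T$ is a morphism of models and, for every object $G=(P,\Gamma,P\to\rho\Gamma)$ of $\mathcal G$: 1. *Phase.* $\mathsf{beh}$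 holds in $G$ iff it holds in $\Gamma$ in $\mathcal T$ and $P(\top)=\varnothing$. 2. *Value types.* For each value type $B$ of $\mathcal T$ over $\Gamma$ and each proof-relevant Kripke predicate on $B$ over $P$ (a presheaf $Q\to P$ on $\mathbb 2$ with an assignment, compatible with restriction, of terms of type $B$ instantiated at the underlying element of $P$) there is a value type $A$ over $G$ with $\pi A=B$ whose semantic component is isomorphic to $Q$ over $P$ and over the terms of $B$. 3. *Computation types.* The same holds for each computation type $Y$ over $\Gamma$ and each Kripke predicate on $\mathsf UY$ that carries an action of $K$ lying over $\mathsf{step}$ and over the identity of $P$ and trivial at the world $\mathsf{beh}$; the isomorphism carries this action to the semantic $\mathsf{step}$. 4. *Canonical booleans and costs.* At each world $w$, the semantic component of $G,x:\mathsf{bool}$ is $P(w)\times\{\mathsf{true},\mathsf{false}\}$ and that of $G,x:\mathbb C$ is $P(w)\times K$, via the constants. 5. *Writer monad.* For each value type $A$ over $G$, the semantic component of $G,y:\mathsf{UF}A$ is, at $\top$, that of $G,x:A$ times $K$, via $(x,k)\mapsto\mathsf{step}^{\bar k}(\mathsf{ret}\,x)$, and, at $\mathsf{beh}$, that of $G,x:A$,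 via $x\mapsto\mathsf{ret}\,x$. If there is a morphism of models $\iota:\mathcal T\to\mathcal G$ with $\pi\circ\iota=\mathrm{id}$, then $\mathcal T$ satisfies *canonicity*: - in the empty context and in the context $(z:\mathsf{beh})$, every boolean is equal to exactly one of $\mathsf{true}$, $\mathsf{false}$, and every cost is equal to $\bar k$ for exactly one $k\in K$; - every closed $e:\mathsf{tm}(\mathsf{UF}A)$ equals $\mathsf{step}^{\bar k}(\mathsf{ret}\,a)$ for exactly one pair $(k,a)$; in particular every closed $e:\mathsf{tm}(\mathsf{UF}\,\mathsf{bool})$ equals $\mathsf{step}^{\bar k}(\mathsf{ret}\,b)$ for exactly one $k\in K$ and one $b\in\{\mathsf{true},\mathsf{false}\}$; - in the context $(z:\mathsf{beh})$, every $e:\mathsf{tm}(\mathsf{UF}A)$ equals $\mathsf{ret}\,a$ for exactly one $a$; in particular every $e:\mathsf{tm}(\mathsf{UF}\,\mathsf{bool})$ equals $\mathsf{ret}\,b$ for exactly one $b\in\{\mathsf{true},\mathsf{false}\}$. If $\mathcal T$ is the syntactic model, then there is exactly one such $\iota$, and hence canonicity holds. -/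

import Mathlib

open CategoryTheory Opposite

universe u

namespace Calf

/-- The judgmental structure of calf on a category `C` of contexts and substitutions: a judgment
`TyP` of value types (tp⁺), a judgment `TyN` of computation types (tp⁻), a judgment `Tm` of terms,
each term carrying its value type, and a proposition `Beh`, the behavioral phase.  Contexts are
extended by term variables (`ext`) and by an assumption of the phase (`extBeh`). -/
structure Judgments (C : Type (u + 1)) [Category.{u} C] where
  /-- the empty context -/
  one : C
  isTerminal : Limits.IsTerminal one
  /-- value types -/
  TyP : C → Type (u + 1)
  /-- computation types -/
  TyN : C → Type (u + 1)
  /-- terms of arbitrary value type -/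
  Tm : C → Type (u + 1)
  ty {Γ : C} : Tm Γ → TyP Γ
  subP {Δ Γ : C} : (Δ ⟶ Γ) → TyP Γ → TyP Δ
  subP_id {Γ : C} (A : TyP Γ) : subP (𝟙 Γ) A = A
  subP_comp {Θ Δ Γ : C} (τ : Θ ⟶ Δ) (σ : Δ ⟶ Γ) (A : TyP Γ) :
    subP (τ ≫ σ) A = subP τ (subP σ A)
  subN {Δ Γ : C} : (Δ ⟶ Γ) → TyN Γ → TyN Δ
  subN_id {Γ : C} (X : TyN Γ) : subN (𝟙 Γ) X = X
  subN_comp {Θ Δ Γ : C} (τ : Θ ⟶ Δ) (σ : Δ ⟶ Γ) (X : TyN Γ) :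
    subN (τ ≫ σ) X = subN τ (subN σ X)
  subT {Δ Γ : C} : (Δ ⟶ Γ) → Tm Γ → Tm Δ
  subT_id {Γ : C} (a : Tm Γ) : subT (𝟙 Γ) a = a
  subT_comp {Θ Δ Γ : C} (τ : Θ ⟶ Δ) (σ : Δ ⟶ Γ) (a : Tm Γ) :
    subT (τ ≫ σ) a = subT τ (subT σ a)
  ty_sub {Δ Γ : C} (σ : Δ ⟶ Γ) (a : Tm Γ) : ty (subT σ a) = subP σ (ty a)
  /-- the context `Γ, x : A` -/
  ext {Γ : C} (A : TyP Γ) : C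
  wk {Γ : C} (A : TyP Γ) : ext A ⟶ Γ
  var {Γ : C} (A : TyP Γ) : Tm (ext A)
  ty_var {Γ : C} (A : TyP Γ) : ty (var A) = subP (wk A) A
  lift {Δ Γ : C} (σ : Δ ⟶ Γ) (A : TyP Γ) (a : Tm Δ) (h : ty a = subP σ A) : Δ ⟶ ext A
  lift_wk {Δ Γ : C} (σ : Δ ⟶ Γ) (A : TyP Γ) (a : Tm Δ) (h : ty a = subP σ A) :
    lift σ A a h ≫ wk A = σ
  lift_var {Δ Γ : C} (σ : Δ ⟶ Γ) (A : TyP Γ) (a : Tm Δ) (h : ty a = subP σ A) :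
    subT (lift σ A a h) (var A) = a
  ext_hom_ext {Δ Γ : C} (A : TyP Γ) (τ τ' : Δ ⟶ ext A) (h : τ ≫ wk A = τ' ≫ wk A)
    (h' : subT τ (var A) = subT τ' (var A)) : τ = τ'
  /-- the behavioral phase; being a proposition, it has at most one proof in each context -/
  Beh : C → Prop
  beh_sub {Δ Γ : C} (σ : Δ ⟶ Γ) : Beh Γ → Beh Δ
  /-- the context `Γ, z : beh` -/
  extBeh (Γ : C) : C
  wkBeh (Γ : C) : extBeh Γ ⟶ Γ
  beh_extBeh (Γ : C) : Beh (extBeh Γ)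
  liftBeh {Δ Γ : C} (σ : Δ ⟶ Γ) (h : Beh Δ) : Δ ⟶ extBeh Γ
  liftBeh_wk {Δ Γ : C} (σ : Δ ⟶ Γ) (h : Beh Δ) : liftBeh σ h ≫ wkBeh Γ = σ
  extBeh_hom_ext {Δ Γ : C} (τ τ' : Δ ⟶ extBeh Γ) (h : τ ≫ wkBeh Γ = τ' ≫ wkBeh Γ) : τ = τ'

namespace Judgments

variable {C : Type (u + 1)} [Category.{u} C] (J : Judgments C)

/-- Terms of value type `A`. -/
def El {Γ : C} (A : J.TyP Γ) : Type (u + 1) := {a : J.Tm Γ // J.ty a = A}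

variable {J}

def El.cast {Γ : C} {A B : J.TyP Γ} (a : J.El A) (h : A = B) : J.El B := ⟨a.1, a.2.trans h⟩

def El.sub {Δ Γ : C} {A : J.TyP Γ} (a : J.El A) (σ : Δ ⟶ Γ) : J.El (J.subP σ A) :=
  ⟨J.subT σ a.1, by rw [J.ty_sub, a.2]⟩

variable (J)

/-- The last variable of `Γ, x : A`. -/
def v {Γ : C} (A : J.TyP Γ) : J.El (J.subP (J.wk A) A) := ⟨J.var A, J.ty_var A⟩

def liftEl {Δ Γ : C} (σ : Δ ⟶ Γ) {A : J.TyP Γ} (a : J.El (J.subP σ A)) : Δ ⟶ J.ext A :=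
  J.lift σ A a.1 a.2

/-- The substitution `[a/x] : Γ ⟶ (Γ, x : A)`. -/
def inst {Γ : C} {A : J.TyP Γ} (a : J.El A) : Γ ⟶ J.ext A :=
  J.liftEl (𝟙 Γ) (a.cast (J.subP_id A).symm)

/-- The substitution `σ` under a binder, `(Δ, x : A[σ]) ⟶ (Γ, x : A)`. -/
def up {Δ Γ : C} (σ : Δ ⟶ Γ) {A : J.TyP Γ} {A' : J.TyP Δ} (h : J.subP σ A = A') :
    J.ext A' ⟶ J.ext A :=
  J.lift (J.wk A' ≫ σ) A (J.var A') (by rw [J.ty_var, J.subP_comp, h])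

/-- The substitution `σ` under an assumption of the phase. -/
def upBeh {Δ Γ : C} (σ : Δ ⟶ Γ) : J.extBeh Δ ⟶ J.extBeh Γ :=
  J.liftBeh (J.wkBeh Δ ≫ σ) (J.beh_extBeh Δ)

theorem inst_wk {Γ : C} {A : J.TyP Γ} (a : J.El A) : J.inst a ≫ J.wk A = 𝟙 Γ :=
  J.lift_wk _ _ _ _

theorem inst_var {Γ : C} {A : J.TyP Γ} (a : J.El A) : J.subT (J.inst a) (J.var A) = a.1 :=
  J.lift_var _ _ _ _

theorem up_wk {Δ Γ : C} (σ : Δ ⟶ Γ) {A : J.TyP Γ} {A' : J.TyP Δ} (h : J.subP σ A = A') :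
    J.up σ h ≫ J.wk A = J.wk A' ≫ σ :=
  J.lift_wk _ _ _ _

theorem up_var {Δ Γ : C} (σ : Δ ⟶ Γ) {A : J.TyP Γ} {A' : J.TyP Δ} (h : J.subP σ A = A') :
    J.subT (J.up σ h) (J.var A) = J.var A' :=
  J.lift_var _ _ _ _

theorem subP_up_wk {Δ Γ : C} (σ : Δ ⟶ Γ) {A : J.TyP Γ} {A' : J.TyP Δ} (h : J.subP σ A = A')
    (B : J.TyP Γ) :
    J.subP (J.up σ h) (J.subP (J.wk A) B) = J.subP (J.wk A') (J.subP σ B) := by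
  rw [← J.subP_comp, J.up_wk, J.subP_comp]

theorem inst_up {Δ Γ : C} (σ : Δ ⟶ Γ) {A : J.TyP Γ} {A' : J.TyP Δ} (h : J.subP σ A = A')
    (a : J.El A) (a' : J.El A') (ha : a'.1 = J.subT σ a.1) :
    J.inst a' ≫ J.up σ h = σ ≫ J.inst a := by
  apply J.ext_hom_ext
  · rw [Category.assoc, Category.assoc, J.up_wk, J.inst_wk, ← Category.assoc, J.inst_wk,
      Category.id_comp, Category.comp_id]
  · rw [J.subT_comp, J.subT_comp, J.up_var, J.inst_var, J.inst_var, ha]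

theorem subP_inst_up {Δ Γ : C} (σ : Δ ⟶ Γ) {A : J.TyP Γ} {A' : J.TyP Δ} (h : J.subP σ A = A')
    (a : J.El A) (a' : J.El A') (ha : a'.1 = J.subT σ a.1) (B : J.TyP (J.ext A)) :
    J.subP σ (J.subP (J.inst a) B) = J.subP (J.inst a') (J.subP (J.up σ h) B) := by
  rw [← J.subP_comp, ← J.subP_comp, J.inst_up σ h a a' ha]

end Judgments

/-- A model of calf over a cost monoid `K`: the judgments together with the constants and equations
of calf.  Computations of type `X` are the terms of the value type `U X`.  Operations that bind
variables act on terms and types in the extended context, and everything is stable under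
substitution. -/
structure Model (K : Type u) [AddMonoid K] (C : Type (u + 1)) [Category.{u} C] where
  J : Judgments C
  -- thunks of computations, and free computations
  U {Γ : C} : J.TyN Γ → J.TyP Γ
  U_sub {Δ Γ : C} (σ : Δ ⟶ Γ) (X : J.TyN Γ) : J.subP σ (U X) = U (J.subN σ X)
  F {Γ : C} : J.TyP Γ → J.TyN Γ
  F_sub {Δ Γ : C} (σ : Δ ⟶ Γ) (A : J.TyP Γ) : J.subN σ (F A) = F (J.subP σ A)
  ret {Γ : C} {A : J.TyP Γ} (a : J.El A) : J.El (U (F A))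
  ret_sub {Δ Γ : C} (σ : Δ ⟶ Γ) {A : J.TyP Γ} (a : J.El A) :
    ((ret a).sub σ).1 = (ret (a.sub σ)).1
  bind {Γ : C} {A : J.TyP Γ} {X : J.TyN Γ} (e : J.El (U (F A))) (f : J.El (J.subP (J.wk A) (U X))) :
    J.El (U X)
  bind_sub {Δ Γ : C} (σ : Δ ⟶ Γ) {A : J.TyP Γ} {X : J.TyN Γ} (e : J.El (U (F A)))
    (f : J.El (J.subP (J.wk A) (U X))) :
    ((bind e f).sub σ).1 =
      (bind (A := J.subP σ A) (X := J.subN σ X) ((e.sub σ).cast (by rw [U_sub, F_sub]))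
        ((f.sub (J.up σ rfl)).cast (by rw [J.subP_up_wk, U_sub]))).1
  bind_ret {Γ : C} {A : J.TyP Γ} {X : J.TyN Γ} (a : J.El A) (f : J.El (J.subP (J.wk A) (U X))) :
    (bind (ret a) f).1 = (f.sub (J.inst a)).1
  bind_eta {Γ : C} {A : J.TyP Γ} (e : J.El (U (F A))) :
    bind e ((ret (J.v A)).cast (by rw [U_sub, F_sub])) = e
  bind_assoc {Γ : C} {A B : J.TyP Γ} {X : J.TyN Γ} (e : J.El (U (F A)))
    (f : J.El (J.subP (J.wk A) (U (F B)))) (g : J.El (J.subP (J.wk B) (U X))) :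
    bind (bind e f) g =
      bind e ((bind (A := J.subP (J.wk A) B) (X := J.subN (J.wk A) X)
        (f.cast (by rw [U_sub, F_sub]))
        ((g.sub (J.up (J.wk A) rfl)).cast (by rw [J.subP_up_wk, U_sub, U_sub]))).cast
          (U_sub (J.wk A) X).symm)
  -- the type of costs, with its monoid structure and the numerals from `K`
  cost (Γ : C) : J.TyP Γ
  cost_sub {Δ Γ : C} (σ : Δ ⟶ Γ) : J.subP σ (cost Γ) = cost Δ
  cst (Γ : C) (k : K) : J.El (cost Γ)
  cst_sub {Δ Γ : C} (σ : Δ ⟶ Γ) (k : K) : ((cst Γ k).sub σ).1 = (cst Δ k).1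
  add {Γ : C} (c d : J.El (cost Γ)) : J.El (cost Γ)
  add_sub {Δ Γ : C} (σ : Δ ⟶ Γ) (c d : J.El (cost Γ)) :
    ((add c d).sub σ).1 = (add ((c.sub σ).cast (cost_sub σ)) ((d.sub σ).cast (cost_sub σ))).1
  zero_add {Γ : C} (c : J.El (cost Γ)) : add (cst Γ 0) c = c
  add_zero {Γ : C} (c : J.El (cost Γ)) : add c (cst Γ 0) = c
  add_assoc {Γ : C} (c d e : J.El (cost Γ)) : add (add c d) e = add c (add d e)
  cst_add (Γ : C) (k l : K) : cst Γ (k + l) = add (cst Γ k) (cst Γ l)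
  -- the cost effect, erased in the behavioral phase
  step {Γ : C} {X : J.TyN Γ} (c : J.El (cost Γ)) (e : J.El (U X)) : J.El (U X)
  step_sub {Δ Γ : C} (σ : Δ ⟶ Γ) {X : J.TyN Γ} (c : J.El (cost Γ)) (e : J.El (U X)) :
    ((step c e).sub σ).1 = (step ((c.sub σ).cast (cost_sub σ)) ((e.sub σ).cast (U_sub σ X))).1
  step_zero {Γ : C} {X : J.TyN Γ} (e : J.El (U X)) : step (cst Γ 0) e = e
  step_add {Γ : C} {X : J.TyN Γ} (c d : J.El (cost Γ)) (e : J.El (U X)) :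
    step (add c d) e = step c (step d e)
  step_beh {Γ : C} (h : J.Beh Γ) {X : J.TyN Γ} (c : J.El (cost Γ)) (e : J.El (U X)) : step c e = e
  bind_step {Γ : C} {A : J.TyP Γ} {X : J.TyN Γ} (c : J.El (cost Γ)) (e : J.El (U (F A)))
    (f : J.El (J.subP (J.wk A) (U X))) : bind (step c e) f = step c (bind e f)
  -- dependent products, which are computation types; `app f` is `f x` in context `Γ, x : A`
  Pi {Γ : C} (A : J.TyP Γ) (X : J.TyN (J.ext A)) : J.TyN Γ
  Pi_sub {Δ Γ : C} (σ : Δ ⟶ Γ) (A : J.TyP Γ) (X : J.TyN (J.ext A)) :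
    J.subN σ (Pi A X) = Pi (J.subP σ A) (J.subN (J.up σ rfl) X)
  lam {Γ : C} {A : J.TyP Γ} {X : J.TyN (J.ext A)} (e : J.El (U X)) : J.El (U (Pi A X))
  lam_sub {Δ Γ : C} (σ : Δ ⟶ Γ) {A : J.TyP Γ} {X : J.TyN (J.ext A)} (e : J.El (U X)) :
    ((lam e).sub σ).1 = (lam ((e.sub (J.up σ rfl)).cast (U_sub _ X))).1
  app {Γ : C} {A : J.TyP Γ} {X : J.TyN (J.ext A)} (f : J.El (U (Pi A X))) : J.El (U X)
  app_lam {Γ : C} {A : J.TyP Γ} {X : J.TyN (J.ext A)} (e : J.El (U X)) : app (lam e) = e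
  lam_app {Γ : C} {A : J.TyP Γ} {X : J.TyN (J.ext A)} (f : J.El (U (Pi A X))) : lam (app f) = f
  app_step {Γ : C} {A : J.TyP Γ} {X : J.TyN (J.ext A)} (c : J.El (cost Γ)) (f : J.El (U (Pi A X))) :
    app (step c f) = step ((c.sub (J.wk A)).cast (cost_sub _)) (app f)
  -- dependent sums of value types
  Sig {Γ : C} (A : J.TyP Γ) (B : J.TyP (J.ext A)) : J.TyP Γ
  Sig_sub {Δ Γ : C} (σ : Δ ⟶ Γ) (A : J.TyP Γ) (B : J.TyP (J.ext A)) :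
    J.subP σ (Sig A B) = Sig (J.subP σ A) (J.subP (J.up σ rfl) B)
  pair {Γ : C} {A : J.TyP Γ} {B : J.TyP (J.ext A)} (a : J.El A) (b : J.El (J.subP (J.inst a) B)) :
    J.El (Sig A B)
  pair_sub {Δ Γ : C} (σ : Δ ⟶ Γ) {A : J.TyP Γ} {B : J.TyP (J.ext A)} (a : J.El A)
    (b : J.El (J.subP (J.inst a) B)) :
    ((pair a b).sub σ).1 =
      (pair (A := J.subP σ A) (B := J.subP (J.up σ rfl) B) (a.sub σ)
        ((b.sub σ).cast (J.subP_inst_up σ rfl a (a.sub σ) rfl B))).1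
  fst {Γ : C} {A : J.TyP Γ} {B : J.TyP (J.ext A)} (p : J.El (Sig A B)) : J.El A
  snd {Γ : C} {A : J.TyP Γ} {B : J.TyP (J.ext A)} (p : J.El (Sig A B)) :
    J.El (J.subP (J.inst (fst p)) B)
  fst_pair {Γ : C} {A : J.TyP Γ} {B : J.TyP (J.ext A)} (a : J.El A) (b : J.El (J.subP (J.inst a) B)) :
    fst (pair a b) = a
  snd_pair {Γ : C} {A : J.TyP Γ} {B : J.TyP (J.ext A)} (a : J.El A) (b : J.El (J.subP (J.inst a) B)) :
    (snd (pair a b)).1 = b.1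
  pair_eta {Γ : C} {A : J.TyP Γ} {B : J.TyP (J.ext A)} (p : J.El (Sig A B)) : pair (fst p) (snd p) = p
  -- extensional equality types
  EqTy {Γ : C} {A : J.TyP Γ} (a b : J.El A) : J.TyP Γ
  EqTy_sub {Δ Γ : C} (σ : Δ ⟶ Γ) {A : J.TyP Γ} (a b : J.El A) :
    J.subP σ (EqTy a b) = EqTy (a.sub σ) (b.sub σ)
  eqRefl {Γ : C} {A : J.TyP Γ} (a : J.El A) : J.El (EqTy a a)
  eqReflect {Γ : C} {A : J.TyP Γ} {a b : J.El A} (p : J.El (EqTy a b)) : a = b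
  eqUnique {Γ : C} {A : J.TyP Γ} {a b : J.El A} (p q : J.El (EqTy a b)) : p = q
  -- booleans, eliminating into arbitrary families
  bool (Γ : C) : J.TyP Γ
  bool_sub {Δ Γ : C} (σ : Δ ⟶ Γ) : J.subP σ (bool Γ) = bool Δ
  boolLit (Γ : C) (x : Bool) : J.El (bool Γ)
  boolLit_sub {Δ Γ : C} (σ : Δ ⟶ Γ) (x : Bool) :
    ((boolLit Γ x).sub σ).1 = (boolLit Δ x).1
  boolRec {Γ : C} (D : J.TyP (J.ext (bool Γ))) (b : J.El (bool Γ))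
    (t : J.El (J.subP (J.inst (boolLit Γ true)) D)) (f : J.El (J.subP (J.inst (boolLit Γ false)) D)) :
    J.El (J.subP (J.inst b) D)
  boolRec_sub {Δ Γ : C} (σ : Δ ⟶ Γ) (D : J.TyP (J.ext (bool Γ))) (b : J.El (bool Γ))
    (t : J.El (J.subP (J.inst (boolLit Γ true)) D)) (f : J.El (J.subP (J.inst (boolLit Γ false)) D)) :
    ((boolRec D b t f).sub σ).1 =
      (boolRec (J.subP (J.up σ (bool_sub σ)) D) ((b.sub σ).cast (bool_sub σ))
        ((t.sub σ).cast (J.subP_inst_up σ _ _ _ (boolLit_sub σ true).symm D))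
        ((f.sub σ).cast (J.subP_inst_up σ _ _ _ (boolLit_sub σ false).symm D))).1
  boolRec_true {Γ : C} (D : J.TyP (J.ext (bool Γ)))
    (t : J.El (J.subP (J.inst (boolLit Γ true)) D)) (f : J.El (J.subP (J.inst (boolLit Γ false)) D)) :
    boolRec D (boolLit Γ true) t f = t
  boolRec_false {Γ : C} (D : J.TyP (J.ext (bool Γ)))
    (t : J.El (J.subP (J.inst (boolLit Γ true)) D)) (f : J.El (J.subP (J.inst (boolLit Γ false)) D)) :
    boolRec D (boolLit Γ false) t f = f
  -- the open modality of the behavioral phase: functions out of `beh`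
  Op {Γ : C} (A : J.TyP (J.extBeh Γ)) : J.TyP Γ
  Op_sub {Δ Γ : C} (σ : Δ ⟶ Γ) (A : J.TyP (J.extBeh Γ)) : J.subP σ (Op A) = Op (J.subP (J.upBeh σ) A)
  opLam {Γ : C} {A : J.TyP (J.extBeh Γ)} (a : J.El A) : J.El (Op A)
  opLam_sub {Δ Γ : C} (σ : Δ ⟶ Γ) {A : J.TyP (J.extBeh Γ)} (a : J.El A) :
    ((opLam a).sub σ).1 = (opLam (a.sub (J.upBeh σ))).1
  opApp {Γ : C} {A : J.TyP (J.extBeh Γ)} (p : J.El (Op A)) : J.El A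
  opApp_opLam {Γ : C} {A : J.TyP (J.extBeh Γ)} (a : J.El A) : opApp (opLam a) = a
  opLam_opApp {Γ : C} {A : J.TyP (J.extBeh Γ)} (p : J.El (Op A)) : opLam (opApp p) = p
  -- the closed modality of the behavioral phase: the join of `A` with `beh`
  Cl {Γ : C} (A : J.TyP Γ) : J.TyP Γ
  Cl_sub {Δ Γ : C} (σ : Δ ⟶ Γ) (A : J.TyP Γ) : J.subP σ (Cl A) = Cl (J.subP σ A)
  clEta {Γ : C} {A : J.TyP Γ} (a : J.El A) : J.El (Cl A)
  clEta_sub {Δ Γ : C} (σ : Δ ⟶ Γ) {A : J.TyP Γ} (a : J.El A) :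
    ((clEta a).sub σ).1 = (clEta (a.sub σ)).1
  star {Γ : C} (A : J.TyP Γ) (h : J.Beh Γ) : J.El (Cl A)
  star_sub {Δ Γ : C} (σ : Δ ⟶ Γ) (A : J.TyP Γ) (h : J.Beh Γ) :
    ((star A h).sub σ).1 = (star (J.subP σ A) (J.beh_sub σ h)).1
  clEta_beh {Γ : C} {A : J.TyP Γ} (a : J.El A) (h : J.Beh Γ) : clEta a = star A h
  /-- Case analysis on `● A`: a case `x := clEta a`, a case `z : beh`, and their agreement when both
  apply. -/
  clRec {Γ : C} {A : J.TyP Γ} (D : J.TyP (J.ext (Cl A)))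
    (f : J.El (J.subP (J.liftEl (J.wk A) ((clEta (J.v A)).cast (Cl_sub _ A).symm)) D))
    (g : J.El (J.subP (J.liftEl (J.wkBeh Γ) ((star _ (J.beh_extBeh Γ)).cast (Cl_sub _ A).symm)) D))
    (coh : J.subT (J.wkBeh (J.ext A)) f.1 = J.subT (J.upBeh (J.wk A)) g.1)
    (e : J.El (Cl A)) : J.El (J.subP (J.inst e) D)
  clRec_eta {Γ : C} {A : J.TyP Γ} (D : J.TyP (J.ext (Cl A)))
    (f : J.El (J.subP (J.liftEl (J.wk A) ((clEta (J.v A)).cast (Cl_sub _ A).symm)) D))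
    (g : J.El (J.subP (J.liftEl (J.wkBeh Γ) ((star _ (J.beh_extBeh Γ)).cast (Cl_sub _ A).symm)) D))
    (coh : J.subT (J.wkBeh (J.ext A)) f.1 = J.subT (J.upBeh (J.wk A)) g.1) (a : J.El A) :
    (clRec D f g coh (clEta a)).1 = (f.sub (J.inst a)).1
  clRec_star {Γ : C} {A : J.TyP Γ} (D : J.TyP (J.ext (Cl A)))
    (f : J.El (J.subP (J.liftEl (J.wk A) ((clEta (J.v A)).cast (Cl_sub _ A).symm)) D))
    (g : J.El (J.subP (J.liftEl (J.wkBeh Γ) ((star _ (J.beh_extBeh Γ)).cast (Cl_sub _ A).symm)) D))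
    (coh : J.subT (J.wkBeh (J.ext A)) f.1 = J.subT (J.upBeh (J.wk A)) g.1) (h : J.Beh Γ) :
    (clRec D f g coh (star A h)).1 = (g.sub (J.liftBeh (𝟙 Γ) h)).1
  -- `f'` and `g'` are `f` and `g` substituted, with their types rewritten
  clRec_sub {Δ Γ : C} (σ : Δ ⟶ Γ) {A : J.TyP Γ} (D : J.TyP (J.ext (Cl A)))
    (f : J.El (J.subP (J.liftEl (J.wk A) ((clEta (J.v A)).cast (Cl_sub _ A).symm)) D))
    (g : J.El (J.subP (J.liftEl (J.wkBeh Γ) ((star _ (J.beh_extBeh Γ)).cast (Cl_sub _ A).symm)) D))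
    (coh : J.subT (J.wkBeh (J.ext A)) f.1 = J.subT (J.upBeh (J.wk A)) g.1) (e : J.El (Cl A))
    (f' : J.El (J.subP (J.liftEl (J.wk (J.subP σ A))
      ((clEta (J.v (J.subP σ A))).cast (Cl_sub _ _).symm)) (J.subP (J.up σ (Cl_sub σ A)) D)))
    (hf : f'.1 = J.subT (J.up σ rfl) f.1)
    (g' : J.El (J.subP (J.liftEl (J.wkBeh Δ) ((star _ (J.beh_extBeh Δ)).cast (Cl_sub _ _).symm))
      (J.subP (J.up σ (Cl_sub σ A)) D)))
    (hg : g'.1 = J.subT (J.upBeh σ) g.1)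
    (coh' : J.subT (J.wkBeh (J.ext (J.subP σ A))) f'.1 = J.subT (J.upBeh (J.wk _)) g'.1) :
    ((clRec D f g coh e).sub σ).1 =
      (clRec (J.subP (J.up σ (Cl_sub σ A)) D) f' g' coh' ((e.sub σ).cast (Cl_sub σ A))).1

variable {C D : Type (u + 1)} [Category.{u} C] [Category.{u} D]

/-- A functor with a strictly compatible translation of the judgments: it preserves the empty
context, context extensions, their projections and their variables on the nose. -/
structure JudgmentHom (M : Judgments C) (N : Judgments D) (Φ : C ⥤ D) where
  tyP {Γ : C} : M.TyP Γ → N.TyP (Φ.obj Γ)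
  tyN {Γ : C} : M.TyN Γ → N.TyN (Φ.obj Γ)
  tm {Γ : C} : M.Tm Γ → N.Tm (Φ.obj Γ)
  ty_tm {Γ : C} (a : M.Tm Γ) : N.ty (tm a) = tyP (M.ty a)
  tyP_sub {Δ Γ : C} (σ : Δ ⟶ Γ) (A : M.TyP Γ) : tyP (M.subP σ A) = N.subP (Φ.map σ) (tyP A)
  tyN_sub {Δ Γ : C} (σ : Δ ⟶ Γ) (X : M.TyN Γ) : tyN (M.subN σ X) = N.subN (Φ.map σ) (tyN X)
  tm_sub {Δ Γ : C} (σ : Δ ⟶ Γ) (a : M.Tm Γ) : tm (M.subT σ a) = N.subT (Φ.map σ) (tm a)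
  one_obj : Φ.obj M.one = N.one
  ext_obj {Γ : C} (A : M.TyP Γ) : Φ.obj (M.ext A) = N.ext (tyP A)
  map_wk {Γ : C} (A : M.TyP Γ) : Φ.map (M.wk A) = eqToHom (ext_obj A) ≫ N.wk (tyP A)
  tm_var {Γ : C} (A : M.TyP Γ) : tm (M.var A) = N.subT (eqToHom (ext_obj A)) (N.var (tyP A))
  beh {Γ : C} : M.Beh Γ → N.Beh (Φ.obj Γ)
  extBeh_obj (Γ : C) : Φ.obj (M.extBeh Γ) = N.extBeh (Φ.obj Γ)
  map_wkBeh (Γ : C) : Φ.map (M.wkBeh Γ) = eqToHom (extBeh_obj Γ) ≫ N.wkBeh (Φ.obj Γ)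

namespace JudgmentHom

variable {M : Judgments C} {N : Judgments D} {Φ : C ⥤ D} (H : JudgmentHom M N Φ)

def el {Γ : C} {A : M.TyP Γ} (a : M.El A) : N.El (H.tyP A) := ⟨H.tm a.1, by rw [H.ty_tm, a.2]⟩

/-- The identification of `Φ Γ, x : A'` with `Φ (Γ, x : A)`, where `A'` is the image of `A`. -/
def cmp {Γ : C} (A : M.TyP Γ) {A' : N.TyP (Φ.obj Γ)} (h : H.tyP A = A') :
    N.ext A' ⟶ Φ.obj (M.ext A) :=
  eqToHom (by rw [H.ext_obj, h])

/-- The identification of `Φ Γ, z : beh` with `Φ (Γ, z : beh)`. -/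
def cmpBeh (Γ : C) : N.extBeh (Φ.obj Γ) ⟶ Φ.obj (M.extBeh Γ) := eqToHom (H.extBeh_obj Γ).symm

theorem cmp_map_wk {Γ : C} (A : M.TyP Γ) {A' : N.TyP (Φ.obj Γ)} (h : H.tyP A = A') :
    H.cmp A h ≫ Φ.map (M.wk A) = N.wk A' := by
  subst h
  simp [cmp, H.map_wk]

theorem cmp_var {Γ : C} (A : M.TyP Γ) {A' : N.TyP (Φ.obj Γ)} (h : H.tyP A = A') :
    N.subT (H.cmp A h) (H.tm (M.var A)) = N.var A' := by
  subst h
  rw [H.tm_var, ← N.subT_comp]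
  simp [cmp, N.subT_id]

theorem cmp_wk {Γ : C} (A : M.TyP Γ) {A' : N.TyP (Φ.obj Γ)} (h : H.tyP A = A') (B : M.TyP Γ) :
    N.subP (H.cmp A h) (H.tyP (M.subP (M.wk A) B)) = N.subP (N.wk A') (H.tyP B) := by
  rw [H.tyP_sub, ← N.subP_comp, H.cmp_map_wk]

theorem inst_cmp {Γ : C} {A : M.TyP Γ} {A' : N.TyP (Φ.obj Γ)} (h : H.tyP A = A') (a : M.El A)
    (a' : N.El A') (ha : a'.1 = H.tm a.1) : N.inst a' ≫ H.cmp A h = Φ.map (M.inst a) := by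
  subst h
  have e : N.inst a' = Φ.map (M.inst a) ≫ eqToHom (H.ext_obj A) := by
    apply N.ext_hom_ext
    · rw [N.inst_wk, Category.assoc, ← H.map_wk, ← Φ.map_comp, M.inst_wk, Φ.map_id]
    · rw [N.inst_var, N.subT_comp, ← H.tm_var, ← H.tm_sub, M.inst_var, ha]
  rw [e]
  simp [cmp]

theorem tyP_inst {Γ : C} {A : M.TyP Γ} {A' : N.TyP (Φ.obj Γ)} (h : H.tyP A = A') (a : M.El A)
    (a' : N.El A') (ha : a'.1 = H.tm a.1) (B : M.TyP (M.ext A)) :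
    H.tyP (M.subP (M.inst a) B) = N.subP (N.inst a') (N.subP (H.cmp A h) (H.tyP B)) := by
  rw [H.tyP_sub, ← N.subP_comp, H.inst_cmp h a a' ha]

end JudgmentHom

variable {K : Type u} [AddMonoid K]

/-- A morphism of models of calf: a morphism of the judgments that preserves all constants. -/
structure Hom (M : Model K C) (N : Model K D) (Φ : C ⥤ D) where
  H : JudgmentHom M.J N.J Φ
  map_U {Γ : C} (X : M.J.TyN Γ) : H.tyP (M.U X) = N.U (H.tyN X)
  map_F {Γ : C} (A : M.J.TyP Γ) : H.tyN (M.F A) = N.F (H.tyP A)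
  map_ret {Γ : C} {A : M.J.TyP Γ} (a : M.J.El A) : H.tm (M.ret a).1 = (N.ret (H.el a)).1
  map_bind {Γ : C} {A : M.J.TyP Γ} {X : M.J.TyN Γ} (e : M.J.El (M.U (M.F A)))
    (f : M.J.El (M.J.subP (M.J.wk A) (M.U X))) :
    H.tm (M.bind e f).1 =
      (N.bind (A := H.tyP A) (X := H.tyN X) ((H.el e).cast (by rw [map_U, map_F]))
        (((H.el f).sub (H.cmp A rfl)).cast (by rw [H.cmp_wk, map_U]))).1
  map_cost (Γ : C) : H.tyP (M.cost Γ) = N.cost (Φ.obj Γ)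
  map_cst (Γ : C) (k : K) : H.tm (M.cst Γ k).1 = (N.cst (Φ.obj Γ) k).1
  map_add {Γ : C} (c d : M.J.El (M.cost Γ)) :
    H.tm (M.add c d).1 = (N.add ((H.el c).cast (map_cost Γ)) ((H.el d).cast (map_cost Γ))).1
  map_step {Γ : C} {X : M.J.TyN Γ} (c : M.J.El (M.cost Γ)) (e : M.J.El (M.U X)) :
    H.tm (M.step c e).1 = (N.step ((H.el c).cast (map_cost Γ)) ((H.el e).cast (map_U X))).1
  map_Pi {Γ : C} (A : M.J.TyP Γ) (X : M.J.TyN (M.J.ext A)) :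
    H.tyN (M.Pi A X) = N.Pi (H.tyP A) (N.J.subN (H.cmp A rfl) (H.tyN X))
  map_lam {Γ : C} {A : M.J.TyP Γ} {X : M.J.TyN (M.J.ext A)} (e : M.J.El (M.U X)) :
    H.tm (M.lam e).1 =
      (N.lam (((H.el e).sub (H.cmp A rfl)).cast (by rw [map_U, N.U_sub]))).1
  map_app {Γ : C} {A : M.J.TyP Γ} {X : M.J.TyN (M.J.ext A)} (f : M.J.El (M.U (M.Pi A X))) :
    N.J.subT (H.cmp A rfl) (H.tm (M.app f).1) =
      (N.app ((H.el f).cast (by rw [map_U, map_Pi]))).1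
  map_Sig {Γ : C} (A : M.J.TyP Γ) (B : M.J.TyP (M.J.ext A)) :
    H.tyP (M.Sig A B) = N.Sig (H.tyP A) (N.J.subP (H.cmp A rfl) (H.tyP B))
  map_pair {Γ : C} {A : M.J.TyP Γ} {B : M.J.TyP (M.J.ext A)} (a : M.J.El A)
    (b : M.J.El (M.J.subP (M.J.inst a) B)) :
    H.tm (M.pair a b).1 =
      (N.pair (H.el a) ((H.el b).cast (H.tyP_inst rfl a (H.el a) rfl B))).1
  map_fst {Γ : C} {A : M.J.TyP Γ} {B : M.J.TyP (M.J.ext A)} (p : M.J.El (M.Sig A B)) :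
    H.tm (M.fst p).1 = (N.fst ((H.el p).cast (map_Sig A B))).1
  map_snd {Γ : C} {A : M.J.TyP Γ} {B : M.J.TyP (M.J.ext A)} (p : M.J.El (M.Sig A B)) :
    H.tm (M.snd p).1 = (N.snd ((H.el p).cast (map_Sig A B))).1
  map_EqTy {Γ : C} {A : M.J.TyP Γ} (a b : M.J.El A) :
    H.tyP (M.EqTy a b) = N.EqTy (H.el a) (H.el b)
  map_eqRefl {Γ : C} {A : M.J.TyP Γ} (a : M.J.El A) :
    H.tm (M.eqRefl a).1 = (N.eqRefl (H.el a)).1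
  map_bool (Γ : C) : H.tyP (M.bool Γ) = N.bool (Φ.obj Γ)
  map_boolLit (Γ : C) (x : Bool) : H.tm (M.boolLit Γ x).1 = (N.boolLit (Φ.obj Γ) x).1
  map_boolRec {Γ : C} (E : M.J.TyP (M.J.ext (M.bool Γ))) (b : M.J.El (M.bool Γ))
    (t : M.J.El (M.J.subP (M.J.inst (M.boolLit Γ true)) E))
    (f : M.J.El (M.J.subP (M.J.inst (M.boolLit Γ false)) E)) :
    H.tm (M.boolRec E b t f).1 =
      (N.boolRec (N.J.subP (H.cmp _ (map_bool Γ)) (H.tyP E)) ((H.el b).cast (map_bool Γ))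
        ((H.el t).cast (H.tyP_inst _ _ _ (map_boolLit Γ true).symm E))
        ((H.el f).cast (H.tyP_inst _ _ _ (map_boolLit Γ false).symm E))).1
  map_Op {Γ : C} (A : M.J.TyP (M.J.extBeh Γ)) :
    H.tyP (M.Op A) = N.Op (N.J.subP (H.cmpBeh Γ) (H.tyP A))
  map_opLam {Γ : C} {A : M.J.TyP (M.J.extBeh Γ)} (a : M.J.El A) :
    H.tm (M.opLam a).1 = (N.opLam ((H.el a).sub (H.cmpBeh Γ))).1
  map_opApp {Γ : C} {A : M.J.TyP (M.J.extBeh Γ)} (p : M.J.El (M.Op A)) :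
    N.J.subT (H.cmpBeh Γ) (H.tm (M.opApp p).1) = (N.opApp ((H.el p).cast (map_Op A))).1
  map_Cl {Γ : C} (A : M.J.TyP Γ) : H.tyP (M.Cl A) = N.Cl (H.tyP A)
  map_clEta {Γ : C} {A : M.J.TyP Γ} (a : M.J.El A) : H.tm (M.clEta a).1 = (N.clEta (H.el a)).1
  map_star {Γ : C} (A : M.J.TyP Γ) (h : M.J.Beh Γ) :
    H.tm (M.star A h).1 = (N.star (H.tyP A) (H.beh h)).1
  -- `f'` and `g'` are the images of `f` and `g`, with their types rewritten
  map_clRec {Γ : C} {A : M.J.TyP Γ} (E : M.J.TyP (M.J.ext (M.Cl A)))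
    (f : M.J.El (M.J.subP
      (M.J.liftEl (M.J.wk A) ((M.clEta (M.J.v A)).cast (M.Cl_sub _ A).symm)) E))
    (g : M.J.El (M.J.subP
      (M.J.liftEl (M.J.wkBeh Γ) ((M.star _ (M.J.beh_extBeh Γ)).cast (M.Cl_sub _ A).symm)) E))
    (coh : M.J.subT (M.J.wkBeh (M.J.ext A)) f.1 = M.J.subT (M.J.upBeh (M.J.wk A)) g.1)
    (e : M.J.El (M.Cl A))
    (f' : N.J.El (N.J.subP
      (N.J.liftEl (N.J.wk (H.tyP A)) ((N.clEta (N.J.v (H.tyP A))).cast (N.Cl_sub _ _).symm))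
      (N.J.subP (H.cmp _ (map_Cl A)) (H.tyP E))))
    (hf : f'.1 = N.J.subT (H.cmp A rfl) (H.tm f.1))
    (g' : N.J.El (N.J.subP
      (N.J.liftEl (N.J.wkBeh _) ((N.star _ (N.J.beh_extBeh _)).cast (N.Cl_sub _ _).symm))
      (N.J.subP (H.cmp _ (map_Cl A)) (H.tyP E))))
    (hg : g'.1 = N.J.subT (H.cmpBeh Γ) (H.tm g.1))
    (coh' : N.J.subT (N.J.wkBeh (N.J.ext (H.tyP A))) f'.1 =
      N.J.subT (N.J.upBeh (N.J.wk (H.tyP A))) g'.1) :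
    H.tm (M.clRec E f g coh e).1 =
      (N.clRec (N.J.subP (H.cmp _ (map_Cl A)) (H.tyP E)) f' g' coh' ((H.el e).cast (map_Cl A))).1

/-- The syntactic model: the initial model of calf over `K`. -/
def Model.IsInitial (M : Model K C) : Prop :=
  ∀ (D : Type (u + 1)) [Category.{u} D] (N : Model K D), Nonempty (Unique (Σ Φ : C ⥤ D, Hom M N Φ))

/-! ### The gluing category -/

/-- The two worlds, `beh ≤ top`. -/
abbrev World : Type := Fin 2

abbrev World.beh : World := 0

abbrev World.top : World := 1

namespace Judgments

variable (J : Judgments C)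

/-- The contexts `z : beh` and `()` that represent the worlds `beh` and `top`. -/
def worlds : World ⥤ C := ComposableArrows.mk₁ (J.wkBeh J.one)

/-- The phase-separated global sections functor: the presheaf on worlds that sends `top` to the
closed instances of a context, and `beh` to its instances in the behavioral phase. -/
def globalSections : C ⥤ Worldᵒᵖ ⥤ Type u :=
  yoneda ⋙ (Functor.whiskeringLeft _ _ _).obj J.worlds.op

/-- The gluing category: presheaves on worlds glued along the phase-separated global sections. -/
abbrev Glue : Type (u + 1) := Comma (𝟭 (Worldᵒᵖ ⥤ Type u)) J.globalSections

/-- The projection of the gluing category to its syntactic component. -/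
abbrev proj : J.Glue ⥤ C := Comma.snd _ _

variable {J}

/-- The syntactic instance underlying an element of the semantic component. -/
def pt (Γ : J.Glue) (w : World) (x : Γ.left.obj (op w)) : J.worlds.obj w ⟶ Γ.right :=
  (Γ.hom.app (op w) : Γ.left.obj (op w) ⟶ (J.globalSections.obj Γ.right).obj (op w)) x

/-- A proof-relevant two-world Kripke predicate over a syntactic value type `A` in context: at each
world, a family of sets indexed by the elements `x` of `Γ` and the terms of type `A[x]`. -/
structure Predicate (Γ : J.Glue) (A : J.TyP Γ.right) where
  carrier : Worldᵒᵖ ⥤ Type u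
  base : carrier ⟶ Γ.left
  syn (w : World) (q : carrier.obj (op w)) : J.El (J.subP (pt Γ w (base.app (op w) q)) A)
  syn_restrict {w' w : World} (f : w' ⟶ w) (q : carrier.obj (op w)) :
    (syn w' (carrier.map f.op q)).1 = J.subT (J.worlds.map f) (syn w q).1

end Judgments

namespace Model

variable (M : Model K C)

/-- The substitution `(Γ, x : A) ⟶ (Γ, y : U (F A))` given by `y := ret x`. -/
def retMap {Γ : C} (A : M.J.TyP Γ) : M.J.ext A ⟶ M.J.ext (M.U (M.F A)) :=
  M.J.liftEl (M.J.wk A) ((M.ret (M.J.v A)).cast (by rw [M.U_sub, M.F_sub]))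

/-- The substitution `(Γ, x : U X) ⟶ (Γ, y : U X)` given by `y := step k x`. -/
def stepMap {Γ : C} (X : M.J.TyN Γ) (k : K) : M.J.ext (M.U X) ⟶ M.J.ext (M.U X) :=
  M.J.liftEl (M.J.wk (M.U X))
    ((M.step (M.cst _ k) ((M.J.v (M.U X)).cast (M.U_sub _ X))).cast (M.U_sub _ X).symm)

variable {M}

/-- An algebra for the phase-separated writer monad on a predicate over a computation type: the
cost monoid acts over the syntactic cost effect, and trivially at the world `beh`. -/
structure Algebra (Γ : M.J.Glue) (X : M.J.TyN Γ.right) extends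
    Judgments.Predicate Γ (M.U X) where
  act (k : K) : carrier ⟶ carrier
  act_base (k : K) : act k ≫ base = base
  act_zero : act 0 = 𝟙 carrier
  act_add (k l : K) : act (k + l) = act l ≫ act k
  act_beh (k : K) : (act k).app (op World.beh) = 𝟙 _
  syn_act (k : K) (w : World) (q : carrier.obj (op w)) :
    (syn w ((act k).app (op w) q)).1 =
      (M.step (M.cst _ k) ((syn w q).cast (M.U_sub _ X))).1

end Model

open Judgments in
/-- `P` is, up to isomorphism over `Γ` and over the syntactic terms, the semantic component of the
type `A` of a model in the gluing category. -/
def Realizes {M : Model K C} {G : Model K M.J.Glue} (π : Hom G M M.J.proj) {Γ : M.J.Glue}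
    (A : G.J.TyP Γ) {B : M.J.TyP Γ.right} (P : Predicate Γ B)
    (φ : P.carrier ≅ (G.J.ext A).left) : Prop :=
  φ.hom ≫ (G.J.wk A).left = P.base ∧
    ∀ (w : World) (q : P.carrier.obj (op w)),
      M.J.subT (pt (G.J.ext A) w (φ.hom.app (op w) q)) (π.H.tm (G.J.var A)) = (P.syn w q).1

open Judgments in
/-- The canonicity gluing model.  Value types are syntactic value types equipped with Kripke
predicates, computation types are syntactic computation types equipped with algebras for the writer
monad, the semantic booleans and costs are the canonical ones, and semantic free computations are
given by the phase-separated writer monad, whose cost component is erased at the world `beh`. -/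
structure IsCanonicityModel {M : Model K C} (G : Model K M.J.Glue) (π : Hom G M M.J.proj) :
    Prop where
  beh_iff (Γ : M.J.Glue) :
    G.J.Beh Γ ↔ M.J.Beh Γ.right ∧ IsEmpty (Γ.left.obj (op World.top))
  valueTypes (Γ : M.J.Glue) (B : M.J.TyP Γ.right) (P : Predicate Γ B) :
    ∃ A : G.J.TyP Γ, π.H.tyP A = B ∧ ∃ φ, Realizes π A P φ
  compTypes (Γ : M.J.Glue) (Y : M.J.TyN Γ.right) (P : Model.Algebra Γ Y) :
    ∃ X : G.J.TyN Γ, π.H.tyN X = Y ∧ ∃ φ, Realizes π (G.U X) P.toPredicate φ ∧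
      ∀ k, P.act k ≫ φ.hom = φ.hom ≫ (G.stepMap X k).left
  bool (Γ : M.J.Glue) (w : World) :
    Function.Bijective fun p : Γ.left.obj (op w) × Bool =>
      (G.J.inst (G.boolLit Γ p.2)).left.app (op w) p.1
  cost (Γ : M.J.Glue) (w : World) :
    Function.Bijective fun p : Γ.left.obj (op w) × K =>
      (G.J.inst (G.cst Γ p.2)).left.app (op w) p.1
  free_top (Γ : M.J.Glue) (A : G.J.TyP Γ) :
    Function.Bijective fun p : (G.J.ext A).left.obj (op World.top) × K =>
      (G.retMap A ≫ G.stepMap (G.F A) p.2).left.app (op World.top) p.1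
  free_beh (Γ : M.J.Glue) (A : G.J.TyP Γ) :
    Function.Bijective fun q : (G.J.ext A).left.obj (op World.beh) =>
      (G.retMap A).left.app (op World.beh) q

/-- A morphism of models `ι` into the gluing category that is a section of the projection. -/
structure IsSection {M : Model K C} {G : Model K M.J.Glue} (π : Hom G M M.J.proj)
    {Φ : C ⥤ M.J.Glue} (ι : Hom M G Φ) : Prop where
  comp_proj : Φ ⋙ M.J.proj = 𝟭 C
  tyP {Γ : C} (A : M.J.TyP Γ) :
    π.H.tyP (ι.H.tyP A) = M.J.subP (eqToHom (Functor.congr_obj comp_proj Γ)) A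
  tyN {Γ : C} (X : M.J.TyN Γ) :
    π.H.tyN (ι.H.tyN X) = M.J.subN (eqToHom (Functor.congr_obj comp_proj Γ)) X
  tm {Γ : C} (a : M.J.Tm Γ) :
    π.H.tm (ι.H.tm a) = M.J.subT (eqToHom (Functor.congr_obj comp_proj Γ)) a

/-- Canonicity, for closed terms (world `top`) and in the behavioral phase (world `beh`). -/
structure Canonicity (M : Model K C) : Prop where
  bool (w : World) (b : M.J.El (M.bool (M.J.worlds.obj w))) : ∃! x : Bool, b = M.boolLit _ x
  cost (w : World) (c : M.J.El (M.cost (M.J.worlds.obj w))) : ∃! k : K, c = M.cst _ k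
  free_top (A : M.J.TyP M.J.one) (e : M.J.El (M.U (M.F A))) :
    ∃! p : K × M.J.El A, e = M.step (M.cst _ p.1) (M.ret p.2)
  free_beh (A : M.J.TyP (M.J.extBeh M.J.one)) (e : M.J.El (M.U (M.F A))) :
    ∃! a : M.J.El A, e = M.ret a
  free_bool_top (e : M.J.El (M.U (M.F (M.bool M.J.one)))) :
    ∃! p : K × Bool, e = M.step (M.cst _ p.1) (M.ret (M.boolLit _ p.2))
  free_bool_beh (e : M.J.El (M.U (M.F (M.bool (M.J.extBeh M.J.one))))) :
    ∃! x : Bool, e = M.ret (M.boolLit _ x)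

end Calf

/-! A value type over a glued context is a syntactic type together with a family of sets, indexed by
the worlds and the semantic elements of the context, each of whose members names a term of the
instantiated type. A glued term is a syntactic term together with a choice of members that name its
instances and commute with restriction. Every law of calf then splits into the same law in `M` and a
pointwise identity of sections, and the projection forgets the second half. Families are indexed by
elements, instead of being presheaves over the context, so that substitution is precomposition and
is strictly functorial; a Kripke predicate is recovered as the family of its fibres.

The semantics of each connective follows from what the two worlds see. The phase holds when nothing
lives at `top`, so assuming it keeps the elements at `beh` and empties `top`. The open modality sees
only `beh`; the closed one collapses `beh` to a point. A computation type carries an action of `K`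
at `top` that restriction forgets, and the free one is `A × K` at `top` and `A` at `beh`. This is a
family of named terms because `step` is the identity in the context `z : beh`, so that `step k (ret
a)` restricts to a plain return.

An element of a dependent product is a term together with the semantic functions that it tracks; the
term must be recorded because the functions do not determine it. Terms live one universe too high
for this, but a term of type `T` is the same as a section of the weakening of `x : T`, and hom-sets
are small.

For canonicity, let `ι` be a section of the projection and `a` a term at a world. The interpretation
of that world has a semantic element `x` (`nonempty_pt`), whose underlying substitution is, up to
the identification given by the section property, an endomorphism of `1` or of `z : beh`, hence the
identity (`worlds_endo`). So the semantic value of `ι a` at `x` names `a` itself (`section_syn`). At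
the booleans and costs such a value is a constant, at a free type a charged return. Uniqueness holds
because `ι` preserves the constants, so they can be read back from the value. If `M` is initial, `ι`
exists uniquely, and its composite with the projection (`compHom`) is the identity (`idHom`) by
uniqueness of endomorphisms. -/

namespace Calf
namespace Gluing

open Judgments

/-! ### Presheaves on two worlds and the gluing category -/

section

variable {C : Type (u + 1)} [Category.{u} C] {J : Judgments C}

/-- The elements of the semantic component of `Γ` at the world `w`. -/
abbrev Pt (Γ : J.Glue) (w : World) : Type u := Γ.left.obj (op w)

/-- The order relation between the two worlds. -/
def down : World.beh ⟶ World.top := homOfLE (by decide)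

variable (J) in
/-- The syntactic restriction map, from closed terms to the behavioral phase. -/
abbrev wb : J.worlds.obj World.beh ⟶ J.worlds.obj World.top := J.worlds.map down

/-- Restriction to the behavioral phase. -/
def rs (Γ : J.Glue) (x : Pt Γ World.top) : Pt Γ World.beh := Γ.left.map down.op x

/-- The action of a morphism on elements. -/
def mp {Δ Γ : J.Glue} (σ : Δ ⟶ Γ) (w : World) (x : Pt Δ w) : Pt Γ w := σ.left.app (op w) x

theorem mp_rs {Δ Γ : J.Glue} (σ : Δ ⟶ Γ) (x : Pt Δ World.top) :
    mp σ World.beh (rs Δ x) = rs Γ (mp σ World.top x) :=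
  NatTrans.naturality_apply σ.left down.op x

theorem pt_mp {Δ Γ : J.Glue} (σ : Δ ⟶ Γ) (w : World) (x : Pt Δ w) :
    pt Γ w (mp σ w x) = pt Δ w x ≫ σ.right :=
  congrArg (fun f : Δ.left ⟶ J.globalSections.obj Γ.right => f.app (op w) x) σ.w

theorem pt_rs (Γ : J.Glue) (x : Pt Γ World.top) :
    pt Γ World.beh (rs Γ x) = wb J ≫ pt Γ World.top x :=
  NatTrans.naturality_apply Γ.hom down.op x

/-- Case distinction on worlds. -/
def wcases {motive : World → Sort*} (h0 : motive World.beh) (h1 : motive World.top) :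
    ∀ w, motive w
  | 0 => h0
  | 1 => h1

/-- The poset of worlds has only the identities and `down`. Hence presheaves, natural
transformations and glued objects can all be given by data and equations along `down` alone. -/
theorem hom_cases {motive : ∀ {w' w : World}, (w' ⟶ w) → Prop} (h : ∀ w, motive (𝟙 w))
    (hd : motive down) {w' w : World} (f : w' ⟶ w) : motive f := by
  have hle : w' ≤ w := leOfHom f
  match w', w with
  | 0, 0 => exact h 0
  | 1, 1 => exact h 1
  | 0, 1 => exact hd
  | 1, 0 => exact absurd hle (by decide)

/-- The restriction maps of a presheaf on worlds given by a single function. -/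
def restr (X : World → Type u) (r : X World.top → X World.beh) :
    ∀ {w' w : World}, (w' ⟶ w) → X w → X w'
  | 0, 0, _ => id
  | 1, 1, _ => id
  | 0, 1, _ => r
  | 1, 0, f => absurd (leOfHom f) (by decide)

/-- The presheaf on worlds given by a single function. -/
def mkPsh (X : World → Type u) (r : X World.top → X World.beh) : Worldᵒᵖ ⥤ Type u where
  obj w := X w.unop
  map f := ↾(restr X r f.unop)
  map_id w := by
    obtain ⟨w⟩ := w
    match w with
    | 0 => rfl
    | 1 => rfl
  map_comp {a b c} f g := by
    obtain ⟨a⟩ := a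
    obtain ⟨b⟩ := b
    obtain ⟨c⟩ := c
    have h1 : b ≤ a := leOfHom f.unop
    have h2 : c ≤ b := leOfHom g.unop
    match a, b, c with
    | 0, 0, 0 => rfl
    | 1, 1, 1 => rfl
    | 1, 0, 0 => rfl
    | 1, 1, 0 => rfl
    | 0, 1, _ => exact absurd h1 (by decide)
    | 0, 0, 1 => exact absurd h2 (by decide)
    | 1, 0, 1 => exact absurd h2 (by decide)

theorem op_hom_cases {motive : ∀ {w w' : Worldᵒᵖ}, (w ⟶ w') → Prop} (h : ∀ w, motive (𝟙 w))
    (hd : motive down.op) {w w' : Worldᵒᵖ} (f : w ⟶ w') : motive f :=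
  hom_cases (motive := fun g => motive g.op) (fun w => h (op w)) hd f.unop

/-- A natural transformation of presheaves on worlds. -/
def mkNat {P Q : Worldᵒᵖ ⥤ Type u} (f : ∀ w : World, P.obj (op w) → Q.obj (op w))
    (h : ∀ x, f World.beh (P.map down.op x) = Q.map down.op (f World.top x)) : P ⟶ Q where
  app w := ↾(f w.unop)
  naturality {w w'} g := by
    refine op_hom_cases (motive := fun {w w'} g => P.map g ≫ ↾(f w'.unop) = ↾(f w.unop) ≫ Q.map g)
      ?_ ?_ g
    · intro w
      simp
    · ext x
      exact h x

/-- An object of the gluing category. -/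
def mkObj (X : World → Type u) (r : X World.top → X World.beh) (Γ : C)
    (p : ∀ w, X w → (J.worlds.obj w ⟶ Γ))
    (hp : ∀ x, p World.beh (r x) = wb J ≫ p World.top x) : J.Glue where
  left := mkPsh X r
  right := Γ
  hom := mkNat p hp

/-- A morphism of the gluing category. -/
def mkHom {Δ Γ : J.Glue} (f : ∀ w, Pt Δ w → Pt Γ w) (g : Δ.right ⟶ Γ.right)
    (hr : ∀ x, f World.beh (rs Δ x) = rs Γ (f World.top x))
    (hp : ∀ w x, pt Γ w (f w x) = pt Δ w x ≫ g) : Δ ⟶ Γ where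
  left := mkNat f hr
  right := g
  w := by
    ext ⟨w⟩ x
    exact hp w x

theorem hom_ext {Δ Γ : J.Glue} {σ τ : Δ ⟶ Γ} (h : ∀ w x, mp σ w x = mp τ w x)
    (h' : σ.right = τ.right) : σ = τ := by
  apply Comma.hom_ext _ _ _ h'
  ext ⟨w⟩ x
  exact h w x

section
variable (J)

theorem lift_eq {Δ Γ : C} {σ : Δ ⟶ Γ} {A : J.TyP Γ} {a : J.Tm Δ} {h : J.ty a = J.subP σ A}
    {τ : Δ ⟶ J.ext A} (hτ : τ ≫ J.wk A = σ) (hv : J.subT τ (J.var A) = a) :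
    J.lift σ A a h = τ :=
  J.ext_hom_ext _ _ _ ((J.lift_wk _ _ _ _).trans hτ.symm) ((J.lift_var _ _ _ _).trans hv.symm)

theorem lift_congr {Δ Γ : C} {σ σ' : Δ ⟶ Γ} (A : J.TyP Γ) {a a' : J.Tm Δ}
    {h : J.ty a = J.subP σ A} {h' : J.ty a' = J.subP σ' A} (hσ : σ = σ') (ha : a = a') :
    J.lift σ A a h = J.lift σ' A a' h' := by
  subst hσ
  subst ha
  rfl

theorem comp_lift_type {Θ Δ Γ : C} (τ : Θ ⟶ Δ) {σ : Δ ⟶ Γ} {A : J.TyP Γ} {a : J.Tm Δ}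
    (h : J.ty a = J.subP σ A) : J.ty (J.subT τ a) = J.subP (τ ≫ σ) A := by
  rw [J.ty_sub, h, J.subP_comp]

theorem comp_lift {Θ Δ Γ : C} (τ : Θ ⟶ Δ) (σ : Δ ⟶ Γ) (A : J.TyP Γ) (a : J.Tm Δ)
    (h : J.ty a = J.subP σ A) :
    τ ≫ J.lift σ A a h = J.lift (τ ≫ σ) A (J.subT τ a) (comp_lift_type J τ h) := by
  symm
  apply lift_eq
  · rw [Category.assoc, J.lift_wk]
  · rw [J.subT_comp, J.lift_var]

end

end

/-! ### Value types, terms and contexts of the gluing model -/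

section

variable {C : Type (u + 1)} [Category.{u} C]

section
variable {J : Judgments C}

/-- A two-world family of sets over `Γ`, tracked by syntactic terms. -/
structure Fam (Γ : J.Glue) : Type (u + 1) where
  Q : ∀ w, Pt Γ w → Type u
  syn : ∀ w x, Q w x → J.Tm (J.worlds.obj w)
  -- The target index is any `y` equal to `rs Γ x`. Along a morphism `σ`, the elements `mp σ _ (rs Δ
  -- x)` and `rs Γ (mp σ _ x)` agree only propositionally, and a free `y` lets reindexing avoid
  -- casts.
  res : ∀ x y, rs Γ x = y → Q World.top x → Q World.beh y
  syn_res : ∀ x y h q, syn World.beh y (res x y h q) = J.subT (wb J) (syn World.top x q)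

/-- Reindexing of families along a morphism. -/
def Fam.sub {Δ Γ : J.Glue} (σ : Δ ⟶ Γ) (F : Fam Γ) : Fam Δ where
  Q w x := F.Q w (mp σ w x)
  syn w x q := F.syn w (mp σ w x) q
  res x y h q := F.res (mp σ _ x) (mp σ _ y) (by rw [← h, mp_rs]) q
  syn_res _ _ _ _ := F.syn_res _ _ _ _

/-- Value types of the gluing model. -/
structure Ty (Γ : J.Glue) : Type (u + 1) extends Fam Γ where
  B : J.TyP Γ.right
  ty_syn : ∀ w x q, J.ty (syn w x q) = J.subP (pt Γ w x) B

theorem Ty.ext' {Γ : J.Glue} {A A' : Ty Γ} (hB : A.B = A'.B) (hF : A.toFam = A'.toFam) :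
    A = A' := by
  cases A
  cases A'
  cases hB
  cases hF
  rfl

/-- Substitution in value types. -/
def Ty.sub {Δ Γ : J.Glue} (σ : Δ ⟶ Γ) (A : Ty Γ) : Ty Δ where
  toFam := A.toFam.sub σ
  B := J.subP σ.right A.B
  ty_syn w x q := by
    rw [← J.subP_comp, ← pt_mp]
    exact A.ty_syn _ _ _

/-- The syntactic component of an element, as a term of the instantiated type. -/
def Ty.el {Γ : J.Glue} (A : Ty Γ) {w : World} {x : Pt Γ w} (q : A.Q w x) :
    J.El (J.subP (pt Γ w x) A.B) := ⟨A.syn w x q, A.ty_syn w x q⟩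

/-- Terms of the gluing model. -/
structure GTm (Γ : J.Glue) : Type (u + 1) where
  A : Ty Γ
  t : J.Tm Γ.right
  ty_t : J.ty t = A.B
  sec : ∀ w x, A.Q w x
  syn_sec : ∀ w x, A.syn w x (sec w x) = J.subT (pt Γ w x) t
  res_sec : ∀ x y h, A.res x y h (sec World.top x) = sec World.beh y

theorem GTm.ext' {Γ : J.Glue} {a b : GTm Γ} (hA : a.A = b.A) (ht : a.t = b.t)
    (hs : ∀ w x, a.sec w x ≍ b.sec w x) : a = b := by
  cases a
  cases b
  cases hA
  cases ht
  congr
  funext w x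
  exact eq_of_heq (hs w x)

/-- Substitution in terms. -/
def GTm.sub {Δ Γ : J.Glue} (σ : Δ ⟶ Γ) (a : GTm Γ) : GTm Δ where
  A := a.A.sub σ
  t := J.subT σ.right a.t
  ty_t := by rw [J.ty_sub, a.ty_t]; rfl
  sec w x := a.sec w (mp σ w x)
  syn_sec w x := by
    rw [← J.subT_comp, ← pt_mp]
    exact a.syn_sec w _
  res_sec x y h := a.res_sec _ _ _

theorem GTm.sec_congr {Γ : J.Glue} {a b : GTm Γ} (h : a = b) (w : World) (x : Pt Γ w) :
    a.sec w x ≍ b.sec w x := by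
  rw [h]

/-- Context extension. -/
def gext {Γ : J.Glue} (A : Ty Γ) : J.Glue :=
  mkObj (fun w => Σ x : Pt Γ w, A.Q w x) (fun p => ⟨rs Γ p.1, A.res p.1 _ rfl p.2⟩) (J.ext A.B)
    (fun w p => J.lift (pt Γ w p.1) A.B (A.syn w p.1 p.2) (A.ty_syn w p.1 p.2))
    (fun p => by
      refine Eq.trans ?_ (comp_lift J _ _ _ _ _).symm
      exact lift_congr J _ (pt_rs Γ p.1) (A.syn_res _ _ _ _))

theorem gext_rs {Γ : J.Glue} (A : Ty Γ) (x : Pt Γ World.top) (y : Pt Γ World.beh) (h : rs Γ x = y)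
    (q : A.Q World.top x) :
    rs (gext A) (⟨x, q⟩ : Σ x : Pt Γ World.top, A.Q World.top x) =
      (⟨y, A.res x y h q⟩ : Σ x : Pt Γ World.beh, A.Q World.beh x) := by
  subst h
  rfl

/-- The weakening of a context extension. -/
def gwk {Γ : J.Glue} (A : Ty Γ) : gext A ⟶ Γ :=
  mkHom (fun _ p => p.1) (J.wk A.B) (fun _ => rfl) (fun _ _ => (J.lift_wk _ _ _ _).symm)

/-- The variable of a context extension. -/
def gvar {Γ : J.Glue} (A : Ty Γ) : GTm (gext A) where
  A := A.sub (gwk A)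
  t := J.var A.B
  ty_t := J.ty_var A.B
  sec _ p := p.2
  syn_sec _ _ := (J.lift_var _ _ _ _).symm
  res_sec := by
    rintro ⟨x, q⟩ _ rfl
    rfl

/-- The semantic component of a term of a given type. -/
def gsec {Γ : J.Glue} {A : Ty Γ} (a : {a : GTm Γ // a.A = A}) (w : World) (x : Pt Γ w) : A.Q w x :=
  cast (congrArg (fun A : Ty Γ => A.Q w x) a.2) (a.1.sec w x)

theorem gsec_heq {Γ : J.Glue} {A : Ty Γ} (a : {a : GTm Γ // a.A = A}) (w : World) (x : Pt Γ w) :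
    gsec a w x ≍ a.1.sec w x :=
  cast_heq _ _

theorem gsec_syn {Γ : J.Glue} {A : Ty Γ} (a : {a : GTm Γ // a.A = A}) (w : World) (x : Pt Γ w) :
    A.syn w x (gsec a w x) = J.subT (pt Γ w x) a.1.t := by
  obtain ⟨a, rfl⟩ := a
  exact a.syn_sec w x

theorem gsec_res {Γ : J.Glue} {A : Ty Γ} (a : {a : GTm Γ // a.A = A}) (x : Pt Γ World.top)
    (y : Pt Γ World.beh) (h : rs Γ x = y) :
    A.res x y h (gsec a _ x) = gsec a _ y := by
  obtain ⟨a, rfl⟩ := a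
  exact a.res_sec x y h

theorem ty_gt {Γ : J.Glue} {A : Ty Γ} (a : {a : GTm Γ // a.A = A}) : J.ty a.1.t = A.B := by
  obtain ⟨a, rfl⟩ := a
  exact a.ty_t

/-- The universal property of context extension. -/
def glift {Δ Γ : J.Glue} (σ : Δ ⟶ Γ) (A : Ty Γ) (a : {a : GTm Δ // a.A = A.sub σ}) :
    Δ ⟶ gext A :=
  mkHom (fun w x => ⟨mp σ w x, gsec a w x⟩) (J.lift σ.right A.B a.1.t (ty_gt a))
    (fun x => by
      refine Eq.trans ?_ (gext_rs A (mp σ _ x) (mp σ _ (rs Δ x)) (mp_rs σ x).symm _).symm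
      exact congrArg (Sigma.mk _) (gsec_res a x _ rfl).symm)
    (fun w x => by
      refine Eq.trans ?_ (comp_lift J _ _ _ _ _).symm
      exact lift_congr J _ (pt_mp σ w x) (gsec_syn a w x))

theorem glift_var {Δ Γ : J.Glue} (σ : Δ ⟶ Γ) (A : Ty Γ) (a : {a : GTm Δ // a.A = A.sub σ}) :
    (gvar A).sub (glift σ A a) = a.1 := by
  apply GTm.ext'
  · rw [a.2]
    apply Ty.ext'
    · refine (J.subP_comp _ _ _).symm.trans ?_
      exact congrArg (fun f => J.subP f A.B) (J.lift_wk _ _ _ _)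
    · rfl
  · exact J.lift_var _ _ _ _
  · exact fun w x => gsec_heq a w x

theorem gext_hom_ext {Δ Γ : J.Glue} (A : Ty Γ) (τ τ' : Δ ⟶ gext A)
    (h : τ ≫ gwk A = τ' ≫ gwk A) (h' : (gvar A).sub τ = (gvar A).sub τ') : τ = τ' := by
  apply hom_ext
  · intro w x
    exact Sigma.ext (congrArg (fun f => mp f w x) h) (GTm.sec_congr h' w x)
  · exact J.ext_hom_ext _ _ _ (congrArg CommaMorphism.right h) (congrArg GTm.t h')

/-- The phase. -/
def GBeh (Γ : J.Glue) : Prop := J.Beh Γ.right ∧ IsEmpty (Pt Γ World.top)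

/-- Context extension by the phase. -/
def gextBeh (Γ : J.Glue) : J.Glue :=
  -- The empty set at `top` is what the semantic half of the phase demands; the elements at `beh`
  -- are kept.
  mkObj (wcases (motive := fun _ => Type u) (Pt Γ World.beh) PEmpty) (fun p => nomatch p)
    (J.extBeh Γ.right)
    (wcases (fun x => J.liftBeh (pt Γ World.beh x) (J.beh_extBeh J.one)) (fun p => nomatch p))
    (fun p => nomatch p)

theorem gextBeh_empty (Γ : J.Glue) : IsEmpty (Pt (gextBeh Γ) World.top) :=
  ⟨fun p => nomatch (p : PEmpty)⟩

theorem gextBeh_beh (Γ : J.Glue) : GBeh (gextBeh Γ) := ⟨J.beh_extBeh Γ.right, gextBeh_empty Γ⟩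

/-- The weakening of an extension by the phase. -/
def gwkBeh (Γ : J.Glue) : gextBeh Γ ⟶ Γ :=
  mkHom (wcases (fun x => x) (fun p => nomatch p)) (J.wkBeh Γ.right) (fun p => nomatch p)
    (wcases (fun _ => (J.liftBeh_wk _ _).symm) (fun p => nomatch p))

/-- The universal property of the extension by the phase. -/
def gliftBeh {Δ Γ : J.Glue} (σ : Δ ⟶ Γ) (h : GBeh Δ) : Δ ⟶ gextBeh Γ :=
  mkHom (wcases (fun x => mp σ _ x) (fun p => (h.2.false p).elim)) (J.liftBeh σ.right h.1)
    (fun p => (h.2.false p).elim)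
    (wcases (fun x => by
      apply J.extBeh_hom_ext
      refine (J.liftBeh_wk _ _).trans ?_
      refine Eq.trans ?_ (Category.assoc _ _ _).symm
      rw [J.liftBeh_wk]
      exact pt_mp σ _ x) (fun p => (h.2.false p).elim))

theorem gliftBeh_wk {Δ Γ : J.Glue} (σ : Δ ⟶ Γ) (h : GBeh Δ) : gliftBeh σ h ≫ gwkBeh Γ = σ := by
  apply hom_ext
  · exact wcases (fun x => rfl) (fun p => (h.2.false p).elim)
  · exact J.liftBeh_wk _ _

theorem gextBeh_hom_ext {Δ Γ : J.Glue} (τ τ' : Δ ⟶ gextBeh Γ)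
    (h : τ ≫ gwkBeh Γ = τ' ≫ gwkBeh Γ) : τ = τ' := by
  apply hom_ext
  · refine wcases (fun x => ?_) (fun p => nomatch (mp τ World.top p : PEmpty))
    exact congrArg (fun f : Δ ⟶ Γ => mp f World.beh x) h
  · exact J.extBeh_hom_ext _ _ (congrArg CommaMorphism.right h)

variable (J) in
/-- The empty context. -/
def gone : J.Glue :=
  mkObj (fun _ => PUnit) (fun p => p) J.one (fun _ _ => J.isTerminal.from _)
    (fun _ => J.isTerminal.hom_ext _ _)

variable (J) in
/-- The empty context is terminal. -/
def goneTerminal : Limits.IsTerminal (gone J) :=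
  Limits.IsTerminal.ofUniqueHom
    (fun _ => mkHom (fun _ _ => PUnit.unit) (J.isTerminal.from _) (fun _ => rfl)
      (fun _ _ => J.isTerminal.hom_ext _ _))
    (fun _ _ => hom_ext (fun _ _ => rfl) (J.isTerminal.hom_ext _ _))

end

/-! ### Computation types and the judgmental structure -/

section
variable {K : Type u} [AddMonoid K] {M : Model K C}

/-- The two sides may have types that agree only propositionally, so this lemma and its analogues
for the other constants compare underlying raw terms. -/
theorem step_congr {Γ : C} {X X' : M.J.TyN Γ} (h : X = X') {c c' : M.J.El (M.cost Γ)}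
    (hc : c.1 = c'.1) {e : M.J.El (M.U X)} {e' : M.J.El (M.U X')} (he : e.1 = e'.1) :
    (M.step c e).1 = (M.step c' e').1 := by
  subst h
  cases Subtype.ext hc
  cases Subtype.ext he
  rfl

/-- Computation types of the gluing model. -/
structure CTy (Γ : M.J.Glue) : Type (u + 1) extends Fam Γ where
  Y : M.J.TyN Γ.right
  ty_syn : ∀ w x q, M.J.ty (syn w x q) = M.J.subP (pt Γ w x) (M.U Y)
  -- An action is needed only at `top`, being trivial at `beh`; naturality of the action becomes
  -- `act_res`, which says that restriction forgets the charge.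
  act : K → ∀ x, Q World.top x → Q World.top x
  act_zero : ∀ x q, act 0 x q = q
  act_add : ∀ k l x q, act (k + l) x q = act k x (act l x q)
  act_res : ∀ k x y h q, res x y h (act k x q) = res x y h q
  syn_act : ∀ k x q, syn World.top x (act k x q) =
    (M.step (X := M.J.subN (pt Γ World.top x) Y) (M.cst _ k)
      ⟨syn World.top x q, (ty_syn _ x q).trans (M.U_sub _ _)⟩).1

theorem CTy.ext' {Γ : M.J.Glue} {X X' : CTy Γ} (hY : X.Y = X'.Y) (hF : X.toFam = X'.toFam)
    (ha : ∀ k x q q', q ≍ q' → X.act k x q ≍ X'.act k x q') : X = X' := by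
  cases X
  cases X'
  cases hY
  cases hF
  congr
  funext k x q
  exact eq_of_heq (ha k x q q HEq.rfl)

/-- Substitution in computation types. -/
def CTy.sub {Δ Γ : M.J.Glue} (σ : Δ ⟶ Γ) (X : CTy Γ) : CTy Δ where
  toFam := X.toFam.sub σ
  Y := M.J.subN σ.right X.Y
  ty_syn w x q := by
    rw [← M.U_sub, ← M.J.subP_comp, ← pt_mp]
    exact X.ty_syn _ _ _
  act k x q := X.act k (mp σ _ x) q
  act_zero _ _ := X.act_zero _ _
  act_add _ _ _ _ := X.act_add _ _ _ _
  act_res _ _ _ _ _ := X.act_res _ _ _ _ _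
  syn_act k x q := by
    refine (X.syn_act k (mp σ _ x) q).trans ?_
    refine step_congr ?_ rfl rfl
    rw [← M.J.subN_comp, ← pt_mp]

variable (M) in
/-- The judgments of the gluing model. -/
def gJ : Judgments M.J.Glue where
  one := gone M.J
  isTerminal := goneTerminal M.J
  TyP Γ := Ty Γ
  TyN Γ := CTy Γ
  Tm Γ := GTm Γ
  ty a := a.A
  subP σ A := A.sub σ
  subP_id A := Ty.ext' (M.J.subP_id _) rfl
  subP_comp τ σ A := Ty.ext' (M.J.subP_comp _ _ _) rfl
  subN σ X := X.sub σ
  subN_id X := CTy.ext' (M.J.subN_id _) rfl (fun _ _ _ _ h => by cases h; rfl)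
  subN_comp τ σ X := CTy.ext' (M.J.subN_comp _ _ _) rfl (fun _ _ _ _ h => by cases h; rfl)
  subT σ a := a.sub σ
  subT_id a := GTm.ext' (Ty.ext' (M.J.subP_id _) rfl) (M.J.subT_id _) (fun _ _ => HEq.rfl)
  subT_comp τ σ a :=
    GTm.ext' (Ty.ext' (M.J.subP_comp _ _ _) rfl) (M.J.subT_comp _ _ _) (fun _ _ => HEq.rfl)
  ty_sub _ _ := rfl
  ext A := gext A
  wk A := gwk A
  var A := gvar A
  ty_var _ := rfl
  lift σ A a h := glift σ A ⟨a, h⟩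
  lift_wk σ A a h := hom_ext (fun _ _ => rfl) (M.J.lift_wk _ _ _ _)
  lift_var σ A a h := glift_var σ A ⟨a, h⟩
  ext_hom_ext A τ τ' h h' := gext_hom_ext A τ τ' h h'
  Beh := GBeh
  beh_sub σ h := ⟨M.J.beh_sub σ.right h.1, ⟨fun p => h.2.false (mp σ _ p)⟩⟩
  extBeh := gextBeh
  wkBeh := gwkBeh
  beh_extBeh := gextBeh_beh
  liftBeh := gliftBeh
  liftBeh_wk := gliftBeh_wk
  extBeh_hom_ext := gextBeh_hom_ext

variable (M) in
/-- The projection of the gluing model, on judgments. -/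
def gπ : JudgmentHom (gJ M) M.J M.J.proj where
  tyP A := A.B
  tyN X := X.Y
  tm a := a.t
  ty_tm a := a.ty_t
  tyP_sub _ _ := rfl
  tyN_sub _ _ := rfl
  tm_sub _ _ := rfl
  one_obj := rfl
  ext_obj _ := rfl
  map_wk _ := (Category.id_comp _).symm
  tm_var _ := (M.J.subT_id _).symm
  beh h := h.1
  extBeh_obj _ := rfl
  map_wkBeh _ := (Category.id_comp _).symm

end

end

/-! ### Thunks, free computations, costs and the step effect -/

section

variable {C : Type (u + 1)} [Category.{u} C]

section
variable (J : Judgments C)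

/-- Mediates between two forms of instantiation under a binder: the syntactic laws produce `inst`
after `up`, while the points of a glued context extension are given by `liftEl`. -/
theorem inst_up_rfl {Δ Γ : C} (σ : Δ ⟶ Γ) {B : J.TyP Γ} (a : J.El (J.subP σ B)) :
    J.inst a ≫ J.up σ rfl = J.liftEl σ a := by
  refine (comp_lift J _ _ _ _ _).trans ?_
  apply lift_congr
  · rw [← Category.assoc, J.inst_wk, Category.id_comp]
  · rw [J.inst_var]

end

variable {K : Type u} [AddMonoid K] {M : Model K C}

section
variable (M)

theorem ret_congr {Γ : C} {A A' : M.J.TyP Γ} (h : A = A') {a : M.J.El A} {a' : M.J.El A'}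
    (ha : a.1 = a'.1) : (M.ret a).1 = (M.ret a').1 := by
  subst h
  cases Subtype.ext ha
  rfl

/-- Pushing `σ` inside `bind` turns the computation into `ret a`, and the left unit law applies.
This is the syntactic half of sequencing at the world `beh`. -/
theorem bind_ret_sub {Δ Γ : C} (σ : Δ ⟶ Γ) {A : M.J.TyP Γ} {X : M.J.TyN Γ}
    (e : M.J.El (M.U (M.F A))) (f : M.J.El (M.J.subP (M.J.wk A) (M.U X)))
    (a : M.J.El (M.J.subP σ A)) (h : (M.ret a).1 = M.J.subT σ e.1) :
    M.J.subT (M.J.liftEl σ a) f.1 = M.J.subT σ (M.bind e f).1 := by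
  refine Eq.trans ?_ (M.bind_sub σ e f).symm
  have h' : (e.sub σ).cast (by rw [M.U_sub, M.F_sub]) = M.ret a := Subtype.ext h.symm
  rw [h', M.bind_ret, ← inst_up_rfl, M.J.subT_comp]
  rfl

theorem liftEl_wk_type {Δ Γ : C} (σ : Δ ⟶ Γ) {A : M.J.TyP Γ} {X : M.J.TyN Γ}
    (f : M.J.El (M.J.subP (M.J.wk A) (M.U X))) (a : M.J.El (M.J.subP σ A)) :
    M.J.ty (M.J.subT (M.J.liftEl σ a) f.1) = M.U (M.J.subN σ X) := by
  rw [M.J.ty_sub, f.2, ← M.J.subP_comp, M.U_sub]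
  exact congrArg (fun τ => M.U (M.J.subN τ X)) (M.J.lift_wk _ _ _ _)

/-- The counterpart at the world `top`, where the computation becomes a charged return: `bind_step`
moves the charge outside before the unit law applies. -/
theorem bind_step_ret_sub {Δ Γ : C} (σ : Δ ⟶ Γ) {A : M.J.TyP Γ} {X : M.J.TyN Γ}
    (e : M.J.El (M.U (M.F A))) (f : M.J.El (M.J.subP (M.J.wk A) (M.U X)))
    (a : M.J.El (M.J.subP σ A)) (c : M.J.El (M.cost Δ))
    (h : (M.step c (M.ret a)).1 = M.J.subT σ e.1) :
    (M.step (X := M.J.subN σ X) c ⟨M.J.subT (M.J.liftEl σ a) f.1, liftEl_wk_type M σ f a⟩).1 =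
      M.J.subT σ (M.bind e f).1 := by
  refine Eq.trans ?_ (M.bind_sub σ e f).symm
  have h' : (e.sub σ).cast (by rw [M.U_sub, M.F_sub]) = M.step c (M.ret a) := Subtype.ext h.symm
  rw [h', M.bind_step]
  refine step_congr rfl rfl ?_
  refine Eq.trans ?_ (M.bind_ret _ _).symm
  exact (congrArg (fun τ => M.J.subT τ f.1) (inst_up_rfl M.J σ a).symm).trans (M.J.subT_comp _ _ _)

/-- The world `beh` is the context `z : beh`, so `step_beh` and `clEta_beh` apply to all instances
at that world. -/
theorem beh_world : M.J.Beh (M.J.worlds.obj World.beh) := M.J.beh_extBeh M.J.one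

end

/-- Terms of a given type. -/
abbrev GEl {Γ : M.J.Glue} (A : Ty Γ) : Type (u + 1) := (gJ M).El A

/-- The syntactic component of a term. -/
def gt {Γ : M.J.Glue} {A : Ty Γ} (a : GEl A) : M.J.El A.B := ⟨a.1.t, ty_gt a⟩

/-- The common method for the equations of the gluing model: a law of `M` for the syntactic parts, a
pointwise identity for the sections. -/
theorem gel_ext {Γ : M.J.Glue} {A : Ty Γ} {a b : GEl A} (ht : a.1.t = b.1.t)
    (hs : ∀ w x, gsec a w x = gsec b w x) : a = b :=
  Subtype.ext (GTm.ext' (a.2.trans b.2.symm) ht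
    fun w x => (gsec_heq a w x).symm.trans ((heq_of_eq (hs w x)).trans (gsec_heq b w x)))

/-- The variant for types that are equal only propositionally, as in the stability of the constants
under substitution. -/
theorem gtm_ext {Γ : M.J.Glue} {A A' : Ty Γ} (hA : A = A') (a : GEl A) (b : GEl A')
    (ht : a.1.t = b.1.t) (hs : ∀ w x, gsec a w x ≍ gsec b w x) : a.1 = b.1 :=
  GTm.ext' (a.2.trans (hA.trans b.2.symm)) ht
    fun w x => (gsec_heq a w x).symm.trans ((hs w x).trans (gsec_heq b w x))

/-- Construct a term of a given type. -/
def mkEl {Γ : M.J.Glue} (A : Ty Γ) (t : M.J.El A.B) (sec : ∀ w x, A.Q w x)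
    (syn_sec : ∀ w x, A.syn w x (sec w x) = M.J.subT (pt Γ w x) t.1)
    (res_sec : ∀ x y h, A.res x y h (sec World.top x) = sec World.beh y) : GEl A :=
  ⟨⟨A, t.1, t.2, sec, syn_sec, res_sec⟩, rfl⟩

/-- The value type of computations. -/
def gU {Γ : M.J.Glue} (X : CTy Γ) : Ty Γ where
  toFam := X.toFam
  B := M.U X.Y
  ty_syn := X.ty_syn

theorem gU_sub {Δ Γ : M.J.Glue} (σ : Δ ⟶ Γ) (X : CTy Γ) : (gU X).sub σ = gU (X.sub σ) :=
  Ty.ext' (M.U_sub _ _) rfl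

/-- Families defined by cases on the world agree only after a case distinction, so the remaining
data are compared heterogeneously. -/
theorem Fam.ext_syn {J : Judgments C} {Γ : J.Glue} {F G : Fam Γ} (hQ : F.Q = G.Q)
    (hs : ∀ w x q q', q ≍ q' → F.syn w x q = G.syn w x q')
    (hr : ∀ x y h q q', q ≍ q' → F.res x y h q ≍ G.res x y h q') : F = G := by
  cases F
  cases G
  cases hQ
  congr
  · funext w x q
    exact hs w x q q HEq.rfl
  · funext x y h q
    exact eq_of_heq (hr x y h q q HEq.rfl)

/-- The semantic component of the free computation type: the writer monad at the top world, the identity at the behavioral one. -/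
def gFfam {Γ : M.J.Glue} (A : Ty Γ) : Fam Γ where
  Q := wcases (motive := fun w => Pt Γ w → Type u) (fun x => A.Q World.beh x)
    (fun x => A.Q World.top x × K)
  syn := wcases (fun _ q => (M.ret (A.el q)).1)
    (fun _ p => (M.step (M.cst _ p.2) (M.ret (A.el p.1))).1)
  res x y h p := A.res x y h p.1
  syn_res x y h p := by
    refine Eq.trans ?_ (M.step_sub _ _ _).symm
    -- In the context `z : beh` the charge disappears, so dropping the cost component under
    -- restriction is sound.
    refine Eq.trans ?_ (congrArg Subtype.val (M.step_beh (beh_world M) _ _)).symm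
    refine Eq.trans ?_ (M.ret_sub _ _).symm
    refine ret_congr M ?_ (A.syn_res x y h p.1)
    subst h
    rw [pt_rs, M.J.subP_comp]

/-- The free computation type. -/
def gF {Γ : M.J.Glue} (A : Ty Γ) : CTy Γ where
  toFam := gFfam A
  Y := M.F A.B
  ty_syn := wcases (fun x q => by rw [M.U_sub, M.F_sub]; exact (M.ret (A.el q)).2)
    (fun x p => by rw [M.U_sub, M.F_sub]; exact (M.step _ (M.ret (A.el p.1))).2)
  -- The new charge is added on the left, as `step_add` requires; `K` need not be commutative.
  act k _ p := (p.1, k + p.2)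
  act_zero _ p := Prod.ext rfl (zero_add p.2)
  act_add k l _ p := Prod.ext rfl (add_assoc k l p.2)
  act_res _ _ _ _ _ := rfl
  syn_act k x p := by
    refine (congrArg (fun c => (M.step c (M.ret (A.el p.1))).1) (M.cst_add _ k p.2)).trans ?_
    refine (congrArg Subtype.val (M.step_add _ _ _)).trans ?_
    exact step_congr (M.F_sub _ _).symm rfl rfl

theorem gF_sub {Δ Γ : M.J.Glue} (σ : Δ ⟶ Γ) (A : Ty Γ) : (gF A).sub σ = gF (A.sub σ) := by
  have hB : ∀ w x, M.J.subP (pt Γ w (mp σ w x)) A.B = M.J.subP (pt Δ w x) (M.J.subP σ.right A.B) :=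
    fun w x => by rw [← M.J.subP_comp, pt_mp]
  refine CTy.ext' (M.F_sub _ _) (Fam.ext_syn ?_ ?_ ?_) ?_
  · funext w
    match w with
    | 0 => rfl
    | 1 => rfl
  · refine wcases ?_ ?_
    · rintro x q _ ⟨⟩
      exact ret_congr M (hB _ x) rfl
    · rintro x q _ ⟨⟩
      exact step_congr (congrArg M.F (hB _ x)) rfl (ret_congr M (hB _ x) rfl)
  · rintro x y h q _ ⟨⟩
    rfl
  · rintro k x q _ ⟨⟩
    rfl

/-- The unit of the writer monad. -/
def gret {Γ : M.J.Glue} {A : Ty Γ} (a : GEl A) : GEl (gU (gF A)) :=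
  mkEl _ (M.ret (gt a)) (wcases (fun x => gsec a _ x) (fun x => (gsec a _ x, (0 : K))))
    (wcases (fun x => by
        refine Eq.trans ?_ (M.ret_sub _ _).symm
        exact ret_congr M rfl (gsec_syn a _ x))
      (fun x => by
        refine Eq.trans ?_ (M.ret_sub _ _).symm
        refine (congrArg Subtype.val (M.step_zero _)).trans ?_
        exact ret_congr M rfl (gsec_syn a _ x)))
    (fun x y h => gsec_res a x y h)

theorem gret_sub {Δ Γ : M.J.Glue} (σ : Δ ⟶ Γ) {A : Ty Γ} (a : GEl A) :
    ((gret a).sub σ).1 = (gret (a.sub σ)).1 := by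
  refine gtm_ext ((gU_sub _ _).trans (congrArg gU (gF_sub _ _))) _ _ (M.ret_sub _ _) ?_
  exact wcases (fun _ => HEq.rfl) (fun _ => HEq.rfl)

/-- Sequencing of computations. -/
def gbind {Γ : M.J.Glue} {A : Ty Γ} {X : CTy Γ} (e : GEl (gU (gF A)))
    (f : GEl ((gU X).sub (gwk A))) : GEl (gU X) :=
  mkEl _ (M.bind (gt e) (gt f))
    (wcases (fun x => gsec f World.beh ⟨x, gsec e World.beh x⟩)
      -- The continuation runs on the returned value, and the charge already incurred acts on its
      -- result.
      (fun x => X.act (gsec e World.top x).2 x (gsec f World.top ⟨x, (gsec e World.top x).1⟩)))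
    (wcases (fun x => (gsec_syn f World.beh ⟨x, gsec e World.beh x⟩).trans
        (bind_ret_sub M (pt Γ _ x) (gt e) (gt f) (A.el (gsec e World.beh x)) (gsec_syn e _ x)))
      (fun x => by
        refine (X.syn_act _ _ _).trans (Eq.trans ?_ (bind_step_ret_sub M (pt Γ _ x) (gt e) (gt f)
          (A.el (gsec e World.top x).1) _ (gsec_syn e _ x)))
        exact step_congr rfl rfl (gsec_syn f World.top ⟨x, (gsec e World.top x).1⟩)))
    (fun x y h => by
      refine (X.act_res _ _ _ _ _).trans ?_
      refine (gsec_res f ⟨x, (gsec e World.top x).1⟩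
        (⟨y, A.res x y h (gsec e World.top x).1⟩ : Σ x, A.Q World.beh x) (gext_rs A x y h _)).trans ?_
      exact congrArg (β := X.Q World.beh y) (fun q : A.Q World.beh y =>
        gsec f World.beh (⟨y, q⟩ : Σ x, A.Q World.beh x)) (gsec_res e x y h))

/-- The type of costs. -/
def gcost (Γ : M.J.Glue) : Ty Γ where
  Q _ _ := K
  syn _ _ k := (M.cst _ k).1
  res _ _ _ k := k
  syn_res _ _ _ _ := (M.cst_sub _ _).symm
  B := M.cost _
  ty_syn _ _ k := (M.cst _ k).2.trans (M.cost_sub _).symm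

theorem gcost_sub {Δ Γ : M.J.Glue} (σ : Δ ⟶ Γ) : (gcost Γ).sub σ = gcost Δ :=
  Ty.ext' (M.cost_sub _) rfl

/-- The constant costs. -/
def gcst (Γ : M.J.Glue) (k : K) : GEl (gcost Γ) :=
  mkEl _ (M.cst _ k) (fun _ _ => k) (fun _ _ => (M.cst_sub _ _).symm) (fun _ _ _ => rfl)

theorem add_congr {Γ : C} {c c' d d' : M.J.El (M.cost Γ)} (hc : c.1 = c'.1) (hd : d.1 = d'.1) :
    (M.add c d).1 = (M.add c' d').1 := by
  cases Subtype.ext hc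
  cases Subtype.ext hd
  rfl

/-- Addition of costs. -/
def gadd {Γ : M.J.Glue} (c d : GEl (gcost Γ)) : GEl (gcost Γ) :=
  mkEl _ (M.add (gt c) (gt d)) (fun w x => @HAdd.hAdd K K K _ (gsec c w x) (gsec d w x))
    (fun w x => by
      refine Eq.trans ?_ (M.add_sub _ _ _).symm
      refine (congrArg Subtype.val (M.cst_add _ _ _)).trans ?_
      exact add_congr (gsec_syn c w x) (gsec_syn d w x))
    (fun x y h => congrArg₂ (fun k l : K => k + l) (gsec_res c x y h) (gsec_res d x y h))

/-- Charging a cost. -/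
def gstep {Γ : M.J.Glue} {X : CTy Γ} (c : GEl (gcost Γ)) (e : GEl (gU X)) : GEl (gU X) :=
  mkEl _ (M.step (gt c) (gt e))
    (wcases (fun x => gsec e _ x) (fun x => X.act (gsec c World.top x) x (gsec e World.top x)))
    (wcases (fun x => by
        refine Eq.trans ?_ (M.step_sub _ _ _).symm
        refine Eq.trans ?_ (congrArg Subtype.val (M.step_beh (beh_world M) _ _)).symm
        exact gsec_syn e _ x)
      (fun x => by
        refine Eq.trans ?_ (M.step_sub _ _ _).symm
        refine (X.syn_act _ _ _).trans ?_
        exact step_congr rfl (gsec_syn c _ x) (gsec_syn e _ x)))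
    (fun x y h => (X.act_res _ _ _ _ _).trans (gsec_res e x y h))

theorem gbind_sub {Δ Γ : M.J.Glue} (σ : Δ ⟶ Γ) {A : Ty Γ} {X : CTy Γ} (e : GEl (gU (gF A)))
    (f : GEl ((gU X).sub (gwk A))) (he : (gU (gF A)).sub σ = gU (gF (A.sub σ)))
    (hf : ((gU X).sub (gwk A)).sub ((gJ M).up σ rfl) = (gU (X.sub σ)).sub (gwk (A.sub σ))) :
    ((gbind e f).sub σ).1 = (gbind (A := A.sub σ) (X := X.sub σ) ((e.sub σ).cast he)
      ((f.sub ((gJ M).up (A := A) σ rfl)).cast hf)).1 := by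
  refine gtm_ext (gU_sub _ _) _ _ (M.bind_sub _ _ _) ?_
  exact wcases (fun _ => HEq.rfl) (fun _ => HEq.rfl)

theorem gbind_ret {Γ : M.J.Glue} {A : Ty Γ} {X : CTy Γ} (a : GEl A)
    (f : GEl ((gU X).sub (gwk A))) :
    (gbind (gret a) f).1 = (f.sub ((gJ M).inst a)).1 := by
  refine gtm_ext ?_ _ _ (M.bind_ret _ _) ?_
  · symm
    exact ((gJ M).subP_comp _ _ _).symm.trans
      ((congrArg (fun τ => (gJ M).subP τ (gU X)) ((gJ M).inst_wk a)).trans ((gJ M).subP_id _))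
  · exact wcases (fun _ => HEq.rfl) (fun x => heq_of_eq (X.act_zero _ _))

theorem gbind_eta {Γ : M.J.Glue} {A : Ty Γ} (e : GEl (gU (gF A)))
    (h : gU (gF (A.sub (gwk A))) = (gU (gF A)).sub (gwk A)) :
    gbind e ((gret ((gJ M).v A)).cast h) = e := by
  refine gel_ext (congrArg Subtype.val (M.bind_eta (gt e))) ?_
  exact wcases (fun _ => rfl) (fun _ => Prod.ext rfl (add_zero _))

/-- At `top` the charges of `e` and `f` are combined in `K` on one side and act successively on the
other, so associativity is `act_add`. At `beh` there is no charge and both sides coincide. -/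
theorem gbind_assoc {Γ : M.J.Glue} {A B : Ty Γ} {X : CTy Γ} (e : GEl (gU (gF A)))
    (f : GEl ((gU (gF B)).sub (gwk A))) (g : GEl ((gU X).sub (gwk B)))
    (h1 : (gU (gF B)).sub (gwk A) = gU (gF (B.sub (gwk A))))
    (h2 : ((gU X).sub (gwk B)).sub ((gJ M).up (gwk A) rfl) =
      (gU (X.sub (gwk A))).sub (gwk (B.sub (gwk A))))
    (h3 : gU (X.sub (gwk A)) = (gU X).sub (gwk A)) :
    gbind (gbind e f) g = gbind e ((gbind (A := B.sub (gwk A)) (X := X.sub (gwk A)) (f.cast h1)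
        ((g.sub ((gJ M).up (A := B) (gwk A) rfl)).cast h2)).cast h3) := by
  refine gel_ext (congrArg Subtype.val (M.bind_assoc (gt e) (gt f) (gt g))) ?_
  exact wcases (fun _ => rfl) (fun _ => X.act_add _ _ _ _)

theorem gbind_step {Γ : M.J.Glue} {A : Ty Γ} {X : CTy Γ} (c : GEl (gcost Γ)) (e : GEl (gU (gF A)))
    (f : GEl ((gU X).sub (gwk A))) : gbind (gstep c e) f = gstep c (gbind e f) := by
  refine gel_ext (congrArg Subtype.val (M.bind_step (gt c) (gt e) (gt f))) ?_
  exact wcases (fun _ => rfl) (fun _ => X.act_add _ _ _ _)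

theorem gstep_sub {Δ Γ : M.J.Glue} (σ : Δ ⟶ Γ) {X : CTy Γ} (c : GEl (gcost Γ)) (e : GEl (gU X)) :
    ((gstep c e).sub σ).1 =
      (gstep ((c.sub σ).cast (gcost_sub σ)) ((e.sub σ).cast (gU_sub σ X))).1 := by
  refine gtm_ext (gU_sub _ _) _ _ (M.step_sub _ _ _) ?_
  exact wcases (fun _ => HEq.rfl) (fun _ => HEq.rfl)

theorem gstep_zero {Γ : M.J.Glue} {X : CTy Γ} (e : GEl (gU X)) : gstep (gcst Γ 0) e = e :=
  gel_ext (congrArg Subtype.val (M.step_zero (gt e)))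
    (wcases (fun _ => rfl) (fun _ => X.act_zero _ _))

theorem gstep_add {Γ : M.J.Glue} {X : CTy Γ} (c d : GEl (gcost Γ)) (e : GEl (gU X)) :
    gstep (gadd c d) e = gstep c (gstep d e) :=
  gel_ext (congrArg Subtype.val (M.step_add (gt c) (gt d) (gt e)))
    (wcases (fun _ => rfl)
      (fun x => X.act_add (gsec c World.top x : K) (gsec d World.top x : K) x _))

/-- Charges act only at `top`, and a context in which the phase holds has no elements there. -/
theorem gstep_beh {Γ : M.J.Glue} (h : GBeh Γ) {X : CTy Γ} (c : GEl (gcost Γ)) (e : GEl (gU X)) :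
    gstep c e = e :=
  gel_ext (congrArg Subtype.val (M.step_beh h.1 (gt c) (gt e)))
    (wcases (fun _ => rfl) (fun x => (h.2.false x).elim))

end

/-! ### Instances of the syntactic constants under substitution -/

section

variable {C : Type (u + 1)} [Category.{u} C] {K : Type u} [AddMonoid K]

section
variable (J : Judgments C)

theorem up_comp {Θ Δ Γ : C} (τ : Θ ⟶ Δ) (σ : Δ ⟶ Γ) {A : J.TyP Γ} {A' : J.TyP Δ} {A'' : J.TyP Θ}
    (h : J.subP σ A = A') (h' : J.subP τ A' = A'') :
    J.up τ h' ≫ J.up σ h = J.up (τ ≫ σ) (by rw [J.subP_comp, h, h']) := by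
  refine (comp_lift J _ _ _ _ _).trans ?_
  apply lift_congr
  · rw [← Category.assoc, J.up_wk, Category.assoc]
  · rw [J.up_var]

theorem subP_up_heq {Δ Γ : C} {σ σ' : Δ ⟶ Γ} (hσ : σ = σ') {A : J.TyP Γ} {A' A'' : J.TyP Δ}
    (h : J.subP σ A = A') (h' : J.subP σ' A = A'') (B : J.TyP (J.ext A)) :
    J.subP (J.up σ h) B ≍ J.subP (J.up σ' h') B := by
  subst hσ
  subst h
  subst h'
  rfl

theorem subN_up_heq {Δ Γ : C} {σ σ' : Δ ⟶ Γ} (hσ : σ = σ') {A : J.TyP Γ} {A' A'' : J.TyP Δ}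
    (h : J.subP σ A = A') (h' : J.subP σ' A = A'') (B : J.TyN (J.ext A)) :
    J.subN (J.up σ h) B ≍ J.subN (J.up σ' h') B := by
  subst hσ
  subst h
  subst h'
  rfl

/-- The contexts extended by `A[ρ]` and by `A[σ][τ]` are only propositionally equal, hence the
heterogeneous form. -/
theorem subP_up_up_heq {Θ Δ Γ : C} (τ : Θ ⟶ Δ) (σ : Δ ⟶ Γ) {ρ : Θ ⟶ Γ} (hρ : ρ = τ ≫ σ)
    {A : J.TyP Γ} (B : J.TyP (J.ext A)) :
    J.subP (J.up ρ rfl) B ≍ J.subP (J.up τ rfl) (J.subP (J.up σ rfl) B) := by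
  refine (subP_up_heq J hρ rfl (J.subP_comp τ σ A) B).trans (heq_of_eq ?_)
  exact (congrArg (fun f => J.subP f B) (up_comp J τ σ rfl rfl)).symm.trans (J.subP_comp _ _ B)

theorem subN_up_up_heq {Θ Δ Γ : C} (τ : Θ ⟶ Δ) (σ : Δ ⟶ Γ) {ρ : Θ ⟶ Γ} (hρ : ρ = τ ≫ σ)
    {A : J.TyP Γ} (B : J.TyN (J.ext A)) :
    J.subN (J.up ρ rfl) B ≍ J.subN (J.up τ rfl) (J.subN (J.up σ rfl) B) := by
  rw [← J.subN_comp, up_comp]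
  exact subN_up_heq J hρ _ _ _

theorem subP_inst_up_rfl {Δ Γ : C} (σ : Δ ⟶ Γ) {A : J.TyP Γ} (a : J.El (J.subP σ A))
    (B : J.TyP (J.ext A)) :
    J.subP (J.liftEl σ a) B = J.subP (J.inst a) (J.subP (J.up σ rfl) B) := by
  rw [← J.subP_comp, inst_up_rfl]

theorem subP_of_eq {Θ Δ Γ : C} (τ : Θ ⟶ Δ) (σ : Δ ⟶ Γ) {ρ : Θ ⟶ Γ} (hρ : ρ = τ ≫ σ)
    (A : J.TyP Γ) : J.subP ρ A = J.subP τ (J.subP σ A) := by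
  rw [hρ, J.subP_comp]

end

section
variable (M : Model K C)

theorem pair_congr {Γ : C} {A A' : M.J.TyP Γ} (hA : A = A') {B : M.J.TyP (M.J.ext A)}
    {B' : M.J.TyP (M.J.ext A')} (hB : B ≍ B') {a : M.J.El A} {a' : M.J.El A'} (ha : a.1 = a'.1)
    {b : M.J.El (M.J.subP (M.J.inst a) B)} {b' : M.J.El (M.J.subP (M.J.inst a') B')}
    (hb : b.1 = b'.1) : (M.pair a b).1 = (M.pair a' b').1 := by
  subst hA
  cases hB
  cases Subtype.ext ha
  cases Subtype.ext hb
  rfl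

/-- Pairs of an instance of a dependent sum type. -/
def pairAt {Δ Γ : C} (σ : Δ ⟶ Γ) {A : M.J.TyP Γ} {B : M.J.TyP (M.J.ext A)}
    (a : M.J.El (M.J.subP σ A)) (b : M.J.El (M.J.subP (M.J.liftEl σ a) B)) :
    M.J.El (M.J.subP σ (M.Sig A B)) :=
  (M.pair (A := M.J.subP σ A) (B := M.J.subP (M.J.up σ rfl) B) a
    (b.cast (subP_inst_up_rfl M.J σ a B))).cast (M.Sig_sub σ A B).symm

theorem pairAt_pair {Δ Γ : C} (σ : Δ ⟶ Γ) {A : M.J.TyP Γ} {B : M.J.TyP (M.J.ext A)}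
    (a : M.J.El (M.J.subP σ A)) (b : M.J.El (M.J.subP (M.J.liftEl σ a) B))
    (a' : M.J.El A) (b' : M.J.El (M.J.subP (M.J.inst a') B)) (ha : a.1 = M.J.subT σ a'.1)
    (hb : b.1 = M.J.subT σ b'.1) : (pairAt M σ a b).1 = M.J.subT σ (M.pair a' b').1 :=
  (pair_congr M rfl HEq.rfl ha hb).trans (M.pair_sub σ a' b').symm

theorem pairAt_sub {Θ Δ Γ : C} (τ : Θ ⟶ Δ) (σ : Δ ⟶ Γ) {ρ : Θ ⟶ Γ} (hρ : ρ = τ ≫ σ)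
    {A : M.J.TyP Γ} {B : M.J.TyP (M.J.ext A)}
    (a : M.J.El (M.J.subP σ A)) (b : M.J.El (M.J.subP (M.J.liftEl σ a) B))
    (a' : M.J.El (M.J.subP ρ A)) (b' : M.J.El (M.J.subP (M.J.liftEl ρ a') B))
    (ha : a'.1 = M.J.subT τ a.1) (hb : b'.1 = M.J.subT τ b.1) :
    (pairAt M ρ a' b').1 = M.J.subT τ (pairAt M σ a b).1 := by
  refine Eq.trans ?_ (M.pair_sub τ _ _).symm
  exact pair_congr M (subP_of_eq M.J τ σ hρ A) (subP_up_up_heq M.J τ σ hρ B) ha hb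

theorem pairAt_comp {Θ Δ Γ : C} (τ : Θ ⟶ Δ) (σ : Δ ⟶ Γ) {ρ : Θ ⟶ Γ} (hρ : ρ = τ ≫ σ)
    {A : M.J.TyP Γ} {B : M.J.TyP (M.J.ext A)}
    (a : M.J.El (M.J.subP ρ A)) (b : M.J.El (M.J.subP (M.J.liftEl ρ a) B))
    (a' : M.J.El (M.J.subP τ (M.J.subP σ A)))
    (b' : M.J.El (M.J.subP (M.J.liftEl τ a') (M.J.subP (M.J.up σ rfl) B)))
    (ha : a.1 = a'.1) (hb : b.1 = b'.1) : (pairAt M ρ a b).1 = (pairAt M τ a' b').1 :=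
  pair_congr M (subP_of_eq M.J τ σ hρ A) (subP_up_up_heq M.J τ σ hρ B) ha hb

theorem pair_inj {Γ : C} {A : M.J.TyP Γ} {B : M.J.TyP (M.J.ext A)} {a a' : M.J.El A}
    {b : M.J.El (M.J.subP (M.J.inst a) B)} {b' : M.J.El (M.J.subP (M.J.inst a') B)}
    (h : M.pair a b = M.pair a' b') : a.1 = a'.1 ∧ b.1 = b'.1 := by
  have hf : ∀ {p p' : M.J.El (M.Sig A B)}, p = p' → (M.snd p).1 = (M.snd p').1 := by
    rintro p _ rfl
    rfl
  constructor
  · rw [← M.fst_pair a b, h, M.fst_pair]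
  · rw [← M.snd_pair a b, ← M.snd_pair a' b', hf h]

/-- By η the term `p` is a pair of its projections, and pairing is injective. This lets the
projections of a semantic pair name the projections of the term. -/
theorem pairAt_proj {Δ Γ : C} (σ : Δ ⟶ Γ) {A : M.J.TyP Γ} {B : M.J.TyP (M.J.ext A)}
    (a : M.J.El (M.J.subP σ A)) (b : M.J.El (M.J.subP (M.J.liftEl σ a) B)) (p : M.J.El (M.Sig A B))
    (h : (pairAt M σ a b).1 = M.J.subT σ p.1) :
    a.1 = M.J.subT σ (M.fst p).1 ∧ b.1 = M.J.subT σ (M.snd p).1 := by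
  rw [← M.pair_eta p] at h
  exact pair_inj M (Subtype.ext (h.trans (M.pair_sub σ _ _)))

theorem eqRefl_congr {Γ : C} {A A' : M.J.TyP Γ} (h : A = A') {a : M.J.El A} {a' : M.J.El A'}
    (ha : a.1 = a'.1) : (M.eqRefl a).1 = (M.eqRefl a').1 := by
  subst h
  cases Subtype.ext ha
  rfl

/-- Stability of reflexivity is not among the laws of a model; it follows from uniqueness of
elements of equality types. -/
theorem eqRefl_sub {Δ Γ : C} (σ : Δ ⟶ Γ) {A : M.J.TyP Γ} (a : M.J.El A) :
    M.J.subT σ (M.eqRefl a).1 = (M.eqRefl (a.sub σ)).1 :=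
  congrArg Subtype.val
    (M.eqUnique (((M.eqRefl a).sub σ).cast (M.EqTy_sub σ a a)) (M.eqRefl (a.sub σ)))

theorem boolRec_lit {Γ : C} (D : M.J.TyP (M.J.ext (M.bool Γ)))
    (t : M.J.El (M.J.subP (M.J.inst (M.boolLit Γ true)) D))
    (f : M.J.El (M.J.subP (M.J.inst (M.boolLit Γ false)) D)) (c : Bool) :
    (M.boolRec D (M.boolLit Γ c) t f).1 = Bool.rec f.1 t.1 c :=
  match c with
  | true => congrArg Subtype.val (M.boolRec_true D t f)
  | false => congrArg Subtype.val (M.boolRec_false D t f)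

/-- The semantic value of a boolean provides the literal that it becomes under `σ`; the eliminator
then computes by β after substitution. -/
theorem boolRec_lit_sub {Δ Γ : C} (σ : Δ ⟶ Γ) (D : M.J.TyP (M.J.ext (M.bool Γ)))
    (b : M.J.El (M.bool Γ))
    (t : M.J.El (M.J.subP (M.J.inst (M.boolLit Γ true)) D))
    (f : M.J.El (M.J.subP (M.J.inst (M.boolLit Γ false)) D)) (c : Bool)
    (h : (M.boolLit Δ c).1 = M.J.subT σ b.1) :
    M.J.subT σ (M.boolRec D b t f).1 = Bool.rec (M.J.subT σ f.1) (M.J.subT σ t.1) c := by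
  refine (M.boolRec_sub σ D b t f).trans ?_
  have hb : (b.sub σ).cast (M.bool_sub σ) = M.boolLit Δ c := Subtype.ext h.symm
  rw [hb, boolRec_lit]
  rfl

theorem opLam_congr {Γ : C} {A A' : M.J.TyP (M.J.extBeh Γ)} (h : A = A') {a : M.J.El A}
    {a' : M.J.El A'} (ha : a.1 = a'.1) : (M.opLam a).1 = (M.opLam a').1 := by
  subst h
  cases Subtype.ext ha
  rfl

/-- Stability of elimination comes from that of `opLam` by β and η. -/
theorem opApp_sub {Δ Γ : C} (σ : Δ ⟶ Γ) {A : M.J.TyP (M.J.extBeh Γ)} (p : M.J.El (M.Op A)) :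
    M.J.subT (M.J.upBeh σ) (M.opApp p).1 = (M.opApp ((p.sub σ).cast (M.Op_sub σ A))).1 := by
  have h : (p.sub σ).cast (M.Op_sub σ A) = M.opLam ((M.opApp p).sub (M.J.upBeh σ)) := by
    apply Subtype.ext
    rw [← M.opLam_sub, M.opLam_opApp]
    rfl
  rw [h, M.opApp_opLam]
  rfl

theorem upBeh_comp {J : Judgments C} {Θ Δ Γ : C} (τ : Θ ⟶ Δ) (σ : Δ ⟶ Γ) :
    J.upBeh τ ≫ J.upBeh σ = J.upBeh (τ ≫ σ) := by
  apply J.extBeh_hom_ext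
  simp only [Judgments.upBeh, Category.assoc, J.liftBeh_wk]
  rw [← Category.assoc, J.liftBeh_wk, Category.assoc]

theorem star_congr {Γ : C} {A A' : M.J.TyP Γ} (h : A = A') (hb hb' : M.J.Beh Γ) :
    (M.star A hb).1 = (M.star A' hb').1 := by
  subst h
  rfl

theorem clEta_congr {Γ : C} {A A' : M.J.TyP Γ} (h : A = A') {a : M.J.El A} {a' : M.J.El A'}
    (ha : a.1 = a'.1) : (M.clEta a).1 = (M.clEta a').1 := by
  subst h
  cases Subtype.ext ha
  rfl

section
variable {M}
variable {Δ Γ : C} (σ : Δ ⟶ Γ) {A : M.J.TyP Γ} (D : M.J.TyP (M.J.ext (M.Cl A)))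
    (f : M.J.El (M.J.subP
      (M.J.liftEl (M.J.wk A) ((M.clEta (M.J.v A)).cast (M.Cl_sub _ A).symm)) D))
    (g : M.J.El (M.J.subP
      (M.J.liftEl (M.J.wkBeh Γ) ((M.star _ (M.J.beh_extBeh Γ)).cast (M.Cl_sub _ A).symm)) D))

/-- Naturality of the substitution that selects the `clEta` case, needed to type the substituted
case; `star_case_comp` does the same for the other case. -/
theorem clEta_case_comp {A' : M.J.TyP Δ} (h : M.J.subP σ A = A') {B' : M.J.TyP Δ}
    (hB : M.J.subP σ (M.Cl A) = B') (h' : M.Cl (M.J.subP (M.J.wk A') A') = M.J.subP (M.J.wk A') B') :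
    M.J.liftEl (M.J.wk A') ((M.clEta (M.J.v A')).cast h') ≫ M.J.up σ hB =
      M.J.up σ h ≫ M.J.liftEl (M.J.wk A) ((M.clEta (M.J.v A)).cast (M.Cl_sub _ A).symm) := by
  refine (comp_lift M.J _ _ _ _ _).trans (Eq.trans ?_ (comp_lift M.J _ _ _ _ _).symm)
  apply lift_congr
  · rw [← Category.assoc, M.J.up_wk]
    exact congrArg (· ≫ σ) (M.J.lift_wk _ _ _ _)
  · refine (M.J.lift_var _ _ _ _).trans (Eq.trans ?_ (M.clEta_sub _ _).symm)
    refine clEta_congr M ?_ (M.J.up_var σ h).symm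
    rw [M.J.subP_up_wk, h]

theorem star_case_comp {B' A' : M.J.TyP Δ} (h : M.J.subP σ A = A')
    (hB : M.J.subP σ (M.Cl A) = B')
    (h' : M.Cl (M.J.subP (M.J.wkBeh Δ) A') = M.J.subP (M.J.wkBeh Δ) B') :
    M.J.liftEl (M.J.wkBeh Δ) ((M.star _ (M.J.beh_extBeh Δ)).cast h') ≫ M.J.up σ hB =
      M.J.upBeh σ ≫
        M.J.liftEl (M.J.wkBeh Γ) ((M.star _ (M.J.beh_extBeh Γ)).cast (M.Cl_sub _ A).symm) := by
  have hw : M.J.upBeh σ ≫ M.J.wkBeh Γ = M.J.wkBeh Δ ≫ σ := M.J.liftBeh_wk _ _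
  refine (comp_lift M.J _ _ _ _ _).trans (Eq.trans ?_ (comp_lift M.J _ _ _ _ _).symm)
  apply lift_congr
  · rw [hw, ← Category.assoc]
    exact congrArg (· ≫ σ) (M.J.lift_wk _ _ _ _)
  · refine (M.J.lift_var _ _ _ _).trans (Eq.trans ?_ (M.star_sub _ _ _).symm)
    refine star_congr M ?_ _ _
    rw [← M.J.subP_comp, hw, M.J.subP_comp, h]

/-- The law `clRec_sub` takes the substituted cases as arguments. Constructing them, with their
types and coherence, makes the law applicable. -/
theorem clRec_sub_aux (coh : M.J.subT (M.J.wkBeh (M.J.ext A)) f.1 =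
    M.J.subT (M.J.upBeh (M.J.wk A)) g.1) (e : M.J.El (M.Cl A)) :
    ∃ f' g' coh', f'.1 = M.J.subT (M.J.up σ rfl) f.1 ∧ g'.1 = M.J.subT (M.J.upBeh σ) g.1 ∧
      M.J.subT σ (M.clRec D f g coh e).1 =
      (M.clRec (A := M.J.subP σ A) (M.J.subP (M.J.up σ (M.Cl_sub σ A)) D) f' g' coh'
        ((e.sub σ).cast (M.Cl_sub σ A))).1 := by
  refine ⟨⟨M.J.subT (M.J.up σ rfl) f.1, ?_⟩, ⟨M.J.subT (M.J.upBeh σ) g.1, ?_⟩, ?_, rfl, rfl,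
    M.clRec_sub σ D f g coh e _ rfl _ rfl ?_⟩
  · rw [M.J.ty_sub, f.2, ← M.J.subP_comp, ← M.J.subP_comp, clEta_case_comp]
  · rw [M.J.ty_sub, g.2, ← M.J.subP_comp, ← M.J.subP_comp, star_case_comp σ rfl]
  all_goals
    rw [← M.J.subT_comp, ← M.J.subT_comp, upBeh_comp, ← M.J.up_wk σ rfl, ← upBeh_comp,
      M.J.subT_comp _ _ g.1, ← coh, ← M.J.subT_comp]
    refine congrArg (fun τ => M.J.subT τ f.1) ?_
    exact (M.J.liftBeh_wk _ _).symm

/-- This and `clRec_star_sub` are the syntactic halves of case analysis. An element of the closed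
modality names some `clEta a` at `top` and `star` at `beh`, so after substitution the matching β law
applies. -/
theorem clRec_eta_sub (coh : M.J.subT (M.J.wkBeh (M.J.ext A)) f.1 =
    M.J.subT (M.J.upBeh (M.J.wk A)) g.1) (e : M.J.El (M.Cl A)) (a : M.J.El (M.J.subP σ A))
    (h : (M.clEta a).1 = M.J.subT σ e.1) :
    M.J.subT (M.J.liftEl σ a) f.1 = M.J.subT σ (M.clRec D f g coh e).1 := by
  obtain ⟨f', g', coh', hf, -, he⟩ := clRec_sub_aux σ D f g coh e
  have ha : (e.sub σ).cast (M.Cl_sub σ A) = M.clEta a := Subtype.ext h.symm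
  rw [he, ha, M.clRec_eta]
  refine Eq.trans ?_ (congrArg (M.J.subT (M.J.inst a)) hf.symm)
  rw [← M.J.subT_comp, inst_up_rfl]

theorem clRec_star_sub (coh : M.J.subT (M.J.wkBeh (M.J.ext A)) f.1 =
    M.J.subT (M.J.upBeh (M.J.wk A)) g.1) (e : M.J.El (M.Cl A)) (hb : M.J.Beh Δ)
    (h : (M.star (M.J.subP σ A) hb).1 = M.J.subT σ e.1) :
    M.J.subT (M.J.liftBeh σ hb) g.1 = M.J.subT σ (M.clRec D f g coh e).1 := by
  obtain ⟨f', g', coh', -, hg, he⟩ := clRec_sub_aux σ D f g coh e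
  have ha : (e.sub σ).cast (M.Cl_sub σ A) = M.star _ hb := Subtype.ext h.symm
  rw [he, ha, M.clRec_star]
  refine Eq.trans ?_ (congrArg (M.J.subT (M.J.liftBeh (𝟙 Δ) hb)) hg.symm)
  rw [← M.J.subT_comp]
  refine congrArg (fun τ => M.J.subT τ g.1) (M.J.extBeh_hom_ext _ _ ?_)
  simp only [Judgments.upBeh, Category.assoc, M.J.liftBeh_wk]
  rw [← Category.assoc, M.J.liftBeh_wk, Category.id_comp]

end

end

end

/-! ### Dependent sums, equality types and booleans -/

section

variable {C : Type (u + 1)} [Category.{u} C] {K : Type u} [AddMonoid K] {M : Model K C}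

theorem Fam.res_congr {J : Judgments C} {Γ : J.Glue} (F : Fam Γ) {x : Pt Γ World.top}
    {y y' : Pt Γ World.beh} (hy : y = y') (h : rs Γ x = y) (h' : rs Γ x = y')
    (q : F.Q World.top x) : F.res x y h q ≍ F.res x y' h' q := by
  subst hy
  rfl

/-- The instance of the type family `D` at an element of a context extension. -/
def elExt {Γ : M.J.Glue} {A : Ty Γ} (D : Ty (gext A)) {w : World} {x : Pt Γ w} {q : A.Q w x}
    (d : D.Q w (⟨x, q⟩ : Σ x, A.Q w x)) : M.J.El (M.J.subP (M.J.liftEl (pt Γ w x) (A.el q)) D.B) :=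
  D.el d

/-- Dependent sums. -/
def gSig {Γ : M.J.Glue} (A : Ty Γ) (D : Ty (gext A)) : Ty Γ where
  Q w x := Σ q : A.Q w x, D.Q w (⟨x, q⟩ : Σ x, A.Q w x)
  syn w x p := (pairAt M (pt Γ w x) (A.el p.1) (elExt D p.2)).1
  res x y h p := ⟨A.res x y h p.1, D.res _ _ (gext_rs A x y h p.1) p.2⟩
  syn_res x y h p := by
    subst h
    exact pairAt_sub M (wb M.J) (pt Γ _ x) (pt_rs Γ x) _ _ _ _ (A.syn_res _ _ _ _)
      (D.syn_res _ _ _ _)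
  B := M.Sig A.B D.B
  ty_syn _ _ p := (pairAt M _ (A.el p.1) (elExt D p.2)).2

theorem gSig_sub {Δ Γ : M.J.Glue} (σ : Δ ⟶ Γ) (A : Ty Γ) (D : Ty (gext A)) :
    (gSig A D).sub σ = gSig (A.sub σ) (D.sub ((gJ M).up (A := A) σ rfl)) := by
  refine Ty.ext' (M.Sig_sub _ _ _) (Fam.ext_syn rfl ?_ ?_)
  · rintro w x q _ ⟨⟩
    exact pairAt_comp M (pt Δ w x) σ.right (pt_mp σ w x) _ _ (Ty.el (A.sub σ) q.1) 
      (elExt (D.sub ((gJ M).up (A := A) σ rfl)) q.2) rfl rfl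
  · rintro x y h q _ ⟨⟩
    rfl

/-- Pairing. -/
def gpair {Γ : M.J.Glue} {A : Ty Γ} {D : Ty (gext A)} (a : GEl A)
    (b : GEl (D.sub ((gJ M).inst a))) : GEl (gSig A D) :=
  mkEl _ (M.pair (gt a) (gt b)) (fun w x => ⟨gsec a w x, gsec b w x⟩)
    (fun w x => pairAt_pair M _ _ _ _ _ (gsec_syn a w x) (gsec_syn b w x))
    (fun x y h => by
      refine Sigma.ext (gsec_res a x y h) ?_
      refine HEq.trans ?_ (heq_of_eq (gsec_res b x y h))
      exact D.res_congr (congrArg (Sigma.mk (β := fun x => A.Q World.beh x) y) (gsec_res a x y h)) _ _ _)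

theorem gpair_sub {Δ Γ : M.J.Glue} (σ : Δ ⟶ Γ) {A : Ty Γ} {D : Ty (gext A)} (a : GEl A)
    (b : GEl (D.sub ((gJ M).inst a)))
    (h : (D.sub ((gJ M).inst a)).sub σ =
      (D.sub ((gJ M).up (A := A) σ rfl)).sub ((gJ M).inst (A := A.sub σ) (a.sub σ))) :
    ((gpair a b).sub σ).1 =
      (gpair (A := A.sub σ) (D := D.sub ((gJ M).up (A := A) σ rfl)) (a.sub σ)
        ((b.sub σ).cast h)).1 :=
  gtm_ext (gSig_sub _ _ _) _ _ (M.pair_sub _ _ _) fun _ _ => HEq.rfl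

/-- First projection. -/
def gfst {Γ : M.J.Glue} {A : Ty Γ} {D : Ty (gext A)} (p : GEl (gSig A D)) : GEl A :=
  mkEl _ (M.fst (gt p)) (fun w x => (gsec p w x).1)
    (fun w x => (pairAt_proj M (pt Γ w x) _ _ (gt p) (gsec_syn p w x)).1)
    (fun x y h => congrArg Sigma.fst (gsec_res p x y h))

/-- Second projection. -/
def gsnd {Γ : M.J.Glue} {A : Ty Γ} {D : Ty (gext A)} (p : GEl (gSig A D)) :
    GEl (D.sub ((gJ M).inst (gfst p))) :=
  mkEl _ (M.snd (gt p)) (fun w x => (gsec p w x).2)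
    (fun w x => (pairAt_proj M (pt Γ w x) _ _ (gt p) (gsec_syn p w x)).2)
    (fun x y h => by
      have e := gsec_res p x y h
      refine eq_of_heq (HEq.trans ?_ (Sigma.ext_iff.1 e).2)
      exact D.res_congr (congrArg (Sigma.mk (β := fun x => A.Q World.beh x) y) 
        (congrArg Sigma.fst e)).symm _ _ _)

theorem gfst_gpair {Γ : M.J.Glue} {A : Ty Γ} {D : Ty (gext A)} (a : GEl A)
    (b : GEl (D.sub ((gJ M).inst a))) : gfst (gpair a b) = a :=
  gel_ext (congrArg Subtype.val (M.fst_pair (gt a) (gt b))) fun _ _ => rfl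

theorem gsnd_gpair {Γ : M.J.Glue} {A : Ty Γ} {D : Ty (gext A)} (a : GEl A)
    (b : GEl (D.sub ((gJ M).inst a))) : (gsnd (gpair a b)).1 = b.1 :=
  gtm_ext (congrArg (fun a => D.sub ((gJ M).inst a)) (gfst_gpair a b)) _ _
    (M.snd_pair (gt a) (gt b)) fun _ _ => HEq.rfl

theorem gpair_eta {Γ : M.J.Glue} {A : Ty Γ} {D : Ty (gext A)} (p : GEl (gSig A D)) :
    gpair (gfst p) (gsnd p) = p :=
  gel_ext (congrArg Subtype.val (M.pair_eta (gt p))) fun _ _ => rfl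

theorem el_gsec {Γ : M.J.Glue} {A : Ty Γ} (a : GEl A) (w : World) (x : Pt Γ w) :
    A.el (gsec a w x) = (gt a).sub (pt Γ w x) :=
  Subtype.ext (gsec_syn a w x)

/-- Extensional equality types. -/
def gEqTy {Γ : M.J.Glue} {A : Ty Γ} (a b : GEl A) : Ty Γ where
  Q w x := ULift (PLift (gsec a w x = gsec b w x))
  syn w x _ := (M.eqRefl (A.el (gsec a w x))).1
  res x y h q := ⟨⟨by rw [← gsec_res a x y h, ← gsec_res b x y h, q.down.down]⟩⟩
  syn_res x y h _ := by
    refine Eq.trans ?_ (eqRefl_sub M _ _).symm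
    subst h
    refine eqRefl_congr M (subP_of_eq M.J _ _ (pt_rs Γ x) _) ?_
    exact (congrArg (A.syn _ _) (gsec_res a x _ rfl)).symm.trans (A.syn_res _ _ _ _)
  B := M.EqTy (gt a) (gt b)
  ty_syn w x q := by
    -- The instances of `a` and `b` are named by their semantic values, so equality of the values
    -- makes reflexivity well typed here.
    rw [M.EqTy_sub, ← el_gsec, ← el_gsec, ← q.down.down]
    exact (M.eqRefl _).2

theorem gEqTy_sub {Δ Γ : M.J.Glue} (σ : Δ ⟶ Γ) {A : Ty Γ} (a b : GEl A) :
    (gEqTy a b).sub σ = gEqTy (A := A.sub σ) (a.sub σ) (b.sub σ) := by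
  refine Ty.ext' (M.EqTy_sub _ _ _) (Fam.ext_syn rfl ?_ ?_)
  · rintro w x q _ ⟨⟩
    exact eqRefl_congr M (subP_of_eq M.J _ _ (pt_mp σ w x) _) rfl
  · rintro x y h q _ ⟨⟩
    rfl

/-- Reflexivity. -/
def geqRefl {Γ : M.J.Glue} {A : Ty Γ} (a : GEl A) : GEl (gEqTy a a) :=
  mkEl _ (M.eqRefl (gt a)) (fun _ _ => ⟨⟨rfl⟩⟩)
    (fun w x => by
      refine Eq.trans ?_ (eqRefl_sub M _ _).symm
      exact eqRefl_congr M rfl (gsec_syn a w x))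
    (fun _ _ _ => rfl)

theorem geqReflect {Γ : M.J.Glue} {A : Ty Γ} {a b : GEl A} (p : GEl (gEqTy a b)) : a = b :=
  gel_ext (congrArg Subtype.val (M.eqReflect (gt p))) fun w x => (gsec p w x).down.down

theorem geqUnique {Γ : M.J.Glue} {A : Ty Γ} {a b : GEl A} (p q : GEl (gEqTy a b)) : p = q :=
  gel_ext (congrArg Subtype.val (M.eqUnique (gt p) (gt q))) fun w x =>
    @Subsingleton.elim (ULift (PLift (gsec a w x = gsec b w x))) _ _ _

/-- The type of booleans. -/
def gbool (Γ : M.J.Glue) : Ty Γ where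
  Q _ _ := ULift Bool
  syn _ _ c := (M.boolLit _ c.down).1
  res _ _ _ c := c
  syn_res _ _ _ _ := (M.boolLit_sub _ _).symm
  B := M.bool _
  ty_syn _ _ c := (M.boolLit _ c.down).2.trans (M.bool_sub _).symm

theorem gbool_sub {Δ Γ : M.J.Glue} (σ : Δ ⟶ Γ) : (gbool Γ).sub σ = gbool Δ :=
  Ty.ext' (M.bool_sub _) rfl

/-- The boolean constants. -/
def gboolLit (Γ : M.J.Glue) (c : Bool) : GEl (gbool Γ) :=
  mkEl _ (M.boolLit _ c) (fun _ _ => ⟨c⟩) (fun _ _ => (M.boolLit_sub _ _).symm) (fun _ _ _ => rfl)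

/-- Case distinction on the semantic booleans. -/
def boolCase {Γ : M.J.Glue} (D : Ty (gext (gbool Γ))) {w : World} {x : Pt Γ w}
    (t : D.Q w (⟨x, ⟨true⟩⟩ : Σ _ : Pt Γ w, ULift Bool))
    (f : D.Q w (⟨x, ⟨false⟩⟩ : Σ _ : Pt Γ w, ULift Bool)) :
    ∀ c : ULift Bool, D.Q w (⟨x, c⟩ : Σ _ : Pt Γ w, ULift Bool)
  | ⟨true⟩ => t
  | ⟨false⟩ => f

/-- Elimination of booleans. -/
def gboolRec {Γ : M.J.Glue} (D : Ty (gext (gbool Γ))) (b : GEl (gbool Γ))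
    (t : GEl (D.sub ((gJ M).inst (gboolLit Γ true))))
    (f : GEl (D.sub ((gJ M).inst (gboolLit Γ false)))) : GEl (D.sub ((gJ M).inst b)) :=
  mkEl _ (M.boolRec D.B (gt b) (gt t) (gt f))
    (fun w x => boolCase D (gsec t w x) (gsec f w x) (gsec b w x))
    (fun w x => by
      refine Eq.trans ?_
        (boolRec_lit_sub M (pt Γ w x) D.B (gt b) (gt t) (gt f) _ (gsec_syn b w x)).symm
      -- The syntactic eliminator has already been evaluated at the literal named by the semantic
      -- boolean; what remains is a case distinction on that boolean.
      have : ∀ c : ULift Bool, D.syn w (⟨x, c⟩ : Σ _ : Pt Γ w, ULift Bool)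
          (boolCase D (gsec t w x) (gsec f w x) c) =
          Bool.rec (M.J.subT (pt Γ w x) f.1.t) (M.J.subT (pt Γ w x) t.1.t) c.down
        | ⟨true⟩ => gsec_syn t w x
        | ⟨false⟩ => gsec_syn f w x
      exact this _)
    (fun x y h => by
      -- The boolean and its restriction are generalized together, so that both case distinctions
      -- reduce at once.
      have : ∀ (c : ULift Bool) (c' : ULift Bool) (hc : c = c'),
          D.res (⟨x, c⟩ : Σ _ : Pt Γ World.top, ULift Bool)
            (⟨y, c'⟩ : Σ _ : Pt Γ World.beh, ULift Bool)
            ((gext_rs (gbool Γ) x y h c).trans (by rw [← hc]; rfl))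
            (boolCase D (gsec t _ x) (gsec f _ x) c) = boolCase D (gsec t _ y) (gsec f _ y) c' := by
        rintro ⟨_ | _⟩ _ rfl
        · exact gsec_res f x y h
        · exact gsec_res t x y h
      exact this _ _ (gsec_res b x y h))

theorem gboolRec_sub {Δ Γ : M.J.Glue} (σ : Δ ⟶ Γ) (D : Ty (gext (gbool Γ))) (b : GEl (gbool Γ))
    (t : GEl (D.sub ((gJ M).inst (gboolLit Γ true))))
    (f : GEl (D.sub ((gJ M).inst (gboolLit Γ false))))
    (ht : (D.sub ((gJ M).inst (gboolLit Γ true))).sub σ =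
      (D.sub ((gJ M).up σ (gbool_sub σ))).sub ((gJ M).inst (gboolLit Δ true)))
    (hf : (D.sub ((gJ M).inst (gboolLit Γ false))).sub σ =
      (D.sub ((gJ M).up σ (gbool_sub σ))).sub ((gJ M).inst (gboolLit Δ false))) :
    ((gboolRec D b t f).sub σ).1 =
      (gboolRec (D.sub ((gJ M).up σ (gbool_sub σ))) ((b.sub σ).cast (gbool_sub σ))
        ((t.sub σ).cast ht) ((f.sub σ).cast hf)).1 := by
  refine gtm_ext ?_ _ _ (M.boolRec_sub _ _ _ _ _) ?_
  · exact (gJ M).subP_inst_up σ (gbool_sub σ) b ((b.sub σ).cast (gbool_sub σ)) rfl D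
  · intro w x
    have : ∀ c : ULift Bool,
        boolCase D (gsec t w (mp σ w x)) (gsec f w (mp σ w x)) c ≍
        boolCase (D.sub ((gJ M).up σ (gbool_sub σ))) (x := x) (gsec t w (mp σ w x))
          (gsec f w (mp σ w x)) c
      | ⟨true⟩ => HEq.rfl
      | ⟨false⟩ => HEq.rfl
    exact this _

theorem gboolRec_true {Γ : M.J.Glue} (D : Ty (gext (gbool Γ)))
    (t : GEl (D.sub ((gJ M).inst (gboolLit Γ true))))
    (f : GEl (D.sub ((gJ M).inst (gboolLit Γ false)))) :
    gboolRec D (gboolLit Γ true) t f = t :=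
  gel_ext (congrArg Subtype.val (M.boolRec_true D.B (gt t) (gt f))) fun _ _ => rfl

theorem gboolRec_false {Γ : M.J.Glue} (D : Ty (gext (gbool Γ)))
    (t : GEl (D.sub ((gJ M).inst (gboolLit Γ true))))
    (f : GEl (D.sub ((gJ M).inst (gboolLit Γ false)))) :
    gboolRec D (gboolLit Γ false) t f = f :=
  gel_ext (congrArg Subtype.val (M.boolRec_false D.B (gt t) (gt f))) fun _ _ => rfl

end

/-! ### The open and closed modalities -/

section

variable {C : Type (u + 1)} [Category.{u} C] {K : Type u} [AddMonoid K] {M : Model K C}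

section
variable (M)

/-- Elements of an instance of the open modality. -/
def opAt {Δ Γ : C} (σ : Δ ⟶ Γ) {A : M.J.TyP (M.J.extBeh Γ)}
    (a : M.J.El (M.J.subP (M.J.upBeh σ) A)) : M.J.El (M.J.subP σ (M.Op A)) :=
  (M.opLam a).cast (M.Op_sub σ A).symm

theorem opAt_comp {Θ Δ Γ : C} (τ : Θ ⟶ Δ) (σ : Δ ⟶ Γ) {ρ : Θ ⟶ Γ} (hρ : ρ = τ ≫ σ)
    {A : M.J.TyP (M.J.extBeh Γ)} (a : M.J.El (M.J.subP (M.J.upBeh ρ) A))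
    (a' : M.J.El (M.J.subP (M.J.upBeh τ) (M.J.subP (M.J.upBeh σ) A))) (ha : a.1 = a'.1) :
    (opAt M ρ a).1 = (opAt M τ a').1 :=
  opLam_congr M (by rw [hρ, ← upBeh_comp, M.J.subP_comp]) ha

theorem opAt_sub {Θ Δ Γ : C} (τ : Θ ⟶ Δ) (σ : Δ ⟶ Γ) {ρ : Θ ⟶ Γ} (hρ : ρ = τ ≫ σ)
    {A : M.J.TyP (M.J.extBeh Γ)} (a : M.J.El (M.J.subP (M.J.upBeh σ) A))
    (a' : M.J.El (M.J.subP (M.J.upBeh ρ) A)) (ha : a'.1 = M.J.subT (M.J.upBeh τ) a.1) :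
    (opAt M ρ a').1 = M.J.subT τ (opAt M σ a).1 := by
  refine Eq.trans ?_ (M.opLam_sub τ a).symm
  exact opLam_congr M (by rw [hρ, ← upBeh_comp, M.J.subP_comp]) ha

theorem opAt_opApp {Δ Γ : C} (σ : Δ ⟶ Γ) {A : M.J.TyP (M.J.extBeh Γ)}
    (a : M.J.El (M.J.subP (M.J.upBeh σ) A)) (p : M.J.El (M.Op A))
    (h : (opAt M σ a).1 = M.J.subT σ p.1) : a.1 = M.J.subT (M.J.upBeh σ) (M.opApp p).1 := by
  rw [opApp_sub]
  have h' : (p.sub σ).cast (M.Op_sub σ A) = M.opLam a := Subtype.ext h.symm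
  rw [h', M.opApp_opLam]

end

/-- The phase is a proposition, so maps into an extension by it are determined by their weakenings.
-/
theorem wkBeh_pt {Γ : M.J.Glue} (y : Pt Γ World.beh) :
    M.J.wkBeh (M.J.worlds.obj World.beh) ≫ pt (gextBeh Γ) World.beh y =
      M.J.upBeh (pt Γ World.beh y) := by
  apply M.J.extBeh_hom_ext
  refine (Category.assoc _ _ _).trans (Eq.trans ?_ (M.J.liftBeh_wk _ _).symm)
  exact congrArg (M.J.wkBeh (M.J.worlds.obj World.beh) ≫ ·) (M.J.liftBeh_wk _ _)

/-- The world `beh` is the world `top` extended by the phase. Hence a member of `A` over `rs Γ x`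
names a term in exactly the context of the body of an open-modality term at `top`. -/
theorem upBeh_pt {Γ : M.J.Glue} (x : Pt Γ World.top) :
    pt (gextBeh Γ) World.beh (rs Γ x) = M.J.upBeh (pt Γ World.top x) := by
  apply M.J.extBeh_hom_ext
  refine (M.J.liftBeh_wk _ _).trans (Eq.trans ?_ (M.J.liftBeh_wk _ _).symm)
  exact pt_rs Γ x

section
variable {Γ : M.J.Glue} (A : Ty (gextBeh Γ))

/-- The term of the open modality given by an element at the behavioral world. -/
def opBeh (y : Pt Γ World.beh) (q : A.Q World.beh y) :
    M.J.El (M.J.subP (M.J.upBeh (pt Γ World.beh y)) A.B) :=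
  ⟨M.J.subT (M.J.wkBeh (M.J.worlds.obj World.beh)) (A.syn World.beh y q), by
    refine (M.J.ty_sub _ _).trans ((congrArg _ (A.ty_syn _ _ _)).trans ?_)
    exact (M.J.subP_comp _ _ _).symm.trans (congrArg (fun τ => M.J.subP τ A.B) (wkBeh_pt y))⟩

/-- The term of the open modality given, at the top world, by an element at the behavioral world. -/
def opTop (x : Pt Γ World.top) (q : A.Q World.beh (rs Γ x)) :
    M.J.El (M.J.subP (M.J.upBeh (pt Γ World.top x)) A.B) :=
  ⟨A.syn World.beh (rs Γ x) q, by
    exact (A.ty_syn _ _ _).trans (congrArg (fun τ => M.J.subP τ A.B) (upBeh_pt x))⟩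

/-- The semantic component of the open modality. -/
def gOpFam : Fam Γ where
  Q := wcases (motive := fun w => Pt Γ w → Type u) (fun y => A.Q World.beh y)
    (fun x => A.Q World.beh (rs Γ x))
  syn := wcases (fun y q => (opAt M _ (opBeh A y q)).1) (fun x q => (opAt M _ (opTop A x q)).1)
  res x y h q := cast (congrArg (A.Q World.beh) h) q
  syn_res x y h q := by
    subst h
    refine opAt_sub M (wb M.J) _ (pt_rs Γ x) _ _ ?_
    refine congrArg (fun τ => M.J.subT τ (A.syn World.beh (rs Γ x) q)) ?_
    -- Both substitutions land in `z : beh` over the empty context, which is subterminal.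
    exact M.J.extBeh_hom_ext _ _ (M.J.isTerminal.hom_ext _ _)

/-- The open modality. -/
def gOp : Ty Γ where
  toFam := gOpFam A
  B := M.Op A.B
  ty_syn := wcases (fun y q => (opAt M _ (opBeh A y q)).2) (fun x q => (opAt M _ (opTop A x q)).2)

theorem syn_heq {y y' : Pt Γ World.beh} (h : y = y') (q : A.Q World.beh y) (q' : A.Q World.beh y')
    (hq : q ≍ q') : A.syn World.beh y q = A.syn World.beh y' q' := by
  subst h
  cases hq
  rfl

end

theorem gOp_sub {Δ Γ : M.J.Glue} (σ : Δ ⟶ Γ) (A : Ty (gextBeh Γ)) :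
    (gOp A).sub σ = gOp (A.sub ((gJ M).upBeh σ)) := by
  refine Ty.ext' (M.Op_sub _ _) (Fam.ext_syn ?_ ?_ ?_)
  · funext w
    match w with
    | 0 => rfl
    | 1 => exact funext fun x => congrArg (A.Q World.beh) (mp_rs σ x).symm
  · refine wcases ?_ ?_
    · rintro y q _ ⟨⟩
      exact opAt_comp M (pt Δ _ y) σ.right (pt_mp σ _ y) _
        (opBeh (A.sub ((gJ M).upBeh σ)) y q) rfl
    · intro x q q' hq
      refine opAt_comp M (pt Δ _ x) σ.right (pt_mp σ _ x) _
        (opTop (A.sub ((gJ M).upBeh σ)) x q') ?_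
      exact syn_heq A (mp_rs σ x).symm q q' hq
  · intro x y h q q' hq
    exact (cast_heq _ _).trans (hq.trans (cast_heq _ _).symm)

/-- Introduction for the open modality. -/
def gopLam {Γ : M.J.Glue} {A : Ty (gextBeh Γ)} (a : GEl A) : GEl (gOp A) :=
  mkEl _ (M.opLam (gt a)) (wcases (fun y => gsec a World.beh y) (fun x => gsec a World.beh (rs Γ x)))
    (wcases (fun y => by
        refine Eq.trans ?_ (M.opLam_sub _ _).symm
        refine opLam_congr M rfl ?_
        refine (congrArg (M.J.subT (M.J.wkBeh (M.J.worlds.obj World.beh)))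
          (gsec_syn a World.beh y)).trans ?_
        exact (M.J.subT_comp _ _ _).symm.trans
          (congrArg (fun τ => M.J.subT τ a.1.t) (wkBeh_pt y)))
      (fun x => by
        refine Eq.trans ?_ (M.opLam_sub _ _).symm
        refine opLam_congr M rfl ?_
        exact (gsec_syn a World.beh (rs Γ x)).trans
          (congrArg (fun τ => M.J.subT τ a.1.t) (upBeh_pt x))))
    (fun x y h => by
      subst h
      rfl)

theorem gsec_congr_pt {Γ : M.J.Glue} {A : Ty Γ} (a : GEl A) (w : World) {x y : Pt Γ w}
    (h : x = y) : gsec a w x ≍ gsec a w y := by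
  rw [h]

theorem gopLam_sub {Δ Γ : M.J.Glue} (σ : Δ ⟶ Γ) {A : Ty (gextBeh Γ)} (a : GEl A) :
    ((gopLam a).sub σ).1 = (gopLam (A := A.sub ((gJ M).upBeh σ)) (a.sub ((gJ M).upBeh σ))).1 := by
  refine gtm_ext (gOp_sub _ _) _ _ (M.opLam_sub _ _) ?_
  exact wcases (fun _ => HEq.rfl) (fun x => gsec_congr_pt a World.beh (mp_rs σ x).symm)

/-- Elimination for the open modality. -/
def gopApp {Γ : M.J.Glue} {A : Ty (gextBeh Γ)} (p : GEl (gOp A)) : GEl A :=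
  mkEl _ (M.opApp (gt p)) (wcases (fun y => gsec p World.beh y) (fun x => nomatch (x : PEmpty)))
    (wcases (fun y => by
      have e := opAt_opApp M _ (opBeh A y (gsec p World.beh y)) (gt p) (gsec_syn p World.beh y)
      -- The equation `e` lives under a second assumption of the phase. The world `beh` already
      -- proves the phase, so this assumption can be instantiated away.
      have e' := congrArg (M.J.subT (M.J.liftBeh (𝟙 _) (beh_world M))) e
      refine Eq.trans ?_ (e'.trans ?_)
      · refine Eq.trans ?_ (M.J.subT_comp _ _ _)
        rw [M.J.liftBeh_wk, M.J.subT_id]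
        rfl
      · refine (M.J.subT_comp _ _ _).symm.trans ?_
        refine congrArg (fun τ => M.J.subT τ (M.opApp (gt p)).1) ?_
        refine (congrArg (M.J.liftBeh (𝟙 _) (beh_world M) ≫ ·) (wkBeh_pt (Γ := Γ) y).symm).trans ?_
        refine (Category.assoc _ _ _).symm.trans ?_
        exact (congrArg (· ≫ _) (M.J.liftBeh_wk _ _)).trans (Category.id_comp _))
      (fun x => nomatch (x : PEmpty)))
    (fun x => nomatch (x : PEmpty))

theorem gopApp_gopLam {Γ : M.J.Glue} {A : Ty (gextBeh Γ)} (a : GEl A) : gopApp (gopLam a) = a :=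
  gel_ext (congrArg Subtype.val (M.opApp_opLam (gt a)))
    (wcases (fun _ => rfl) (fun x => nomatch (x : PEmpty)))

theorem gopLam_gopApp {Γ : M.J.Glue} {A : Ty (gextBeh Γ)} (p : GEl (gOp A)) :
    gopLam (gopApp p) = p :=
  gel_ext (congrArg Subtype.val (M.opLam_opApp (gt p)))
    -- An element of the open modality at `top` is the same thing as its restriction to `beh`, which
    -- gives η there.
    (wcases (fun _ => rfl) (fun x => (gsec_res p x _ rfl).symm))

section
variable {Γ : M.J.Glue} (A : Ty Γ)

/-- The semantic component of the closed modality. -/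
def gClFam : Fam Γ where
  Q := wcases (motive := fun w => Pt Γ w → Type u) (fun _ => PUnit) (fun x => A.Q World.top x)
  syn := wcases (fun y _ => (M.star (M.J.subP (pt Γ _ y) A.B) (beh_world M)).1)
    (fun _ q => (M.clEta (A.el q)).1)
  res _ _ _ _ := PUnit.unit
  syn_res x y h q := by
    subst h
    refine Eq.trans ?_ (M.clEta_sub _ _).symm
    -- In the context `z : beh` every `clEta a` equals `star`, so restriction to the one-point set
    -- loses nothing syntactically.
    refine Eq.trans ?_ (congrArg Subtype.val (M.clEta_beh _ (beh_world M))).symm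
    exact star_congr M (subP_of_eq M.J _ _ (pt_rs Γ x) _) _ _

/-- The closed modality. -/
def gCl : Ty Γ where
  toFam := gClFam A
  B := M.Cl A.B
  ty_syn := wcases (fun _ _ => (M.star _ _).2.trans (M.Cl_sub _ _).symm)
    (fun _ q => (M.clEta (A.el q)).2.trans (M.Cl_sub _ _).symm)

end

theorem gCl_sub {Δ Γ : M.J.Glue} (σ : Δ ⟶ Γ) (A : Ty Γ) : (gCl A).sub σ = gCl (A.sub σ) := by
  refine Ty.ext' (M.Cl_sub _ _) (Fam.ext_syn ?_ ?_ ?_)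
  · funext w
    match w with
    | 0 => rfl
    | 1 => rfl
  · refine wcases ?_ ?_
    · rintro y q _ ⟨⟩
      exact star_congr M (subP_of_eq M.J _ _ (pt_mp σ _ y) _) _ _
    · rintro x q _ ⟨⟩
      exact clEta_congr M (subP_of_eq M.J _ _ (pt_mp σ _ x) _) rfl
  · intro x y h q q' hq
    rfl

/-- The unit of the closed modality. -/
def gclEta {Γ : M.J.Glue} {A : Ty Γ} (a : GEl A) : GEl (gCl A) :=
  mkEl _ (M.clEta (gt a)) (wcases (fun _ => PUnit.unit) (fun x => gsec a World.top x))
    (wcases (fun y => by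
        refine Eq.trans ?_ (M.clEta_sub _ _).symm
        exact (congrArg Subtype.val (M.clEta_beh _ (beh_world M))).symm)
      (fun x => by
        refine Eq.trans ?_ (M.clEta_sub _ _).symm
        exact clEta_congr M rfl (gsec_syn a _ x)))
    (fun _ _ _ => rfl)

theorem gclEta_sub {Δ Γ : M.J.Glue} (σ : Δ ⟶ Γ) {A : Ty Γ} (a : GEl A) :
    ((gclEta a).sub σ).1 = (gclEta (A := A.sub σ) (a.sub σ)).1 :=
  gtm_ext (gCl_sub _ _) _ _ (M.clEta_sub _ _) (wcases (fun _ => HEq.rfl) (fun _ => HEq.rfl))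

/-- The point of the closed modality under the phase. -/
def gstar {Γ : M.J.Glue} (A : Ty Γ) (h : GBeh Γ) : GEl (gCl A) :=
  mkEl _ (M.star A.B h.1) (wcases (fun _ => PUnit.unit) (fun x => (h.2.false x).elim))
    (wcases (fun _ => (M.star_sub _ _ _).symm) (fun x => (h.2.false x).elim))
    (fun x => (h.2.false x).elim)

theorem gstar_sub {Δ Γ : M.J.Glue} (σ : Δ ⟶ Γ) (A : Ty Γ) (h : GBeh Γ) (h' : GBeh Δ) :
    (El.sub (J := gJ M) (gstar A h) σ).1 = (gstar (A.sub σ) h').1 :=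
  gtm_ext (gCl_sub _ _) _ _ (M.star_sub _ _ _)
    (wcases (fun _ => HEq.rfl) (fun x => (h'.2.false x).elim))

theorem gclEta_beh {Γ : M.J.Glue} {A : Ty Γ} (a : GEl A) (h : GBeh Γ) : gclEta a = gstar A h :=
  gel_ext (congrArg Subtype.val (M.clEta_beh (gt a) h.1))
    (wcases (fun _ => rfl) (fun x => (h.2.false x).elim))

theorem inst_clEta (M : Model K C) {Γ : C} {A : M.J.TyP Γ} (a : M.J.El A) :
    M.J.inst (M.clEta a) =
      M.J.inst a ≫ M.J.liftEl (M.J.wk A) ((M.clEta (M.J.v A)).cast (M.Cl_sub _ A).symm) := by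
  refine Eq.trans ?_ (comp_lift M.J _ _ _ _ _).symm
  refine lift_congr M.J _ (M.J.inst_wk a).symm (Eq.trans ?_ (M.clEta_sub _ _).symm)
  refine clEta_congr M ?_ (M.J.inst_var a).symm
  rw [← M.J.subP_comp, M.J.inst_wk, M.J.subP_id]

theorem inst_star (M : Model K C) {Γ : C} (A : M.J.TyP Γ) (h : M.J.Beh Γ) :
    M.J.inst (M.star A h) = M.J.liftBeh (𝟙 Γ) h ≫
      M.J.liftEl (M.J.wkBeh Γ) ((M.star _ (M.J.beh_extBeh Γ)).cast (M.Cl_sub _ A).symm) := by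
  refine Eq.trans ?_ (comp_lift M.J _ _ _ _ _).symm
  refine lift_congr M.J _ (M.J.liftBeh_wk _ _).symm (Eq.trans ?_ (M.star_sub _ _ _).symm)
  refine star_congr M ?_ _ _
  rw [← M.J.subP_comp, M.J.liftBeh_wk, M.J.subP_id]

section
variable {Γ : M.J.Glue} {A : Ty Γ} (D : Ty (gext (gCl A)))
  (f : GEl (D.sub ((gJ M).liftEl (gwk A) ((gclEta ((gJ M).v A)).cast (gCl_sub _ A).symm))))
  (g : GEl (D.sub ((gJ M).liftEl (gwkBeh Γ)
    ((gstar _ (gextBeh_beh Γ)).cast (gCl_sub _ A).symm))))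
  (coh : (gJ M).subT (gwkBeh (gext A)) f.1 = (gJ M).subT ((gJ M).upBeh (gwk A)) g.1)

/-- Elimination for the closed modality. -/
def gclRec (e : GEl (gCl A)) : GEl (D.sub ((gJ M).inst e)) :=
  mkEl _ (M.clRec D.B (gt f) (gt g) (congrArg GTm.t coh) (gt e))
    -- The single point at `beh` is handled by `g` and a member of `A` at `top` by `f`; `coh` makes
    -- the two choices commute with restriction.
    (wcases (fun y => gsec g World.beh y) (fun x => gsec f World.top ⟨x, gsec e World.top x⟩))
    (wcases (fun y => by
        refine (gsec_syn g World.beh y).trans ?_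
        exact clRec_star_sub (pt Γ _ y) D.B (gt f) (gt g) _ (gt e) _ (gsec_syn e World.beh y))
      (fun x => by
        refine (gsec_syn f World.top ⟨x, gsec e World.top x⟩).trans ?_
        exact clRec_eta_sub (pt Γ _ x) D.B (gt f) (gt g) _ (gt e) (A.el (gsec e World.top x))
          (gsec_syn e World.top x)))
    (fun x y h => by
      refine (gsec_res f ⟨x, gsec e World.top x⟩
        (⟨y, A.res x y h (gsec e World.top x)⟩ : Σ x, A.Q World.beh x)
        (gext_rs A x y h _)).trans ?_
      refine eq_of_heq ((gsec_heq f _ _).trans (HEq.trans ?_ (gsec_heq g _ _).symm))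
      exact GTm.sec_congr coh World.beh
        (⟨y, A.res x y h (gsec e World.top x)⟩ : Σ x, A.Q World.beh x))

theorem gclRec_eta (a : GEl A) : (gclRec D f g coh (gclEta a)).1 = (f.sub ((gJ M).inst a)).1 := by
  refine gtm_ext ?_ _ _ (M.clRec_eta _ _ _ _ _) ?_
  · refine Eq.trans ?_ ((gJ M).subP_comp _ _ _)
    refine congrArg (fun τ => (gJ M).subP τ D) ?_
    exact hom_ext (wcases (fun _ => rfl) (fun _ => rfl)) (inst_clEta M (gt a))
  · refine wcases (fun y => ?_) (fun _ => HEq.rfl)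
    refine HEq.trans ?_ (gsec_heq f World.beh (⟨y, gsec a World.beh y⟩ : Σ x, A.Q World.beh x)).symm
    refine (gsec_heq g World.beh y).trans ?_
    exact (GTm.sec_congr coh World.beh (⟨y, gsec a World.beh y⟩ : Σ x, A.Q World.beh x)).symm

theorem gclRec_star (h : GBeh Γ) :
    (gclRec D f g coh (gstar A h)).1 = (g.sub ((gJ M).liftBeh (𝟙 Γ) h)).1 := by
  refine gtm_ext ?_ _ _ (M.clRec_star _ _ _ _ _) ?_
  · refine Eq.trans ?_ ((gJ M).subP_comp _ _ _)
    refine congrArg (fun τ => (gJ M).subP τ D) ?_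
    exact hom_ext (wcases (fun _ => rfl) (fun x => (h.2.false x).elim)) (inst_star M A.B h.1)
  · exact wcases (fun _ => HEq.rfl) (fun x => (h.2.false x).elim)

theorem gclRec_sub {Δ : M.J.Glue} (σ : Δ ⟶ Γ) (e : GEl (gCl A))
    (f' : GEl ((D.sub ((gJ M).up σ (gCl_sub σ A))).sub ((gJ M).liftEl (gwk (A.sub σ))
      ((gclEta ((gJ M).v (A.sub σ))).cast (gCl_sub _ _).symm))))
    (hf : f'.1 = (gJ M).subT ((gJ M).up (A := A) σ rfl) f.1)
    (g' : GEl ((D.sub ((gJ M).up σ (gCl_sub σ A))).sub ((gJ M).liftEl (gwkBeh Δ)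
      ((gstar _ (gextBeh_beh Δ)).cast (gCl_sub _ _).symm))))
    (hg : g'.1 = (gJ M).subT ((gJ M).upBeh σ) g.1)
    (coh' : (gJ M).subT (gwkBeh (gext (A.sub σ))) f'.1 =
      (gJ M).subT ((gJ M).upBeh (gwk (A.sub σ))) g'.1) :
    (El.sub (J := gJ M) (gclRec D f g coh e) σ).1 =
      (gclRec (A := A.sub σ) (D.sub ((gJ M).up σ (gCl_sub σ A))) f' g' coh'
        ((El.sub (J := gJ M) e σ).cast (gCl_sub σ A))).1 := by
  refine gtm_ext ?_ _ _ (M.clRec_sub σ.right D.B (gt f) (gt g) (congrArg GTm.t coh) (gt e)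
    (gt f') (congrArg GTm.t hf) (gt g') (congrArg GTm.t hg) (congrArg GTm.t coh')) ?_
  · exact (gJ M).subP_inst_up σ (gCl_sub σ A) e _ rfl D
  · refine wcases (fun y => ?_) (fun x => ?_)
    · refine (gsec_heq g World.beh (mp σ _ y)).trans (HEq.trans ?_ (gsec_heq g' World.beh y).symm)
      exact GTm.sec_congr hg.symm World.beh y
    · refine (gsec_heq f World.top ⟨mp σ _ x, gsec e World.top (mp σ _ x)⟩).trans
        (HEq.trans ?_ (gsec_heq f' World.top
          (⟨x, gsec e World.top (mp σ _ x)⟩ : Σ x, (A.sub σ).Q World.top x)).symm)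
      exact GTm.sec_congr hf.symm World.top
        (⟨x, gsec e World.top (mp σ _ x)⟩ : Σ x, (A.sub σ).Q World.top x)

end

end

/-! ### Dependent products -/

section

variable {C : Type (u + 1)} [Category.{u} C] {K : Type u} [AddMonoid K]

section
variable {J : Judgments C}

/-- A small type of terms of a given type, by local smallness of the category of contexts. -/
def Sm {Γ : C} (T : J.TyP Γ) : Type u := {s : Γ ⟶ J.ext T // s ≫ J.wk T = 𝟙 Γ}

/-- The small code of a term. -/
def Sm.mk {Γ : C} {T : J.TyP Γ} (a : J.El T) : Sm T := ⟨J.inst a, J.inst_wk a⟩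

/-- The term with a given small code. -/
def Sm.el {Γ : C} {T : J.TyP Γ} (s : Sm T) : J.El T :=
  ⟨J.subT s.1 (J.var T), by rw [J.ty_sub, J.ty_var, ← J.subP_comp, s.2, J.subP_id]⟩

theorem Sm.el_mk {Γ : C} {T : J.TyP Γ} (a : J.El T) : (Sm.mk a).el = a :=
  Subtype.ext (J.inst_var a)

theorem Sm.ext {Γ : C} {T : J.TyP Γ} {s s' : Sm T} (h : s.el.1 = s'.el.1) : s = s' :=
  Subtype.ext (J.ext_hom_ext _ _ _ (s.2.trans s'.2.symm) h)

/-- Elements of `F` together with a syntactic term that tracks them. -/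
structure Trk {Γ : C} (T : J.TyP Γ) (F : Type u) (P : J.Tm Γ → F → Prop) : Type u where
  s : Sm T
  f : F
  h : P s.el.1 f

/-- An element tracked by a term. -/
def Trk.of {Γ : C} {T : J.TyP Γ} {F : Type u} {P : J.Tm Γ → F → Prop} (a : J.El T) (f : F)
    (h : P a.1 f) : Trk T F P := ⟨Sm.mk a, f, by rw [Sm.el_mk]; exact h⟩

theorem Trk.ext' {Γ : C} {T : J.TyP Γ} {F : Type u} {P : J.Tm Γ → F → Prop} {p p' : Trk T F P}
    (hs : p.s.el.1 = p'.s.el.1) (hf : p.f = p'.f) : p = p' := by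
  obtain ⟨s, f, _⟩ := p
  obtain ⟨s', f', _⟩ := p'
  cases Sm.ext hs
  cases hf
  rfl

/-- Substitution changes the type, the set of functions and the tracking relation, each along a
propositional equality. -/
theorem Trk.heq {Γ : C} {T T' : J.TyP Γ} (hT : T = T') {F F' : Type u} (hF : F = F')
    {P : J.Tm Γ → F → Prop} {P' : J.Tm Γ → F' → Prop} (hP : P ≍ P') {p : Trk T F P}
    {p' : Trk T' F' P'} (hs : p.s.el.1 = p'.s.el.1) (hf : p.f ≍ p'.f) : p ≍ p' := by
  subst hT
  subst hF
  cases hP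
  exact heq_of_eq (Trk.ext' hs (eq_of_heq hf))

theorem Trk.of_heq {Γ : C} {T T' : J.TyP Γ} (hT : T = T') {F F' : Type u} (hF : F = F')
    {P : J.Tm Γ → F → Prop} {P' : J.Tm Γ → F' → Prop} (hP : P ≍ P') {p : Trk T F P}
    {p' : Trk T' F' P'} (h : p ≍ p') : p.s.el.1 = p'.s.el.1 ∧ p.f ≍ p'.f := by
  subst hT
  subst hF
  cases hP
  cases h
  exact ⟨rfl, HEq.rfl⟩

end

section
variable (M : Model K C)

theorem app_congr {Γ : C} {A A' : M.J.TyP Γ} (hA : A = A') {X : M.J.TyN (M.J.ext A)}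
    {X' : M.J.TyN (M.J.ext A')} (hX : X ≍ X') {f : M.J.El (M.U (M.Pi A X))}
    {f' : M.J.El (M.U (M.Pi A' X'))} (hf : f.1 = f'.1) {a : M.J.El A} {a' : M.J.El A'}
    (ha : a.1 = a'.1) :
    M.J.subT (M.J.inst a) (M.app f).1 = M.J.subT (M.J.inst a') (M.app f').1 := by
  subst hA
  cases hX
  cases Subtype.ext hf
  cases Subtype.ext ha
  rfl

/-- Derived from stability of `lam` by β and η. -/
theorem app_sub {Δ Γ : C} (σ : Δ ⟶ Γ) {A : M.J.TyP Γ} {X : M.J.TyN (M.J.ext A)}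
    (f : M.J.El (M.U (M.Pi A X))) :
    M.J.subT (M.J.up σ rfl) (M.app f).1 =
      (M.app ((f.sub σ).cast (by rw [M.U_sub, M.Pi_sub]))).1 := by
  have h : (f.sub σ).cast (by rw [M.U_sub, M.Pi_sub]) =
      M.lam (((M.app f).sub (M.J.up σ rfl)).cast (M.U_sub _ X)) := by
    apply Subtype.ext
    rw [← M.lam_sub, M.lam_app]
    rfl
  rw [h, M.app_lam]
  rfl

theorem Pi_type {Δ Γ : C} (σ : Δ ⟶ Γ) (A : M.J.TyP Γ) (X : M.J.TyN (M.J.ext A)) :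
    M.J.subP σ (M.U (M.Pi A X)) = M.U (M.Pi (M.J.subP σ A) (M.J.subN (M.J.up σ rfl) X)) := by
  rw [M.U_sub, M.Pi_sub]

/-- Application of an instance of a function. -/
def appAt {Δ Γ : C} (σ : Δ ⟶ Γ) {A : M.J.TyP Γ} {X : M.J.TyN (M.J.ext A)}
    (t : M.J.El (M.J.subP σ (M.U (M.Pi A X)))) (a : M.J.El (M.J.subP σ A)) :
    M.J.El (M.U (M.J.subN (M.J.liftEl σ a) X)) :=
  ((M.app (t.cast (Pi_type M σ A X))).sub (M.J.inst a)).cast (by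
    rw [M.U_sub, ← M.J.subN_comp, inst_up_rfl])

theorem appAt_comp {Θ Δ Γ : C} (τ : Θ ⟶ Δ) (σ : Δ ⟶ Γ) {ρ : Θ ⟶ Γ} (hρ : ρ = τ ≫ σ)
    {A : M.J.TyP Γ} {X : M.J.TyN (M.J.ext A)} (t : M.J.El (M.J.subP ρ (M.U (M.Pi A X))))
    (a : M.J.El (M.J.subP ρ A))
    (t' : M.J.El (M.J.subP τ (M.U (M.Pi (M.J.subP σ A) (M.J.subN (M.J.up σ rfl) X)))))
    (a' : M.J.El (M.J.subP τ (M.J.subP σ A))) (ht : t.1 = t'.1) (ha : a.1 = a'.1) :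
    (appAt M ρ t a).1 = (appAt M τ t' a').1 :=
  app_congr M (subP_of_eq M.J τ σ hρ A) (subN_up_up_heq M.J τ σ hρ X) ht ha

theorem appAt_app {Δ Γ : C} (σ : Δ ⟶ Γ) {A : M.J.TyP Γ} {X : M.J.TyN (M.J.ext A)}
    (t : M.J.El (M.J.subP σ (M.U (M.Pi A X)))) (a : M.J.El (M.J.subP σ A))
    (f : M.J.El (M.U (M.Pi A X))) (h : t.1 = M.J.subT σ f.1) :
    (appAt M σ t a).1 = M.J.subT (M.J.liftEl σ a) (M.app f).1 := by
  cases (Subtype.ext h : t = f.sub σ)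
  refine Eq.trans ?_ ((M.J.subT_comp _ _ _).symm.trans
    (congrArg (fun τ => M.J.subT τ (M.app f).1) (inst_up_rfl M.J σ a)))
  exact congrArg (M.J.subT (M.J.inst a)) (app_sub M σ f).symm

/-- By `app_step` the charge passes to the body with `c` weakened, and instantiating at `a` undoes
the weakening. -/
theorem appAt_step {Δ Γ : C} (σ : Δ ⟶ Γ) {A : M.J.TyP Γ} {X : M.J.TyN (M.J.ext A)}
    (c : M.J.El (M.cost Δ)) (t t' : M.J.El (M.J.subP σ (M.U (M.Pi A X)))) (a : M.J.El (M.J.subP σ A))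
    (h : t'.1 = (M.step c (t.cast (Pi_type M σ A X))).1) :
    (appAt M σ t' a).1 = (M.step c (appAt M σ t a)).1 := by
  have h' : t'.cast (Pi_type M σ A X) = M.step c (t.cast (Pi_type M σ A X)) := Subtype.ext h
  unfold appAt
  rw [h', M.app_step]
  refine (M.step_sub (M.J.inst a) _ _).trans ?_
  refine step_congr ?_ ?_ rfl
  · rw [← M.J.subN_comp, inst_up_rfl]
  · refine (M.J.subT_comp _ _ _).symm.trans ?_
    rw [M.J.inst_wk, M.J.subT_id]

end

variable {M : Model K C}

section
variable {Γ : M.J.Glue} (A : Ty Γ) (X : CTy (gext A))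

/-- Semantic functions at a single world. -/
def PF (w : World) (x : Pt Γ w) : Type u :=
  ∀ a : A.Q w x, X.Q w (⟨x, a⟩ : Σ x, A.Q w x)

/-- A term of function type tracks a semantic function. -/
def tracks (w : World) (x : Pt Γ w) (t : M.J.Tm (M.J.worlds.obj w)) (f : PF A X w x) : Prop :=
  -- The typing of `t` is quantified inside, so tracking is a relation on raw terms and can be
  -- compared across equal types.
  ∀ (ht : M.J.ty t = M.J.subP (pt Γ w x) (M.U (M.Pi A.B X.Y))) (a : A.Q w x),
    X.syn w (⟨x, a⟩ : Σ x, A.Q w x) (f a) = (appAt M (pt Γ w x) ⟨t, ht⟩ (A.el a)).1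

/-- Functions at the world `top`, with their restriction to the behavioral phase. -/
def tracksTop (x : Pt Γ World.top) (y : Pt Γ World.beh) (h : rs Γ x = y) (t : M.J.Tm M.J.one)
    (f : PF A X World.top x × PF A X World.beh y) : Prop :=
  -- As in a Kripke function space, an element at `top` carries a function for each world below it,
  -- since members of `A` at `beh` need not be restrictions from `top`.
  tracks A X World.top x t f.1 ∧ tracks A X World.beh y (M.J.subT (wb M.J) t) f.2 ∧
    ∀ a, X.res _ _ (gext_rs A x y h a) (f.1 a) = f.2 (A.res x y h a)

/-- Dependent products at the behavioral world. -/
def PQ0 (y : Pt Γ World.beh) : Type u :=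
  Trk (M.J.subP (pt Γ World.beh y) (M.U (M.Pi A.B X.Y))) (PF A X World.beh y)
    (tracks A X World.beh y)

/-- Dependent products at the top world. -/
def PQ1 (x : Pt Γ World.top) (y : Pt Γ World.beh) (h : rs Γ x = y) : Type u :=
  Trk (M.J.subP (pt Γ World.top x) (M.U (M.Pi A.B X.Y))) (PF A X World.top x × PF A X World.beh y)
    (tracksTop A X x y h)

variable {A X}

/-- Restriction of dependent products. -/
def PQ1.res {x : Pt Γ World.top} (p : PQ1 A X x _ rfl) : PQ0 A X (rs Γ x) :=
  Trk.of ((p.s.el.sub (wb M.J)).cast (subP_of_eq M.J _ _ (pt_rs Γ x) _).symm) p.f.2 p.h.2.1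

theorem PQ1.res_tm {x : Pt Γ World.top} (p : PQ1 A X x _ rfl) :
    p.res.s.el.1 = M.J.subT (wb M.J) p.s.el.1 :=
  congrArg Subtype.val (Sm.el_mk _)

/-- The pointwise action of costs on dependent products. -/
def PQ1.act (k : K) {x : Pt Γ World.top} (p : PQ1 A X x _ rfl) : PQ1 A X x _ rfl :=
  Trk.of ((M.step (M.cst _ k) (p.s.el.cast (Pi_type M _ _ _))).cast (Pi_type M _ _ _).symm)
    -- Only the function at `top` is charged. The one at `beh` is unchanged and still tracked,
    -- because the restricted `step` is the identity.
    (fun a => X.act k _ (p.f.1 a), p.f.2) (by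
    refine ⟨fun ht a => ?_, ?_, fun a => (X.act_res _ _ _ _ _).trans (p.h.2.2 a)⟩
    · refine (X.syn_act _ _ _).trans (Eq.trans ?_
        (appAt_step M _ (M.cst _ k) p.s.el _ _ rfl).symm)
      exact step_congr rfl rfl (p.h.1 p.s.el.2 a)
    · refine (congrArg (fun t => tracks A X _ _ t p.f.2) ?_).mpr p.h.2.1
      exact (M.step_sub _ _ _).trans (congrArg Subtype.val (M.step_beh (beh_world M) _ _)))

theorem PQ1.act_tm (k : K) {x : Pt Γ World.top} (p : PQ1 A X x _ rfl) :
    (p.act k).s.el.1 = (M.step (M.cst _ k) (p.s.el.cast (Pi_type M _ _ _))).1 :=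
  congrArg Subtype.val (Sm.el_mk _)

variable (A X)

/-- The semantic component of dependent products. -/
def gPiFam : Fam Γ where
  Q := wcases (motive := fun w => Pt Γ w → Type u) (fun y => PQ0 A X y) (fun x => PQ1 A X x _ rfl)
  syn := wcases (fun _ p => p.s.el.1) (fun _ p => p.s.el.1)
  res x y h p := cast (congrArg (PQ0 A X) h) (PQ1.res p)
  syn_res x y h p := by
    subst h
    exact PQ1.res_tm p

/-- Dependent products of computation types. -/
def gPi : CTy Γ where
  toFam := gPiFam A X
  Y := M.Pi A.B X.Y
  ty_syn := wcases (fun _ p => p.s.el.2) (fun _ p => p.s.el.2)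
  act k _ p := PQ1.act k p
  act_zero x p := by
    refine Trk.ext' ((PQ1.act_tm _ _).trans ?_) (Prod.ext ?_ rfl)
    · exact congrArg Subtype.val (M.step_zero _)
    · exact funext fun a => X.act_zero _ _
  act_add k l x p := by
    refine Trk.ext' ((PQ1.act_tm _ _).trans (Eq.trans ?_ (PQ1.act_tm _ _).symm)) (Prod.ext ?_ rfl)
    · rw [M.cst_add, M.step_add]
      exact step_congr rfl rfl (PQ1.act_tm _ _).symm
    · exact funext fun a => X.act_add _ _ _ _
  act_res k x y h p := by
    subst h
    refine Trk.ext' ((PQ1.res_tm _).trans (Eq.trans ?_ (PQ1.res_tm _).symm)) rfl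
    refine (congrArg (M.J.subT (wb M.J)) (PQ1.act_tm _ _)).trans ?_
    exact (M.step_sub _ _ _).trans (congrArg Subtype.val (M.step_beh (beh_world M) _ _))
  syn_act k x p := (PQ1.act_tm _ _).trans (step_congr (M.Pi_sub _ _ _).symm rfl rfl)

end

section
variable {Δ Γ : M.J.Glue} (σ : Δ ⟶ Γ) (A : Ty Γ) (X : CTy (gext A))

theorem Pi_type_at (w : World) (x : Pt Δ w) :
    M.J.subP (pt Γ w (mp σ w x)) (M.U (M.Pi A.B X.Y)) =
      M.J.subP (pt Δ w x) (M.U (M.Pi (A.sub σ).B (X.sub ((gJ M).up (A := A) σ rfl)).Y)) :=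
  (subP_of_eq M.J _ _ (pt_mp σ w x) _).trans (congrArg (M.J.subP (pt Δ w x)) (Pi_type M _ _ _))

theorem tracks_sub (w : World) (x : Pt Δ w) :
    tracks A X w (mp σ w x) = tracks (A.sub σ) (X.sub ((gJ M).up (A := A) σ rfl)) w x := by
  funext t f
  apply propext
  have hT := Pi_type_at σ A X w x
  constructor
  · intro h ht a
    exact (h (ht.trans hT.symm) a).trans (appAt_comp M _ _ (pt_mp σ w x) _ _ _ _ rfl rfl)
  · intro h ht a
    exact (h (ht.trans hT) a).trans (appAt_comp M _ _ (pt_mp σ w x) _ _ _ _ rfl rfl).symm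

/-- The restriction of `mp σ _ x` equals the image of `rs Δ x` only by naturality. Keeping `y'`
free, here and in the next two lemmas, allows that equation to be eliminated. -/
theorem tracksTop_sub (x : Pt Δ World.top) (y : Pt Δ World.beh) (h : rs Δ x = y)
    (y' : Pt Γ World.beh) (h' : rs Γ (mp σ _ x) = y') (hy : y' = mp σ _ y) :
    tracksTop A X (mp σ _ x) y' h' ≍
      tracksTop (A.sub σ) (X.sub ((gJ M).up (A := A) σ rfl)) x y h := by
  subst hy
  refine heq_of_eq (funext fun t => funext fun f => ?_)
  exact congrArg₂ And (congrFun (congrFun (tracks_sub σ A X _ x) _) _)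
    (congrArg₂ And (congrFun (congrFun (tracks_sub σ A X _ y) _) _) rfl)

theorem PF_sub (x : Pt Δ World.top) (y : Pt Δ World.beh)
    (y' : Pt Γ World.beh) (hy : y' = mp σ _ y) :
    (PF A X World.top (mp σ _ x) × PF A X World.beh y') =
      (PF (A.sub σ) (X.sub ((gJ M).up (A := A) σ rfl)) World.top x ×
        PF (A.sub σ) (X.sub ((gJ M).up (A := A) σ rfl)) World.beh y) := by
  subst hy
  rfl

theorem PF_act_heq (k : K) (x : Pt Δ World.top) (y : Pt Δ World.beh)
    (y' : Pt Γ World.beh) (hy : y' = mp σ _ y)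
    (f : PF A X World.top (mp σ _ x) × PF A X World.beh y')
    (f' : PF (A.sub σ) (X.sub ((gJ M).up (A := A) σ rfl)) World.top x ×
        PF (A.sub σ) (X.sub ((gJ M).up (A := A) σ rfl)) World.beh y) (h : f ≍ f') :
    ((fun a => X.act k _ (f.1 a), f.2) : PF A X World.top (mp σ _ x) × PF A X World.beh y') ≍
      ((fun a => X.act k _ (f'.1 a), f'.2) :
        PF (A.sub σ) (X.sub ((gJ M).up (A := A) σ rfl)) World.top x ×
        PF (A.sub σ) (X.sub ((gJ M).up (A := A) σ rfl)) World.beh y) ∧ f.2 ≍ f'.2 := by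
  subst hy
  cases eq_of_heq h
  exact ⟨HEq.rfl, HEq.rfl⟩

theorem Trk.congr_type {J : Judgments C} {Γ : C} {T T' : J.TyP Γ} (hT : T = T') {F F' : Type u}
    (hF : F = F') {P : J.Tm Γ → F → Prop} {P' : J.Tm Γ → F' → Prop} (hP : P ≍ P') :
    Trk T F P = Trk T' F' P' := by
  subst hT
  subst hF
  cases hP
  rfl

theorem gPi_sub : (gPi A X).sub σ = gPi (A.sub σ) (X.sub ((gJ M).up (A := A) σ rfl)) := by
  have hT := Pi_type_at σ A X
  have hF := fun x => PF_sub σ A X x (rs Δ x) (rs Γ (mp σ _ x)) (mp_rs σ x).symm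
  have hP := fun x => tracksTop_sub σ A X x (rs Δ x) rfl _ rfl (mp_rs σ x).symm
  -- Heterogeneously equal elements of the two products have the same term and the same functions;
  -- `h0` and `h1` reduce all later comparisons to these components.
  have h0 : ∀ y (p : PQ0 A X (mp σ _ y))
      (p' : PQ0 (A.sub σ) (X.sub ((gJ M).up (A := A) σ rfl)) y), p ≍ p' →
      p.s.el.1 = p'.s.el.1 ∧ p.f ≍ p'.f :=
    fun y _ _ h => Trk.of_heq (hT _ y) rfl (heq_of_eq (tracks_sub σ A X _ y)) h
  have h1 : ∀ x (p : PQ1 A X (mp σ _ x) _ rfl)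
      (p' : PQ1 (A.sub σ) (X.sub ((gJ M).up (A := A) σ rfl)) x _ rfl), p ≍ p' →
      p.s.el.1 = p'.s.el.1 ∧ p.f ≍ p'.f :=
    fun x _ _ h => Trk.of_heq (hT _ x) (hF x) (hP x) h
  refine CTy.ext' (M.Pi_sub _ _ _) (Fam.ext_syn ?_ ?_ ?_) ?_
  · funext w
    match w with
    | 0 => exact funext fun y => Trk.congr_type (hT _ y) rfl (heq_of_eq (tracks_sub σ A X _ y))
    | 1 => exact funext fun x => Trk.congr_type (hT _ x) (hF x) (hP x)
  · exact wcases (fun y p p' h => (h0 y p p' h).1) (fun x p p' h => (h1 x p p' h).1)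
  · intro x y h p p' hp
    subst h
    refine (cast_heq _ _).trans (HEq.trans (b := PQ1.res p') ?_ HEq.rfl)
    have hp' := h1 x p p' hp
    -- Only the second conclusion is used; the cost `0` is a dummy.
    have h2 := (PF_act_heq σ A X 0 x _ _ (mp_rs σ x).symm p.f p'.f hp'.2).2
    refine Trk.heq ?_ ?_ ?_ ?_ h2
    · exact (congrArg (fun y => M.J.subP (pt Γ _ y) _) (mp_rs σ x).symm).trans (hT _ _)
    · exact congrArg (PF A X World.beh) (mp_rs σ x).symm
    · exact (congr_arg_heq (tracks A X World.beh) (mp_rs σ x).symm).trans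
        (heq_of_eq (tracks_sub σ A X _ (rs Δ x)))
    · refine (PQ1.res_tm _).trans (Eq.trans ?_ (PQ1.res_tm _).symm)
      exact congrArg (M.J.subT (wb M.J)) hp'.1
  · intro k x p p' hp
    have hp' := h1 x p p' hp
    refine Trk.heq (hT _ x) (hF x) (hP x) ?_
      (PF_act_heq σ A X k x _ _ (mp_rs σ x).symm p.f p'.f hp'.2).1
    refine (PQ1.act_tm _ _).trans (Eq.trans ?_ (PQ1.act_tm _ _).symm)
    refine step_congr ?_ rfl hp'.1
    refine (M.Pi_sub _ _ _).symm.trans (Eq.trans ?_ (M.Pi_sub _ _ _))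
    refine Eq.trans ?_ (congrArg (M.J.subN (pt Δ _ x)) (M.Pi_sub σ.right A.B X.Y))
    rw [← M.J.subN_comp, ← pt_mp]

end

section
variable {Γ : M.J.Glue} {A : Ty Γ} {X : CTy (gext A)}

theorem tracks_lam (e : GEl (gU X)) (w : World) (x : Pt Γ w) (t : M.J.Tm (M.J.worlds.obj w))
    (h : t = M.J.subT (pt Γ w x) (M.lam (gt e)).1) :
    tracks A X w x t (fun a => gsec e w (⟨x, a⟩ : Σ x, A.Q w x)) := by
  intro ht a
  refine (gsec_syn e w (⟨x, a⟩ : Σ x, A.Q w x)).trans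
    (Eq.trans ?_ (appAt_app M _ ⟨t, ht⟩ (A.el a) _ h).symm)
  exact congrArg (M.J.subT _) (congrArg Subtype.val (M.app_lam (gt e)).symm)

theorem tracksTop_lam (e : GEl (gU X)) (x : Pt Γ World.top) (y : Pt Γ World.beh) (h : rs Γ x = y) :
    tracksTop A X x y h (M.J.subT (pt Γ _ x) (M.lam (gt e)).1)
      (fun a => gsec e World.top (⟨x, a⟩ : Σ x, A.Q World.top x),
        fun a => gsec e World.beh (⟨y, a⟩ : Σ x, A.Q World.beh x)) := by
  refine ⟨tracks_lam e _ x _ rfl, tracks_lam e _ y _ ?_, fun a => gsec_res e _ _ _⟩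
  subst h
  rw [pt_rs, M.J.subT_comp]
  rfl

/-- Abstraction. -/
def glam (e : GEl (gU X)) : GEl (gU (gPi A X)) :=
  mkEl _ (M.lam (gt e))
    (wcases (fun y => Trk.of ((El.sub (J := M.J) (M.lam (gt e)) (pt Γ _ y)))
        (fun a => gsec e World.beh (⟨y, a⟩ : Σ x, A.Q World.beh x)) (tracks_lam e _ y _ rfl))
      (fun x => Trk.of ((El.sub (J := M.J) (M.lam (gt e)) (pt Γ _ x)))
        (fun a => gsec e World.top (⟨x, a⟩ : Σ x, A.Q World.top x),
          fun a => gsec e World.beh (⟨rs Γ x, a⟩ : Σ x, A.Q World.beh x))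
        (tracksTop_lam e x _ rfl)))
    (wcases (fun _ => congrArg Subtype.val (Sm.el_mk _))
      (fun _ => congrArg Subtype.val (Sm.el_mk _)))
    (fun x y h => by
      subst h
      refine Trk.ext' ((PQ1.res_tm _).trans ?_) rfl
      refine (congrArg (M.J.subT (wb M.J)) (congrArg Subtype.val (Sm.el_mk _))).trans
        (Eq.trans ?_ (congrArg Subtype.val (Sm.el_mk _)).symm)
      refine (M.J.subT_comp _ _ _).symm.trans ?_
      exact congrArg (fun τ => M.J.subT τ (M.lam (gt e)).1) (pt_rs Γ x).symm)

/-- The functions underlying a term of a dependent product. -/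
def gfun (f : GEl (gU (gPi A X))) : ∀ (w : World) (x : Pt Γ w), PF A X w x :=
  wcases (fun y => Trk.f (gsec f World.beh y : PQ0 A X y))
    (fun x => (Trk.f (gsec f World.top x : PQ1 A X x _ rfl)).1)

theorem gfun_tracks (f : GEl (gU (gPi A X))) :
    ∀ (w : World) (x : Pt Γ w), tracks A X w x (M.J.subT (pt Γ w x) f.1.t) (gfun f w x) :=
  wcases (fun y => (congrArg (fun t => tracks A X _ y t _) (gsec_syn f World.beh y)).mp
      (Trk.h (gsec f World.beh y : PQ0 A X y)))
    (fun x => (congrArg (fun t => tracks A X _ x t _) (gsec_syn f World.top x)).mp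
      (Trk.h (gsec f World.top x : PQ1 A X x _ rfl)).1)

/-- An element at `top` stores its own function at `beh`. Compatibility of the section with
restriction identifies it with the one read off at `beh`; η depends on this. -/
theorem gfun_beh (f : GEl (gU (gPi A X))) (x : Pt Γ World.top) :
    (Trk.f (gsec f World.top x : PQ1 A X x _ rfl)).2 = gfun f World.beh (rs Γ x) :=
  congrArg (fun p : PQ0 A X (rs Γ x) => p.f) (gsec_res f x _ rfl)

/-- Application to the variable. -/
def gapp (f : GEl (gU (gPi A X))) : GEl (gU X) :=
  mkEl _ (M.app (gt f)) (fun w p => gfun f w p.1 p.2)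
    (fun w p => (gfun_tracks f w p.1 ((gt f).sub (pt Γ w p.1)).2 p.2).trans
      (appAt_app M _ _ (A.el p.2) (gt f) rfl))
    (fun p y h => by
      subst h
      refine ((Trk.h (gsec f World.top p.1 : PQ1 A X p.1 _ rfl)).2.2 p.2).trans ?_
      exact congrFun (gfun_beh f p.1) _)

theorem gapp_glam (e : GEl (gU X)) : gapp (glam e) = e :=
  gel_ext (congrArg Subtype.val (M.app_lam (gt e)))
    (wcases (fun _ => rfl) (fun _ => rfl))

theorem glam_gapp (f : GEl (gU (gPi A X))) : glam (gapp f) = f := by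
  have ht := congrArg Subtype.val (M.lam_app (gt f))
  refine gel_ext ht (wcases (fun y => ?_) (fun x => ?_))
  · refine Trk.ext' ((congrArg Subtype.val (Sm.el_mk _)).trans ?_) rfl
    exact (congrArg (M.J.subT (pt Γ _ y)) ht).trans (gsec_syn f World.beh y).symm
  · refine Trk.ext' ((congrArg Subtype.val (Sm.el_mk _)).trans ?_)
      (Prod.ext rfl (gfun_beh f x).symm)
    exact (congrArg (M.J.subT (pt Γ _ x)) ht).trans (gsec_syn f World.top x).symm

theorem gapp_step (c : GEl (gcost Γ)) (f : GEl (gU (gPi A X))) :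
    gapp (gstep c f) =
      gstep ((El.sub (J := gJ M) c (gwk A)).cast (gcost_sub _)) (gapp f) :=
  gel_ext (congrArg Subtype.val (M.app_step (gt c) (gt f)))
    (wcases (fun _ => rfl) (fun _ => rfl))

theorem glam_heq {Δ : M.J.Glue} (σ : Δ ⟶ Γ) (e : GEl (gU X)) (x : Pt Δ World.top)
    (y : Pt Δ World.beh) (y' : Pt Γ World.beh) (hy : y' = mp σ _ y) :
    ((fun a => gsec e World.top (⟨mp σ _ x, a⟩ : Σ x, A.Q World.top x),
      fun a => gsec e World.beh (⟨y', a⟩ : Σ x, A.Q World.beh x)) :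
        PF A X World.top (mp σ _ x) × PF A X World.beh y') ≍
    ((fun a => gsec e World.top (⟨mp σ _ x, a⟩ : Σ x, A.Q World.top x),
      fun a => gsec e World.beh (⟨mp σ _ y, a⟩ : Σ x, A.Q World.beh x)) :
        PF (A.sub σ) (X.sub ((gJ M).up (A := A) σ rfl)) World.top x ×
        PF (A.sub σ) (X.sub ((gJ M).up (A := A) σ rfl)) World.beh y) := by
  subst hy
  rfl

theorem glam_sub {Δ : M.J.Glue} (σ : Δ ⟶ Γ) (e : GEl (gU X))
    (h : (gU X).sub ((gJ M).up (A := A) σ rfl) = gU (X.sub ((gJ M).up (A := A) σ rfl))) :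
    (El.sub (J := gJ M) (glam e) σ).1 =
      (glam (A := A.sub σ) (X := X.sub ((gJ M).up (A := A) σ rfl))
        ((El.sub (J := gJ M) e ((gJ M).up (A := A) σ rfl)).cast h)).1 := by
  have ht := M.lam_sub σ.right (gt e)
  have hm : ∀ w (x : Pt Δ w), M.J.subT (pt Γ w (mp σ w x)) (M.lam (gt e)).1 =
      M.J.subT (pt Δ w x) (M.J.subT σ.right (M.lam (gt e)).1) := fun w x => by
    rw [← M.J.subT_comp, ← pt_mp]
  refine gtm_ext ((gU_sub _ _).trans (congrArg gU (gPi_sub _ _ _))) _ _ ht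
    (wcases (fun y => ?_) (fun x => ?_))
  · refine Trk.heq (Pi_type_at σ A X _ y) rfl (heq_of_eq (tracks_sub σ A X _ y)) ?_ HEq.rfl
    refine (congrArg Subtype.val (Sm.el_mk _)).trans
      (Eq.trans ?_ (congrArg Subtype.val (Sm.el_mk _)).symm)
    exact (hm _ y).trans (congrArg _ ht)
  · refine Trk.heq (Pi_type_at σ A X _ x) (PF_sub σ A X x (rs Δ x) _ (mp_rs σ x).symm)
      (tracksTop_sub σ A X x (rs Δ x) rfl _ rfl (mp_rs σ x).symm) ?_
      (glam_heq σ e x (rs Δ x) _ (mp_rs σ x).symm)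
    refine (congrArg Subtype.val (Sm.el_mk _)).trans
      (Eq.trans ?_ (congrArg Subtype.val (Sm.el_mk _)).symm)
    exact (hm _ x).trans (congrArg _ ht)

end

end

/-! ### Assembly of the gluing model -/

section

variable {C : Type (u + 1)} [Category.{u} C] {K : Type u} [AddMonoid K]

/-- The gluing model. -/
def gModel (M : Model K C) : Model K M.J.Glue where
  J := gJ M
  U X := gU X
  U_sub σ X := gU_sub σ X
  F A := gF A
  F_sub σ A := gF_sub σ A
  ret a := gret a
  ret_sub σ _ a := gret_sub σ a
  bind e f := gbind e f
  bind_sub σ _ _ e f := gbind_sub σ e f _ _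
  bind_ret a f := gbind_ret a f
  bind_eta e := gbind_eta e _
  bind_assoc e f g := gbind_assoc e f g _ _ _
  cost Γ := gcost Γ
  cost_sub σ := gcost_sub σ
  cst Γ k := gcst Γ k
  cst_sub σ _ := gtm_ext (gcost_sub σ) _ _ (M.cst_sub _ _) fun _ _ => HEq.rfl
  add c d := gadd c d
  add_sub σ _ _ := gtm_ext (gcost_sub σ) _ _ (M.add_sub _ _ _) fun _ _ => HEq.rfl
  zero_add c := gel_ext (congrArg Subtype.val (M.zero_add (gt c)))
    fun w x => zero_add (M := K) (gsec c w x)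
  add_zero c := gel_ext (congrArg Subtype.val (M.add_zero (gt c)))
    fun w x => add_zero (M := K) (gsec c w x)
  add_assoc c d e := gel_ext (congrArg Subtype.val (M.add_assoc (gt c) (gt d) (gt e)))
    fun w x => add_assoc (G := K) (gsec c w x) (gsec d w x) (gsec e w x)
  cst_add Γ k l := gel_ext (congrArg Subtype.val (M.cst_add Γ.right k l)) fun _ _ => rfl
  step c e := gstep c e
  step_sub σ _ c e := gstep_sub σ c e
  step_zero e := gstep_zero e
  step_add c d e := gstep_add c d e
  step_beh h _ c e := gstep_beh h c e
  bind_step c e f := gbind_step c e f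
  Pi A X := gPi A X
  Pi_sub σ A X := gPi_sub σ A X
  lam e := glam e
  lam_sub σ _ _ e := glam_sub σ e _
  app f := gapp f
  app_lam e := gapp_glam e
  lam_app f := glam_gapp f
  app_step c f := gapp_step c f
  Sig A B := gSig A B
  Sig_sub σ A B := gSig_sub σ A B
  pair a b := gpair a b
  pair_sub σ _ _ a b := gpair_sub σ a b _
  fst p := gfst p
  snd p := gsnd p
  fst_pair a b := gfst_gpair a b
  snd_pair a b := gsnd_gpair a b
  pair_eta p := gpair_eta p
  EqTy a b := gEqTy a b
  EqTy_sub σ _ a b := gEqTy_sub σ a b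
  eqRefl a := geqRefl a
  eqReflect p := geqReflect p
  eqUnique p q := geqUnique p q
  bool Γ := gbool Γ
  bool_sub σ := gbool_sub σ
  boolLit Γ x := gboolLit Γ x
  boolLit_sub σ _ := gtm_ext (gbool_sub σ) _ _ (M.boolLit_sub _ _) fun _ _ => HEq.rfl
  boolRec D b t f := gboolRec D b t f
  boolRec_sub σ D b t f := gboolRec_sub σ D b t f _ _
  boolRec_true D t f := gboolRec_true D t f
  boolRec_false D t f := gboolRec_false D t f
  Op A := gOp A
  Op_sub σ A := gOp_sub σ A
  opLam a := gopLam a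
  opLam_sub σ _ a := gopLam_sub σ a
  opApp p := gopApp p
  opApp_opLam a := gopApp_gopLam a
  opLam_opApp p := gopLam_gopApp p
  Cl A := gCl A
  Cl_sub σ A := gCl_sub σ A
  clEta a := gclEta a
  clEta_sub σ _ a := gclEta_sub σ a
  star A h := gstar A h
  star_sub σ A h := gstar_sub σ A h _
  clEta_beh a h := gclEta_beh a h
  clRec D f g coh e := gclRec D f g coh e
  clRec_eta D f g coh a := gclRec_eta D f g coh a
  clRec_star D f g coh h := gclRec_star D f g coh h
  clRec_sub σ _ D f g coh e f' hf g' hg coh' := gclRec_sub D f g coh σ e f' hf g' hg coh'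

end

/-! ### Morphisms of models: identity, projection, composition with the projection -/

section

variable {C D : Type (u + 1)} [Category.{u} C] [Category.{u} D] {K : Type u} [AddMonoid K]

section
variable (M : Model K C)

theorem bind_congr {Γ : C} {A : M.J.TyP Γ} {X : M.J.TyN Γ} {e e' : M.J.El (M.U (M.F A))}
    (he : e.1 = e'.1) {f f' : M.J.El (M.J.subP (M.J.wk A) (M.U X))} (hf : f.1 = f'.1) :
    (M.bind e f).1 = (M.bind e' f').1 := by
  cases Subtype.ext he
  cases Subtype.ext hf
  rfl

theorem lam_congr {Γ : C} {A : M.J.TyP Γ} {X X' : M.J.TyN (M.J.ext A)} (hX : X = X')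
    {e : M.J.El (M.U X)} {e' : M.J.El (M.U X')} (he : e.1 = e'.1) :
    (M.lam e).1 = (M.lam e').1 := by
  subst hX
  cases Subtype.ext he
  rfl

theorem app_term_congr {Γ : C} {A : M.J.TyP Γ} {X X' : M.J.TyN (M.J.ext A)} (hX : X = X')
    {f : M.J.El (M.U (M.Pi A X))} {f' : M.J.El (M.U (M.Pi A X'))} (hf : f.1 = f'.1) :
    (M.app f).1 = (M.app f').1 := by
  subst hX
  cases Subtype.ext hf
  rfl

theorem fst_congr {Γ : C} {A : M.J.TyP Γ} {B B' : M.J.TyP (M.J.ext A)} (hB : B = B')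
    {p : M.J.El (M.Sig A B)} {p' : M.J.El (M.Sig A B')} (hp : p.1 = p'.1) :
    (M.fst p).1 = (M.fst p').1 := by
  subst hB
  cases Subtype.ext hp
  rfl

theorem snd_congr {Γ : C} {A : M.J.TyP Γ} {B B' : M.J.TyP (M.J.ext A)} (hB : B = B')
    {p : M.J.El (M.Sig A B)} {p' : M.J.El (M.Sig A B')} (hp : p.1 = p'.1) :
    (M.snd p).1 = (M.snd p').1 := by
  subst hB
  cases Subtype.ext hp
  rfl

theorem boolRec_congr {Γ : C} {E E' : M.J.TyP (M.J.ext (M.bool Γ))} (hE : E = E')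
    {b b' : M.J.El (M.bool Γ)} (hb : b.1 = b'.1)
    {t : M.J.El (M.J.subP (M.J.inst (M.boolLit Γ true)) E)}
    {t' : M.J.El (M.J.subP (M.J.inst (M.boolLit Γ true)) E')} (ht : t.1 = t'.1)
    {f : M.J.El (M.J.subP (M.J.inst (M.boolLit Γ false)) E)}
    {f' : M.J.El (M.J.subP (M.J.inst (M.boolLit Γ false)) E')} (hf : f.1 = f'.1) :
    (M.boolRec E b t f).1 = (M.boolRec E' b' t' f').1 := by
  subst hE
  cases Subtype.ext hb
  cases Subtype.ext ht
  cases Subtype.ext hf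
  rfl

theorem opApp_congr {Γ : C} {A A' : M.J.TyP (M.J.extBeh Γ)} (h : A = A') {p : M.J.El (M.Op A)}
    {p' : M.J.El (M.Op A')} (hp : p.1 = p'.1) : (M.opApp p).1 = (M.opApp p').1 := by
  subst h
  cases Subtype.ext hp
  rfl

theorem clRec_congr {Γ : C} {A : M.J.TyP Γ} {E E' : M.J.TyP (M.J.ext (M.Cl A))} (hE : E = E')
    {f : M.J.El (M.J.subP
      (M.J.liftEl (M.J.wk A) ((M.clEta (M.J.v A)).cast (M.Cl_sub _ A).symm)) E)}
    {f' : M.J.El (M.J.subP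
      (M.J.liftEl (M.J.wk A) ((M.clEta (M.J.v A)).cast (M.Cl_sub _ A).symm)) E')}
    (hf : f.1 = f'.1)
    {g : M.J.El (M.J.subP
      (M.J.liftEl (M.J.wkBeh Γ) ((M.star _ (M.J.beh_extBeh Γ)).cast (M.Cl_sub _ A).symm)) E)}
    {g' : M.J.El (M.J.subP
      (M.J.liftEl (M.J.wkBeh Γ) ((M.star _ (M.J.beh_extBeh Γ)).cast (M.Cl_sub _ A).symm)) E')}
    (hg : g.1 = g'.1)
    (coh : M.J.subT (M.J.wkBeh (M.J.ext A)) f.1 = M.J.subT (M.J.upBeh (M.J.wk A)) g.1)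
    (coh' : M.J.subT (M.J.wkBeh (M.J.ext A)) f'.1 = M.J.subT (M.J.upBeh (M.J.wk A)) g'.1)
    {e e' : M.J.El (M.Cl A)} (he : e.1 = e'.1) :
    (M.clRec E f g coh e).1 = (M.clRec E' f' g' coh' e').1 := by
  subst hE
  cases Subtype.ext hf
  cases Subtype.ext hg
  cases Subtype.ext he
  rfl

end

section
variable {M : Model K C} {N : Model K D} {Φ : C ⥤ D}

/-- The image of a context extension is a context extension up to `eqToHom`, so it inherits the
uniqueness half of the universal property. -/
theorem map_ext_hom_ext (H : JudgmentHom M.J N.J Φ) {Δ : D} {Γ : C} {A : M.J.TyP Γ}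
    {τ τ' : Δ ⟶ Φ.obj (M.J.ext A)}
    (h : τ ≫ Φ.map (M.J.wk A) = τ' ≫ Φ.map (M.J.wk A))
    (h' : N.J.subT τ (H.tm (M.J.var A)) = N.J.subT τ' (H.tm (M.J.var A))) : τ = τ' := by
  rw [H.map_wk, ← Category.assoc, ← Category.assoc] at h
  rw [H.tm_var, ← N.J.subT_comp, ← N.J.subT_comp] at h'
  have e := N.J.ext_hom_ext _ _ _ h h'
  exact (cancel_mono _).1 e

theorem map_extBeh_hom_ext (H : JudgmentHom M.J N.J Φ) {Δ : D} {Γ : C}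
    {τ τ' : Δ ⟶ Φ.obj (M.J.extBeh Γ)}
    (h : τ ≫ Φ.map (M.J.wkBeh Γ) = τ' ≫ Φ.map (M.J.wkBeh Γ)) : τ = τ' := by
  rw [H.map_wkBeh, ← Category.assoc, ← Category.assoc] at h
  exact (cancel_mono _).1 (N.J.extBeh_hom_ext _ _ h)

theorem cmpBeh_map_wkBeh (H : JudgmentHom M.J N.J Φ) (Γ : C) :
    H.cmpBeh Γ ≫ Φ.map (M.J.wkBeh Γ) = N.J.wkBeh (Φ.obj Γ) := by
  rw [H.map_wkBeh]
  simp [JudgmentHom.cmpBeh]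

variable (ι : Hom M N Φ) {Γ : C} (A : M.J.TyP Γ)

/-- Needed, with `map_star_case`, to type the images of the two cases of `clRec`. -/
theorem map_clEta_case :
    N.J.liftEl (N.J.wk (ι.H.tyP A)) ((N.clEta (N.J.v (ι.H.tyP A))).cast (N.Cl_sub _ _).symm) ≫
        ι.H.cmp _ (ι.map_Cl A) =
      ι.H.cmp A rfl ≫
        Φ.map (M.J.liftEl (M.J.wk A) ((M.clEta (M.J.v A)).cast (M.Cl_sub _ A).symm)) := by
  apply map_ext_hom_ext ι.H
  · rw [Category.assoc, Category.assoc, ι.H.cmp_map_wk, ← Φ.map_comp]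
    exact (N.J.lift_wk _ _ _ _).trans
      ((congrArg (fun f => ι.H.cmp A rfl ≫ Φ.map f) (M.J.lift_wk _ _ _ _)).trans
        (ι.H.cmp_map_wk A rfl)).symm
  · rw [N.J.subT_comp, N.J.subT_comp, ι.H.cmp_var, ← ι.H.tm_sub]
    refine (N.J.lift_var _ _ _ _).trans (Eq.trans ?_
      (congrArg (fun a => N.J.subT (ι.H.cmp A rfl) (ι.H.tm a)) (M.J.lift_var _ _ _ _)).symm)
    refine Eq.trans ?_ (congrArg (N.J.subT (ι.H.cmp A rfl)) (ι.map_clEta (M.J.v A))).symm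
    refine Eq.trans ?_ (N.clEta_sub _ _).symm
    exact clEta_congr N (ι.H.cmp_wk A rfl A).symm (ι.H.cmp_var A rfl).symm

theorem map_star_case :
    N.J.liftEl (N.J.wkBeh (Φ.obj Γ))
        ((N.star _ (N.J.beh_extBeh (Φ.obj Γ))).cast (N.Cl_sub _ (ι.H.tyP A)).symm) ≫
        ι.H.cmp _ (ι.map_Cl A) =
      ι.H.cmpBeh Γ ≫
        Φ.map (M.J.liftEl (M.J.wkBeh Γ)
          ((M.star _ (M.J.beh_extBeh Γ)).cast (M.Cl_sub _ A).symm)) := by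
  apply map_ext_hom_ext ι.H
  · rw [Category.assoc, Category.assoc, ι.H.cmp_map_wk, ← Φ.map_comp]
    exact (N.J.lift_wk _ _ _ _).trans
      ((congrArg (fun f => ι.H.cmpBeh Γ ≫ Φ.map f) (M.J.lift_wk _ _ _ _)).trans
        (cmpBeh_map_wkBeh ι.H Γ)).symm
  · rw [N.J.subT_comp, N.J.subT_comp, ι.H.cmp_var, ← ι.H.tm_sub]
    refine (N.J.lift_var _ _ _ _).trans (Eq.trans ?_
      (congrArg (fun a => N.J.subT (ι.H.cmpBeh Γ) (ι.H.tm a)) (M.J.lift_var _ _ _ _)).symm)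
    refine Eq.trans ?_ (congrArg (N.J.subT (ι.H.cmpBeh Γ)) (ι.map_star _ _)).symm
    refine Eq.trans ?_ (N.star_sub _ _ _).symm
    refine star_congr N ?_ _ _
    rw [ι.H.tyP_sub, ← N.J.subP_comp, cmpBeh_map_wkBeh]

/-- Constructs the translated cases that `map_clRec` expects as arguments, so that preservation of
`clRec` can be used. -/
theorem map_clRec_cases (E : M.J.TyP (M.J.ext (M.Cl A)))
    (f : M.J.El (M.J.subP
      (M.J.liftEl (M.J.wk A) ((M.clEta (M.J.v A)).cast (M.Cl_sub _ A).symm)) E))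
    (g : M.J.El (M.J.subP
      (M.J.liftEl (M.J.wkBeh Γ) ((M.star _ (M.J.beh_extBeh Γ)).cast (M.Cl_sub _ A).symm)) E))
    (coh : M.J.subT (M.J.wkBeh (M.J.ext A)) f.1 = M.J.subT (M.J.upBeh (M.J.wk A)) g.1)
    (e : M.J.El (M.Cl A)) :
    ∃ f' g' coh', f'.1 = N.J.subT (ι.H.cmp A rfl) (ι.H.tm f.1) ∧
      g'.1 = N.J.subT (ι.H.cmpBeh Γ) (ι.H.tm g.1) ∧
      ι.H.tm (M.clRec E f g coh e).1 =
        (N.clRec (A := ι.H.tyP A) (N.J.subP (ι.H.cmp _ (ι.map_Cl A)) (ι.H.tyP E)) f' g' coh'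
          ((ι.H.el e).cast (ι.map_Cl A))).1 := by
  refine ⟨⟨_, ?_⟩, ⟨_, ?_⟩, ?_, rfl, rfl, ι.map_clRec E f g coh e _ rfl _ rfl ?_⟩
  · rw [N.J.ty_sub, ι.H.ty_tm, f.2, ι.H.tyP_sub, ← N.J.subP_comp, ← N.J.subP_comp, map_clEta_case]
  · rw [N.J.ty_sub, ι.H.ty_tm, g.2, ι.H.tyP_sub, ← N.J.subP_comp, ← N.J.subP_comp, map_star_case]
  all_goals
    -- Both sides of the coherence factor through one comparison map into the image of `Γ, x : A, z
    -- : beh`, where the image of `coh` applies.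
    have h1 : N.J.wkBeh _ ≫ ι.H.cmp A rfl =
        (N.J.upBeh (ι.H.cmp A rfl) ≫ ι.H.cmpBeh _) ≫ Φ.map (M.J.wkBeh (M.J.ext A)) := by
      rw [Category.assoc, cmpBeh_map_wkBeh]
      exact (N.J.liftBeh_wk _ _).symm
    have h2 : N.J.upBeh (N.J.wk (ι.H.tyP A)) ≫ ι.H.cmpBeh Γ =
        (N.J.upBeh (ι.H.cmp A rfl) ≫ ι.H.cmpBeh _) ≫ Φ.map (M.J.upBeh (M.J.wk A)) := by
      apply map_extBeh_hom_ext ι.H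
      have h3 : M.J.upBeh (M.J.wk A) ≫ M.J.wkBeh Γ = M.J.wkBeh _ ≫ M.J.wk A := M.J.liftBeh_wk _ _
      rw [Category.assoc, Category.assoc, cmpBeh_map_wkBeh, ← Φ.map_comp, h3, Φ.map_comp,
        ← Category.assoc, ← h1, Category.assoc, ι.H.cmp_map_wk]
      exact N.J.liftBeh_wk _ _
    rw [← N.J.subT_comp, ← N.J.subT_comp, h1, h2, N.J.subT_comp, N.J.subT_comp _ _ (ι.H.tm g.1),
      ← ι.H.tm_sub, ← ι.H.tm_sub, coh]

end

section
variable (M : Model K C)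

/-- The identity morphism, on judgments. -/
def idJ : JudgmentHom M.J M.J (𝟭 C) where
  tyP A := A
  tyN X := X
  tm a := a
  ty_tm _ := rfl
  tyP_sub _ _ := rfl
  tyN_sub _ _ := rfl
  tm_sub _ _ := rfl
  one_obj := rfl
  ext_obj _ := rfl
  map_wk _ := (Category.id_comp _).symm
  tm_var _ := (M.J.subT_id _).symm
  beh h := h
  extBeh_obj _ := rfl
  map_wkBeh _ := (Category.id_comp _).symm

/-- The identity morphism of a model. -/
def idHom : Hom M M (𝟭 C) where
  H := idJ M
  map_U _ := rfl
  map_F _ := rfl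
  map_ret _ := rfl
  map_bind _ _ := bind_congr M rfl (M.J.subT_id _).symm
  map_cost _ := rfl
  map_cst _ _ := rfl
  map_add _ _ := rfl
  map_step _ _ := rfl
  map_Pi A X := congrArg (M.Pi A) (M.J.subN_id X).symm
  map_lam _ := lam_congr M (M.J.subN_id _).symm (M.J.subT_id _).symm
  map_app _ := (M.J.subT_id _).trans (app_term_congr M (M.J.subN_id _).symm rfl)
  map_Sig A B := congrArg (M.Sig A) (M.J.subP_id B).symm
  map_pair _ _ := pair_congr M rfl (heq_of_eq (M.J.subP_id _).symm) rfl rfl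
  map_fst _ := fst_congr M (M.J.subP_id _).symm rfl
  map_snd _ := snd_congr M (M.J.subP_id _).symm rfl
  map_EqTy _ _ := rfl
  map_eqRefl _ := rfl
  map_bool _ := rfl
  map_boolLit _ _ := rfl
  map_boolRec _ _ _ _ := boolRec_congr M (M.J.subP_id _).symm rfl rfl rfl
  map_Op _ := congrArg M.Op (M.J.subP_id _).symm
  map_opLam _ := opLam_congr M (M.J.subP_id _).symm (M.J.subT_id _).symm
  map_opApp _ := (M.J.subT_id _).trans (opApp_congr M (M.J.subP_id _).symm rfl)
  map_Cl _ := rfl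
  map_clEta _ := rfl
  map_star _ _ := rfl
  map_clRec _ _ _ _ _ _ hf _ hg _ := clRec_congr M (M.J.subP_id _).symm
    (hf.trans (M.J.subT_id _)).symm (hg.trans (M.J.subT_id _)).symm _ _ rfl

/-- The projection of the gluing model. -/
def gProj : Hom (gModel M) M M.J.proj where
  H := gπ M
  map_U _ := rfl
  map_F _ := rfl
  map_ret _ := rfl
  map_bind _ _ := bind_congr M rfl (M.J.subT_id _).symm
  map_cost _ := rfl
  map_cst _ _ := rfl
  map_add _ _ := rfl
  map_step _ _ := rfl
  map_Pi A X := congrArg (M.Pi A.B) (M.J.subN_id X.Y).symm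
  map_lam _ := lam_congr M (M.J.subN_id _).symm (M.J.subT_id _).symm
  map_app _ := (M.J.subT_id _).trans (app_term_congr M (M.J.subN_id _).symm rfl)
  map_Sig A B := congrArg (M.Sig A.B) (M.J.subP_id B.B).symm
  map_pair _ _ := pair_congr M rfl (heq_of_eq (M.J.subP_id _).symm) rfl rfl
  map_fst _ := fst_congr M (M.J.subP_id _).symm rfl
  map_snd _ := snd_congr M (M.J.subP_id _).symm rfl
  map_EqTy _ _ := rfl
  map_eqRefl _ := rfl
  map_bool _ := rfl
  map_boolLit _ _ := rfl
  map_boolRec _ _ _ _ := boolRec_congr M (M.J.subP_id _).symm rfl rfl rfl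
  map_Op _ := congrArg M.Op (M.J.subP_id _).symm
  map_opLam _ := opLam_congr M (M.J.subP_id _).symm (M.J.subT_id _).symm
  map_opApp _ := (M.J.subT_id _).trans (opApp_congr M (M.J.subP_id _).symm rfl)
  map_Cl _ := rfl
  map_clEta _ := rfl
  map_star _ _ := rfl
  map_clRec _ _ _ _ _ _ hf _ hg _ := clRec_congr M (M.J.subP_id _).symm
    (hf.trans (M.J.subT_id _)).symm (hg.trans (M.J.subT_id _)).symm _ _ rfl

end

section
variable {M : Model K C} {L : Model K D} {Φ : D ⥤ M.J.Glue} (ι : Hom L (gModel M) Φ)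

/-- The composite of a morphism into the gluing model with the projection, on judgments. -/
def compJ : JudgmentHom L.J M.J (Φ ⋙ M.J.proj) where
  tyP A := (ι.H.tyP A).B
  tyN X := (ι.H.tyN X).Y
  tm a := (ι.H.tm a).t
  ty_tm a := ((gπ M).ty_tm (ι.H.tm a)).trans (congrArg Ty.B (ι.H.ty_tm a))
  tyP_sub σ A := congrArg Ty.B (ι.H.tyP_sub σ A)
  tyN_sub σ X := congrArg CTy.Y (ι.H.tyN_sub σ X)
  tm_sub σ a := congrArg GTm.t (ι.H.tm_sub σ a)
  one_obj := congrArg Comma.right ι.H.one_obj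
  ext_obj A := congrArg Comma.right (ι.H.ext_obj A)
  map_wk A := (congrArg CommaMorphism.right (ι.H.map_wk A)).trans
    (congrArg (· ≫ M.J.wk (ι.H.tyP A).B) (Comma.eqToHom_right _ _ _ _ _))
  tm_var A := (congrArg GTm.t (ι.H.tm_var A)).trans
    (congrArg (fun f => M.J.subT f (M.J.var (ι.H.tyP A).B)) (Comma.eqToHom_right _ _ _ _ _))
  beh h := (ι.H.beh h).1
  extBeh_obj Γ := congrArg Comma.right (ι.H.extBeh_obj Γ)
  map_wkBeh Γ := (congrArg CommaMorphism.right (ι.H.map_wkBeh Γ)).trans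
    (congrArg (· ≫ M.J.wkBeh _) (Comma.eqToHom_right _ _ _ _ _))

/-- The syntactic component of an `eqToHom` is an `eqToHom`, so the comparison maps of `ι` project
to those of the composite. -/
theorem cmp_right {Γ : D} (A : L.J.TyP Γ) {A' : Ty (Φ.obj Γ)} (h : ι.H.tyP A = A') :
    (ι.H.cmp A h).right = (compJ ι).cmp A (congrArg Ty.B h) :=
  Comma.eqToHom_right _ _ _ _ _

theorem cmpBeh_right (Γ : D) : (ι.H.cmpBeh Γ).right = (compJ ι).cmpBeh Γ :=
  Comma.eqToHom_right _ _ _ _ _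

/-- The composite of a morphism into the gluing model with the projection. -/
def compHom : Hom L M (Φ ⋙ M.J.proj) where
  H := compJ ι
  map_U X := congrArg Ty.B (ι.map_U X)
  map_F A := congrArg CTy.Y (ι.map_F A)
  map_ret a := congrArg GTm.t (ι.map_ret a)
  map_bind e f := (congrArg GTm.t (ι.map_bind e f)).trans
    (bind_congr M rfl (congrArg (fun τ => M.J.subT τ (ι.H.tm f.1).t) (cmp_right ι _ rfl)))
  map_cost Γ := congrArg Ty.B (ι.map_cost Γ)
  map_cst Γ k := congrArg GTm.t (ι.map_cst Γ k)
  map_add c d := congrArg GTm.t (ι.map_add c d)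
  map_step c e := congrArg GTm.t (ι.map_step c e)
  map_Pi A X := (congrArg CTy.Y (ι.map_Pi A X)).trans (congrArg (M.Pi _)
    (congrArg (fun τ => M.J.subN τ (ι.H.tyN X).Y) (cmp_right ι A rfl)))
  map_lam {_ A X} e := (congrArg GTm.t (ι.map_lam e)).trans (lam_congr M
    (congrArg (fun τ => M.J.subN τ (ι.H.tyN X).Y) (cmp_right ι A rfl))
    (congrArg (fun τ => M.J.subT τ (ι.H.tm e.1).t) (cmp_right ι A rfl)))
  map_app {_ A X} f :=
    (congrArg (fun τ => M.J.subT τ (ι.H.tm (L.app f).1).t) (cmp_right ι A rfl)).symm.trans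
      ((congrArg GTm.t (ι.map_app f)).trans (app_term_congr M
        (congrArg (fun τ => M.J.subN τ (ι.H.tyN X).Y) (cmp_right ι A rfl)) rfl))
  map_Sig A B := (congrArg Ty.B (ι.map_Sig A B)).trans (congrArg (M.Sig _)
    (congrArg (fun τ => M.J.subP τ (ι.H.tyP B).B) (cmp_right ι A rfl)))
  map_pair {_ A B} a b := (congrArg GTm.t (ι.map_pair a b)).trans (pair_congr M rfl (heq_of_eq
    (congrArg (fun τ => M.J.subP τ (ι.H.tyP B).B) (cmp_right ι A rfl))) rfl rfl)
  map_fst {_ A B} p := (congrArg GTm.t (ι.map_fst p)).trans (fst_congr M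
    (congrArg (fun τ => M.J.subP τ (ι.H.tyP B).B) (cmp_right ι A rfl)) rfl)
  map_snd {_ A B} p := (congrArg GTm.t (ι.map_snd p)).trans (snd_congr M
    (congrArg (fun τ => M.J.subP τ (ι.H.tyP B).B) (cmp_right ι A rfl)) rfl)
  map_EqTy a b := congrArg Ty.B (ι.map_EqTy a b)
  map_eqRefl a := congrArg GTm.t (ι.map_eqRefl a)
  map_bool Γ := congrArg Ty.B (ι.map_bool Γ)
  map_boolLit Γ x := congrArg GTm.t (ι.map_boolLit Γ x)
  map_boolRec {Γ} E b t f := (congrArg GTm.t (ι.map_boolRec E b t f)).trans (boolRec_congr M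
    (congrArg (fun τ => M.J.subP τ (ι.H.tyP E).B) (cmp_right ι _ (ι.map_bool Γ))) rfl rfl rfl)
  map_Op {Γ} A := (congrArg Ty.B (ι.map_Op A)).trans (congrArg M.Op
    (congrArg (fun τ => M.J.subP τ (ι.H.tyP A).B) (cmpBeh_right ι Γ)))
  map_opLam {Γ A} a := (congrArg GTm.t (ι.map_opLam a)).trans (opLam_congr M
    (congrArg (fun τ => M.J.subP τ (ι.H.tyP A).B) (cmpBeh_right ι Γ))
    (congrArg (fun τ => M.J.subT τ (ι.H.tm a.1).t) (cmpBeh_right ι Γ)))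
  map_opApp {Γ A} p :=
    (congrArg (fun τ => M.J.subT τ (ι.H.tm (L.opApp p).1).t) (cmpBeh_right ι Γ)).symm.trans
      ((congrArg GTm.t (ι.map_opApp p)).trans (opApp_congr M
        (congrArg (fun τ => M.J.subP τ (ι.H.tyP A).B) (cmpBeh_right ι Γ)) rfl))
  map_Cl A := congrArg Ty.B (ι.map_Cl A)
  map_clEta a := congrArg GTm.t (ι.map_clEta a)
  map_star A h := congrArg GTm.t (ι.map_star A h)
  map_clRec {Γ A} E f g coh e f' hf g' hg coh' := by
    obtain ⟨f₁, g₁, coh₁, hf₁, hg₁, h⟩ := map_clRec_cases ι A E f g coh e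
    refine (congrArg GTm.t h).trans (clRec_congr M
      (congrArg (fun τ => M.J.subP τ (ι.H.tyP E).B) (cmp_right ι _ (ι.map_Cl A)))
      (f := gt f₁) (g := gt g₁) ?_ ?_ (congrArg GTm.t coh₁) coh' rfl)
    · exact (congrArg GTm.t hf₁).trans
        ((congrArg (fun τ => M.J.subT τ (ι.H.tm f.1).t) (cmp_right ι A rfl)).trans hf.symm)
    · exact (congrArg GTm.t hg₁).trans
        ((congrArg (fun τ => M.J.subT τ (ι.H.tm g.1).t) (cmpBeh_right ι Γ)).trans hg.symm)

end

end

/-! ### Kripke predicates as types of the gluing model -/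

section

variable {C : Type (u + 1)} [Category.{u} C] {K : Type u} [AddMonoid K]

section
variable {J : Judgments C} {Γ : J.Glue} {B : J.TyP Γ.right} (P : Predicate Γ B)

/-- The family of fibres of a Kripke predicate. -/
def fibFam : Fam Γ where
  Q w x := {q : P.carrier.obj (op w) // P.base.app (op w) q = x}
  syn w _ q := (P.syn w q.1).1
  res _ y h q := ⟨P.carrier.map down.op q.1, by
    subst h
    exact (NatTrans.naturality_apply P.base down.op q.1).trans (congrArg (rs Γ) q.2)⟩
  syn_res _ _ _ q := P.syn_restrict down q.1

/-- The value type of a Kripke predicate. -/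
def fibTy : Ty Γ where
  toFam := fibFam P
  B := B
  ty_syn w _ q := (P.syn w q.1).2.trans (congrArg (fun y => J.subP (pt Γ w y) B) q.2)

/-- The base point of an element of a fibre is forced, so the total space of the fibres is the
carrier again. -/
theorem fib_ext {w : World} {p p' : Σ x : Pt Γ w, (fibFam P).Q w x} (h : p.2.1 = p'.2.1) :
    p = p' := by
  obtain ⟨_, q, rfl⟩ := p
  obtain ⟨_, q', rfl⟩ := p'
  cases (show q = q' from h)
  rfl

/-- A Kripke predicate is isomorphic to the total space of its fibres. -/
def fibIso : P.carrier ≅ (gext (fibTy P)).left where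
  hom := mkNat (fun w q => (⟨P.base.app (op w) q, q, rfl⟩ : Σ x : Pt Γ w, (fibFam P).Q w x))
    fun _ => fib_ext P rfl
  inv := mkNat (fun w (p : Σ x : Pt Γ w, (fibFam P).Q w x) => p.2.1) fun _ => rfl
  hom_inv_id := by
    ext ⟨w⟩ q
    rfl
  inv_hom_id := by
    ext ⟨w⟩ q
    exact fib_ext P rfl

end

variable {M : Model K C}

theorem fib_realizes {Γ : M.J.Glue} {B : M.J.TyP Γ.right} (P : Predicate Γ B) :
    Realizes (gProj M) (fibTy P) P (fibIso P) :=
  ⟨by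
    ext ⟨w⟩ q
    rfl, fun _ _ => M.J.lift_var _ _ _ _⟩

/-- The computation type of an algebra. -/
def fibCTy {Γ : M.J.Glue} {Y : M.J.TyN Γ.right} (P : Model.Algebra Γ Y) : CTy Γ where
  toFam := fibFam P.toPredicate
  Y := Y
  ty_syn := (fibTy P.toPredicate).ty_syn
  act k x q := ⟨(P.act k).app (op World.top) q.1,
    (congrArg (fun f : P.carrier ⟶ Γ.left => f.app (op World.top) q.1) (P.act_base k)).trans q.2⟩
  act_zero x q := Subtype.ext
    (congrArg (fun f : P.carrier ⟶ P.carrier => f.app (op World.top) q.1) P.act_zero)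
  act_add k l x q := Subtype.ext
    (congrArg (fun f : P.carrier ⟶ P.carrier => f.app (op World.top) q.1) (P.act_add k l))
  act_res k x y h q := Subtype.ext ((NatTrans.naturality_apply (P.act k) down.op q.1).symm.trans
    (congrArg (fun f : P.carrier.obj (op World.beh) ⟶ _ => f (P.carrier.map down.op q.1))
      (P.act_beh k)))
  syn_act k x q := by
    refine (P.syn_act k World.top q.1).trans (step_congr ?_ rfl rfl)
    exact congrArg (fun x => M.J.subN (pt Γ World.top x) Y) q.2

theorem fib_act {Γ : M.J.Glue} {Y : M.J.TyN Γ.right} (P : Model.Algebra Γ Y) (k : K) :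
    P.act k ≫ (fibIso P.toPredicate).hom =
      (fibIso P.toPredicate).hom ≫ ((gModel M).stepMap (fibCTy P) k).left := by
  ext ⟨w⟩ q
  revert q
  refine wcases (motive := fun w => ∀ q : P.carrier.obj (op w),
    (P.act k ≫ (fibIso P.toPredicate).hom).app (op w) q = ((fibIso P.toPredicate).hom ≫
      ((gModel M).stepMap (fibCTy P) k).left).app (op w) q) (fun q => ?_) (fun q => ?_) w
  · exact fib_ext P.toPredicate
      (congrArg (fun f : P.carrier.obj (op World.beh) ⟶ _ => f q) (P.act_beh k))
  · exact fib_ext P.toPredicate rfl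

theorem isCanonicityModel (M : Model K C) : IsCanonicityModel (gModel M) (gProj M) where
  beh_iff _ := Iff.rfl
  valueTypes _ _ P := ⟨fibTy P, rfl, fibIso P, fib_realizes P⟩
  compTypes _ _ P := ⟨fibCTy P, rfl, fibIso P.toPredicate, fib_realizes P.toPredicate, fib_act P⟩
  bool Γ w := by
    refine Function.bijective_iff_has_inverse.2
      ⟨fun p : Σ _ : Pt Γ w, ULift Bool => (p.1, p.2.down), fun _ => rfl, fun _ => rfl⟩
  cost Γ w := by
    refine Function.bijective_iff_has_inverse.2
      ⟨fun p : Σ _ : Pt Γ w, K => (p.1, p.2), fun _ => rfl, fun _ => rfl⟩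
  free_top Γ A := by
    -- The composite substitution stores `k + 0`, the semantic `ret` having charge `0`; hence
    -- `add_zero` in both directions.
    refine Function.bijective_iff_has_inverse.2
      ⟨fun p : Σ x : Pt Γ World.top, A.Q World.top x × K => (⟨p.1, p.2.1⟩, p.2.2),
        fun p => Prod.ext rfl (add_zero p.2), fun p => ?_⟩
    exact congrArg (fun k => (⟨p.1, p.2.1, k⟩ : Σ x : Pt Γ World.top, A.Q World.top x × K))
      (add_zero p.2.2)
  free_beh Γ A := by
    refine Function.bijective_iff_has_inverse.2
      ⟨fun p : Σ x : Pt Γ World.beh, A.Q World.beh x => p, fun _ => rfl, fun _ => rfl⟩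

/-! ### Canonicity -/

/-- The empty context is terminal and `z : beh` is subterminal. -/
theorem worlds_endo (J : Judgments C) :
    ∀ (w : World) (f : J.worlds.obj w ⟶ J.worlds.obj w), f = 𝟙 _ :=
  wcases (fun _ => J.extBeh_hom_ext _ _ (J.isTerminal.hom_ext _ _))
    (fun _ => J.isTerminal.hom_ext _ _)

/-- Strict preservation of the empty context gives a point at every world; extension by the phase
keeps the one at `beh`. -/
theorem nonempty_pt {Φ : C ⥤ M.J.Glue} (ι : Hom M (gModel M) Φ) : ∀ w : World, Nonempty (Pt (Φ.obj (M.J.worlds.obj w)) w) := by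
  have h1 : ∀ w, Nonempty (Pt (Φ.obj M.J.one) w) := by
    rw [ι.H.one_obj]
    exact fun w => ⟨PUnit.unit⟩
  refine wcases ?_ (h1 _)
  have h0 : Nonempty (Pt (gextBeh (Φ.obj M.J.one)) World.beh) := h1 World.beh
  have e : Φ.obj (M.J.extBeh M.J.one) = gextBeh (Φ.obj M.J.one) := ι.H.extBeh_obj M.J.one
  rw [← e] at h0
  exact h0

section
variable {Φ : C ⥤ M.J.Glue} {ι : Hom M (gModel M) Φ}

/-- The section property makes the underlying substitution of `x`, followed by an `eqToHom`, an
endomorphism of a world, hence the identity. -/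
theorem section_tm (hι : IsSection (gProj M) ι) {w : World}
    (x : Pt (Φ.obj (M.J.worlds.obj w)) w) (a : M.J.Tm (M.J.worlds.obj w)) : M.J.subT (pt _ w x) (ι.H.tm a).t = a := by
  refine (congrArg (M.J.subT (pt _ w x)) (hι.tm a)).trans ?_
  refine (M.J.subT_comp _ _ _).symm.trans ?_
  exact (congrArg (fun f => M.J.subT f a) (worlds_endo M.J w _)).trans (M.J.subT_id a)

theorem section_tyP (hι : IsSection (gProj M) ι) {w : World}
    (x : Pt (Φ.obj (M.J.worlds.obj w)) w) (A : M.J.TyP (M.J.worlds.obj w)) :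
    M.J.subP (pt _ w x) (ι.H.tyP A).B = A := by
  refine (congrArg (M.J.subP (pt _ w x)) (hι.tyP A)).trans ?_
  refine (M.J.subP_comp _ _ _).symm.trans ?_
  exact (congrArg (fun f => M.J.subP f A) (worlds_endo M.J w _)).trans (M.J.subP_id A)

/-- The heart of canonicity: the semantic value of the interpretation of `a` names `a` itself, so
what is known about semantic values transfers to arbitrary terms. -/
theorem section_syn (hι : IsSection (gProj M) ι) {w : World}
    (x : Pt (Φ.obj (M.J.worlds.obj w)) w) {A : M.J.TyP (M.J.worlds.obj w)} (a : M.J.El A) {A' : Ty _}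
    (h : ι.H.tyP A = A') : A'.syn w x (gsec (El.cast (J := gJ M) (ι.H.el a) h) w x) = a.1 :=
  (gsec_syn _ w x).trans (section_tm hι x a.1)

theorem canonicity_bool (hι : IsSection (gProj M) ι) {w : World}
    (b : M.J.El (M.bool (M.J.worlds.obj w))) :
    ∃! c : Bool, b = M.boolLit _ c := by
  obtain ⟨x⟩ := nonempty_pt ι w
  refine ⟨_, Subtype.ext (section_syn hι x b (ι.map_bool _)).symm, ?_⟩
  rintro c rfl
  -- For uniqueness, `ι` preserves the literal, so the semantic value at `x` is `c`.
  have e : El.cast (J := gJ M) (ι.H.el (M.boolLit (M.J.worlds.obj w) c)) (ι.map_bool (M.J.worlds.obj w)) = gboolLit _ c :=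
    Subtype.ext (ι.map_boolLit (M.J.worlds.obj w) c)
  exact congrArg ULift.down (congrArg (fun a => gsec a w x) e).symm

theorem canonicity_cost (hι : IsSection (gProj M) ι) {w : World}
    (b : M.J.El (M.cost (M.J.worlds.obj w))) :
    ∃! k : K, b = M.cst _ k := by
  obtain ⟨x⟩ := nonempty_pt ι w
  refine ⟨_, Subtype.ext (section_syn hι x b (ι.map_cost _)).symm, ?_⟩
  rintro c rfl
  have e : El.cast (J := gJ M) (ι.H.el (M.cst (M.J.worlds.obj w) c)) (ι.map_cost (M.J.worlds.obj w)) = gcst _ c :=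
    Subtype.ext (ι.map_cst (M.J.worlds.obj w) c)
  exact (congrArg (fun a => gsec a w x) e).symm

end

theorem map_free {Φ : C ⥤ M.J.Glue} (ι : Hom M (gModel M) Φ) {Γ : C} (A : M.J.TyP Γ) :
    ι.H.tyP (M.U (M.F A)) = gU (gF (ι.H.tyP A)) :=
  (ι.map_U _).trans (congrArg gU (ι.map_F A))

theorem map_ret_cast {Φ : C ⥤ M.J.Glue} (ι : Hom M (gModel M) Φ) {Γ : C} {A : M.J.TyP Γ}
    (a : M.J.El A) :
    El.cast (J := gJ M) (ι.H.el (M.ret a)) (map_free ι A) = gret (ι.H.el a) :=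
  Subtype.ext (ι.map_ret a)

theorem map_step_ret {Φ : C ⥤ M.J.Glue} (ι : Hom M (gModel M) Φ) {Γ : C} {A : M.J.TyP Γ}
    (k : K) (a : M.J.El A) :
    El.cast (J := gJ M) (ι.H.el (M.step (M.cst _ k) (M.ret a))) (map_free ι A) =
      gstep (gcst _ k) (gret (ι.H.el a)) := by
  have hF : ι.H.tyN (M.F A) = gF (ι.H.tyP A) := ι.map_F A
  apply Subtype.ext
  refine (ι.map_step _ _).trans ?_
  exact step_congr (M := gModel M) hF (ι.map_cst _ k) (ι.map_ret a)

section
variable {Φ : C ⥤ M.J.Glue} {ι : Hom M (gModel M) Φ}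

/-- The semantic value of `e` is a value of `A` with a charge, and it names the required charged
return. Conversely `step k (ret a)` has as its value that of `a` with charge `k + 0`, from which
both `k` and `a` are recovered. -/
theorem canonicity_free_top (hι : IsSection (gProj M) ι)
    (A : M.J.TyP M.J.one) (e : M.J.El (M.U (M.F A))) :
    ∃! p : K × M.J.El A, e = M.step (M.cst _ p.1) (M.ret p.2) := by
  obtain ⟨x⟩ := nonempty_pt ι World.top
  have hA := section_tyP hι x A
  set p : (ι.H.tyP A).Q World.top x × K :=
    gsec (El.cast (J := gJ M) (ι.H.el e) (map_free ι A)) World.top x with hp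
  refine ⟨(p.2, ((ι.H.tyP A).el p.1).cast hA), Subtype.ext ?_, ?_⟩
  · refine (section_syn hι x e (map_free ι A)).symm.trans ?_
    exact step_congr (congrArg M.F hA) rfl (ret_congr M hA rfl)
  · rintro ⟨k, a⟩ rfl
    have h : p = (gsec (ι.H.el a) World.top x, k + 0) :=
      hp.trans (congrArg (fun a => gsec a World.top x) (map_step_ret ι k a))
    refine Prod.ext ((add_zero k).symm.trans (congrArg Prod.snd h).symm) (Subtype.ext ?_)
    refine (section_syn hι x a rfl).symm.trans ?_
    exact congrArg ((ι.H.tyP A).syn World.top x) (congrArg Prod.fst h).symm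

theorem canonicity_free_beh (hι : IsSection (gProj M) ι)
    (A : M.J.TyP (M.J.extBeh M.J.one)) (e : M.J.El (M.U (M.F A))) :
    ∃! a : M.J.El A, e = M.ret a := by
  obtain ⟨x⟩ := nonempty_pt ι World.beh
  have hA := section_tyP hι x A
  set p : (ι.H.tyP A).Q World.beh x :=
    gsec (El.cast (J := gJ M) (ι.H.el e) (map_free ι A)) World.beh x with hp
  refine ⟨((ι.H.tyP A).el p).cast hA, Subtype.ext ?_, ?_⟩
  · refine (section_syn hι x e (map_free ι A)).symm.trans ?_
    exact ret_congr M hA rfl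
  · rintro a rfl
    have h : p = gsec (ι.H.el a) World.beh x :=
      hp.trans (congrArg (fun a => gsec a World.beh x) (map_ret_cast ι a))
    refine Subtype.ext ((section_syn hι x a rfl).symm.trans ?_)
    exact congrArg ((ι.H.tyP A).syn World.beh x) h.symm

theorem canonicity (hι : IsSection (gProj M) ι) : Canonicity M where
  bool _ b := canonicity_bool hι b
  cost _ c := canonicity_cost hι c
  free_top A e := canonicity_free_top hι A e
  free_beh A e := canonicity_free_beh hι A e
  free_bool_top e := by
    obtain ⟨⟨k, a⟩, he, hu⟩ := canonicity_free_top hι _ e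
    obtain ⟨c, rfl, hc⟩ := canonicity_bool hι (w := World.top) a
    refine ⟨(k, c), he, ?_⟩
    rintro ⟨k', c'⟩ h
    have h' := hu (k', M.boolLit _ c') h
    exact Prod.ext (congrArg Prod.fst h' :) (hc c' (congrArg Prod.snd h').symm)
  free_bool_beh e := by
    obtain ⟨a, he, hu⟩ := canonicity_free_beh hι _ e
    obtain ⟨c, rfl, hc⟩ := canonicity_bool hι (w := World.beh) a
    exact ⟨c, he, fun c' h => hc c' (hu (M.boolLit _ c') h).symm⟩

end

/-- Unpacks an equality of functor-and-morphism pairs into the section equations, which are stated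
along `eqToHom`. -/
theorem section_of_eq {Φ : C ⥤ M.J.Glue} (ι : Hom M (gModel M) Φ)
    (h : (⟨Φ ⋙ M.J.proj, compHom ι⟩ : Σ Ψ : C ⥤ C, Hom M M Ψ) = ⟨𝟭 C, idHom M⟩) :
    IsSection (gProj M) ι := by
  -- The pair is generalized to a variable so that the equality can be eliminated.
  have key : ∀ s : Σ Ψ : C ⥤ C, Hom M M Ψ, s = ⟨𝟭 C, idHom M⟩ → ∃ hp : s.1 = 𝟭 C,
      (∀ {Γ : C} (A : M.J.TyP Γ),
        s.2.H.tyP A = M.J.subP (eqToHom (Functor.congr_obj hp Γ)) A) ∧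
      (∀ {Γ : C} (X : M.J.TyN Γ),
        s.2.H.tyN X = M.J.subN (eqToHom (Functor.congr_obj hp Γ)) X) ∧
      (∀ {Γ : C} (a : M.J.Tm Γ),
        s.2.H.tm a = M.J.subT (eqToHom (Functor.congr_obj hp Γ)) a) := by
    rintro _ rfl
    exact ⟨rfl, fun _ => (M.J.subP_id _).symm, fun _ => (M.J.subN_id _).symm,
      fun _ => (M.J.subT_id _).symm⟩
  obtain ⟨hp, h1, h2, h3⟩ := key _ h
  exact ⟨hp, h1, h2, h3⟩

end

end Gluing
end Calf

theorem mainTheorem2 {K : Type u} [AddMonoid K] {C : Type (u + 1)} [CategoryTheory.Category.{u} C]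
    (M : Calf.Model K C) :
    ∃ (G : Calf.Model K M.J.Glue) (π : Calf.Hom G M M.J.proj),
      Calf.IsCanonicityModel G π ∧
      (∀ (Φ : C ⥤ M.J.Glue) (ι : Calf.Hom M G Φ), Calf.IsSection π ι → Calf.Canonicity M) ∧
      (M.IsInitial →
        (∃! s : Σ Φ : C ⥤ M.J.Glue, Calf.Hom M G Φ, Calf.IsSection π s.2) ∧
        Calf.Canonicity M) := by
  refine ⟨Calf.Gluing.gModel M, Calf.Gluing.gProj M, Calf.Gluing.isCanonicityModel M,
    fun Φ ι hι => Calf.Gluing.canonicity hι, fun hM => ?_⟩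
  obtain ⟨u⟩ := hM M.J.Glue (Calf.Gluing.gModel M)
  obtain ⟨v⟩ := hM C M
  -- The composite with the projection and the identity are both endomorphisms of the initial model,
  -- so they coincide.
  have hs : Calf.IsSection (Calf.Gluing.gProj M) u.default.2 :=
    Calf.Gluing.section_of_eq _ ((v.uniq _).trans (v.uniq _).symm)
  exact ⟨⟨u.default, hs, fun s _ => u.uniq s⟩, Calf.Gluing.canonicity hs⟩
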